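/- For each sample size $n\ge1$ let $d=d_n\in\mathbb N$ and let $X_t=(x_{t,1},\dots,x_{t,d})^\top$ follow the time-varying VAR(1) model $$X_t=\mathbf A(\tau_t)X_{t-1}+e_t,\qquad e_t=\boldsymbol\Sigma(\tau_t)^{1/2}\varepsilon_t,\qquad \tau_t=t/n,\quad 1\le t\le n,$$ with $\mathbf A(\tau)=[\alpha_{ij}(\tau)]_{d\times d}$ and locally stationary solution $X_t=\sum_{k\ge0}\boldsymbol\Phi_{t,k}e_{t-k}$ $(0\le t\le n)$, $\boldsymbol\Phi_{t,0}=\mathbf I_d$, $\boldsymbol\Phi_{t,k}=\mathbf A(\tau_t)\mathbf A(\tau_{t-1})\cdots\mathbf A(\tau_{t-k+1})$. (All objects may depend on $n$, except the kernel $K$ and the constants named below; before time $0$ the functions $\mathbf A,\boldsymbol\Sigma$ are extended to $\tau<0$ with $\boldsymbol\Sigma(\tau)$ positive semidefinite and bounded in operator norm by the constant $C$ of Assumption 1.) Index sets: $\mathcal J_i(\tau)=\{j:\alpha_{ij}(\tau)\ne0\}$, $\mathcal J_i'(\tau)=\{j:\alpha_{ij}'(\tau)\ne0\}$, $\mathcal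 J_i=\bigcup_{t=1}^n\mathcal J_i(\tau_t)$, $\mathcal J_i'=\bigcup_{t=1}^n\mathcal J'_i(\tau_t)$, $s=\max_i|\mathcal J_i|$, and $D_{i,j}^2=\sum_{t=1}^n[\alpha_{ij}(\tau_t)-\frac1n\sum_{r=1}^n\alpha_{ij}(\tau_r)]^2$. Estimators. With $K_h(x)=K(x/h)/h$ and $h>0$, let $$\mathcal L_i(\alpha,\beta\mid\tau)=\frac1n\sum_{t=1}^n\{x_{t,i}-[\alpha+\beta(\tau_t-\tau)]^\top X_{t-1}\}^2K_h(\tau_t-\tau).$$ First stage: for each $i,t$, $(\widetilde\alpha_{i,\cdot}(\tau_t),\widetilde\alpha'_{i,\cdot}(\tau_t))$ is any minimiser of $\mathcal L_i(\alpha,\beta\mid\tau_t)+\lambda_1(|\alpha|_1+h|\beta|_1)$, $\lambda_1>0$. Let $\widetilde D_{i,j}$ be $D_{i,j}$ computed from $\widetilde\alpha_{i,j}$, and $p'_\lambda(z)=\lambda\{I(z\le\lambda)+\frac{(a_0\lambda-z)_+}{(a_0-1)\lambda}I(z>\lambda)\}$, $a_0=3.7$. Second stage: for each $i$, $(\widehat\alpha_{ij}(\tau_t),\widehat\alpha'_{ij}(\tau_t))_{t\le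 n,\,j\le d}$ is any minimiser over $n\times d$ arrays $(\alpha_{j|t}),(\beta_{j|t})$ of $$\sum_{t=1}^n\mathcal L_i(\alpha_{\cdot|t},\beta_{\cdot|t}\mid\tau_t)+\sum_{j=1}^d p'_{\lambda_2}\Big(\big(\textstyle\sum_t\widetilde\alpha_{i,j}(\tau_t)^2\big)^{1/2}\Big)\big(\textstyle\sum_t\alpha_{j|t}^2\big)^{1/2}+\sum_{j=1}^d p'_{\lambda_2}(\widetilde D_{i,j})\,h\big(\textstyle\sum_t\beta_{j|t}^2\big)^{1/2},\qquad\lambda_2>0.$$ Put $$\mathbb E_n^G=\{(i,j):\exists t\in\{1,\dots,n\},\ \alpha_{ij}(\tau_t)\ne0\},\qquad \widehat{\mathbb E}_n^G=\Big\{(i,j):\sum_{t=1}^n\widehat\alpha_{ij}(\tau_t)^2>0\Big\}.$$ Assume, with positive constants $M,C_1,c,C,\iota_1,C_0,\kappa_0$ and $\rho\in(0,1)$ not depending on $n$: 1. (i) $\det(\mathbf I_d-\mathbf A(\tau)z)\ne0$ for all $\tau\in[0,1]$ and complex $|z|\le1$; the entries of $\mathbf A$ are $C^2$ on $[0,1]$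 with second derivatives bounded by $M$; $\|\boldsymbol\Phi_{t,k}\|\le C_1\rho^k$ for all $k\ge0$, $0\le t\le n$. (ii) For $\tau\in[0,1]$, $\boldsymbol\Sigma(\tau)$ and $\boldsymbol\Omega(\tau)=\boldsymbol\Sigma(\tau)^{-1}$ are uniformly positive definite ($\boldsymbol\Sigma(\tau)\succeq c\,\mathbf I_d$, $\boldsymbol\Omega(\tau)\succeq c\,\mathbf I_d$), $\|\boldsymbol\Sigma(\tau)\|\le C$, and all their entries are $C^2$ on $[0,1]$. (iii) $(\varepsilon_t)_{t\in\mathbb Z}$ is i.i.d. with mean $0$, covariance $\mathbf I_d$, and $\mathsf E\exp\{\iota_1(u^\top\varepsilon_t)^2\}\le C_0$ for all $\|u\|=1$. 2. $K$ is a bounded continuous symmetric probability density supported in $[-1,1]$; $nh/\log^2(n\vee d)\to\infty$; $sh^2\log(n\vee d)\to0$; and $s\ge1$ for all large $n$. 3. (i) $\zeta_{n,d}:=\log(n\vee d)[(nh)^{-1/2}+sh^2]=o(\lambda_1)$ and $\sqrt s\,\lambda_1/h\to0$. (ii) With probability approaching one, $u^\top\boldsymbol\Psi(\tau_t)u\ge\kappa_0$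 for all $1\le i\le d$, $1\le t\le n$ and $u\in\mathcal B_i(\tau_t)$, where $\boldsymbol\Psi(\tau)=\begin{pmatrix}\boldsymbol\Psi_0&\boldsymbol\Psi_1\\ \boldsymbol\Psi_1&\boldsymbol\Psi_2\end{pmatrix}(\tau)$, $\boldsymbol\Psi_k(\tau)=\frac1n\sum_{t=1}^n(\frac{\tau_t-\tau}h)^kX_{t-1}X_{t-1}^\top K_h(\tau_t-\tau)$, and $\mathcal B_i(\tau)$ is the set of $u=(u_1^\top,u_2^\top)^\top\in\mathbb R^{2d}$ with $\|u_1\|^2+\|u_2\|^2=1$ and $|u_1|_1+|u_2|_1\le3(\sum_{j\in\mathcal J_i(\tau)}|u_{1,j}|+\sum_{j\in\mathcal J_i'(\tau)}|u_{2,j}|)$. 4. (i) $\sqrt n\,s\log(n\vee d)\,\zeta_{n,d}+\sqrt{ns}\,\lambda_1=o(\lambda_2)$. (ii) For all large $n$: $(\sum_{t=1}^n\alpha_{ij}^2(\tau_t))^{1/2}\ge(a_0+1)\lambda_2$ for all $i$ and $j\in\mathcal J_i$, and $D_{i,j}\ge(a_0+1)\lambda_2$ for all $i$ and $j\in\mathcal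 J_i'$. Then $$\mathsf P\big(\widehat{\mathbb E}_n^G=\mathbb E_n^G\big)\to1\qquad(n\to\infty).$$ -/

import Mathlib

open MeasureTheory ProbabilityTheory Filter Topology Asymptotics Set
open scoped Matrix Matrix.Norms.L2Operator MatrixOrder

noncomputable section

namespace TVNet

/-! ### The time-varying VAR(1) model -/

/-- The scaled time `t / n` of an integer time `t`. -/
def scaledTime (n : ℕ) (t : ℤ) : ℝ := (t : ℝ) / n

/-- The innovation `e_t = Σ(t/n)^{1/2} ε_t`, where `Σ^{1/2}` is the positive semidefinite
square root. -/
def innovation {d : ℕ} (n : ℕ) (Sig : ℝ → Matrix (Fin d) (Fin d) ℝ) (eps : ℤ → Fin d → ℝ)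
    (t : ℤ) : Fin d → ℝ :=
  CFC.sqrt (Sig (scaledTime n t)) *ᵥ eps t

/-- The moving-average coefficients `Φ_{t,0} = I` and
`Φ_{t,k} = A(t/n) A((t-1)/n) ⋯ A((t-k+1)/n)`. -/
def woldCoef {d : ℕ} (n : ℕ) (A : ℝ → Matrix (Fin d) (Fin d) ℝ) :
    ℕ → ℤ → Matrix (Fin d) (Fin d) ℝ
  | 0, _ => 1
  | k + 1, t => A (scaledTime n t) * woldCoef n A k (t - 1)

/-- Second-order continuous differentiability on `[0,1]` of every entry of a matrix function. -/
def EntrywiseC2 {d : ℕ} (W : ℝ → Matrix (Fin d) (Fin d) ℝ) : Prop :=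
  ∀ i j, ContDiffOn ℝ 2 (fun τ => W τ i j) (Icc 0 1)

/-- `(ε_t)` is i.i.d. with mean zero, identity covariance matrix and
`E exp(ι₁ (uᵀ ε_t)²) ≤ C₀` for every Euclidean unit vector `u`. -/
structure IsInnovationSequence {Ω : Type*} [MeasurableSpace Ω] (P : Measure Ω) {d : ℕ}
    (eps : ℤ → Ω → Fin d → ℝ) (ι₁ C₀ : ℝ) : Prop where
  measurable : ∀ t, Measurable (eps t)
  indep : iIndepFun eps P
  identDistrib : ∀ t, IdentDistrib (eps t) (eps 0) P P
  mean_zero : ∀ t i, ∫ ω, eps t ω i ∂P = 0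
  cov_one : ∀ t i j, ∫ ω, eps t ω i * eps t ω j ∂P = if i = j then 1 else 0
  subGaussian : ∀ t (u : Fin d → ℝ), ∑ i, u i ^ 2 = 1 →
    ∫⁻ ω, ENNReal.ofReal (Real.exp (ι₁ * (u ⬝ᵥ eps t ω) ^ 2)) ∂P ≤ ENNReal.ofReal C₀

/-- `X_0, …, X_n` follows the time-varying VAR(1) model
`X_t = A(t/n) X_{t-1} + Σ(t/n)^{1/2} ε_t` (`1 ≤ t ≤ n`) and is the locally stationary solution
`X_t = ∑_k Φ_{t,k} e_{t-k}` (`0 ≤ t ≤ n`). The values of `A` and `Σ` at negative arguments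
describe the dynamics before time `0`. -/
structure IsTVVAR {Ω : Type*} [MeasurableSpace Ω] (P : Measure Ω) {d : ℕ} (n : ℕ)
    (A Sig : ℝ → Matrix (Fin d) (Fin d) ℝ) (eps : ℤ → Ω → Fin d → ℝ)
    (X : ℤ → Ω → Fin d → ℝ) : Prop where
  recursion : ∀ t : ℤ, 1 ≤ t → t ≤ n → ∀ᵐ ω ∂P,
    X t ω = A (scaledTime n t) *ᵥ X (t - 1) ω + innovation n Sig (fun s => eps s ω) t
  wold : ∀ t : ℤ, 0 ≤ t → t ≤ n → ∀ᵐ ω ∂P,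
    HasSum (fun k : ℕ => woldCoef n A k t *ᵥ innovation n Sig (fun s => eps s ω) (t - k)) (X t ω)

/-- Stability and smoothness of the transition matrix, with geometrically decaying
moving-average coefficients. -/
structure TransitionRegular {d : ℕ} (n : ℕ) (A : ℝ → Matrix (Fin d) (Fin d) ℝ)
    (M C₁ ρ : ℝ) : Prop where
  stable : ∀ τ ∈ Icc (0 : ℝ) 1, ∀ z : ℂ, ‖z‖ ≤ 1 →
    (1 - z • (A τ).map (fun a : ℝ => (a : ℂ))).det ≠ 0
  smooth : EntrywiseC2 A
  secondDeriv_le : ∀ i j, ∀ τ ∈ Icc (0 : ℝ) 1,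
    |iteratedDerivWithin 2 (fun σ => A σ i j) (Icc 0 1) τ| ≤ M
  decay : ∀ (k : ℕ) (t : ℤ), 0 ≤ t → t ≤ n → ‖woldCoef n A k t‖ ≤ C₁ * ρ ^ k

/-- Uniform positive definiteness, boundedness and smoothness of the volatility matrix `Σ(·)` and
of the precision matrix `Ω(·) = Σ(·)⁻¹`. For arguments `τ < 0` (before the sample) only
semidefiniteness and boundedness are required. -/
structure VolatilityRegular {d : ℕ} (Sig : ℝ → Matrix (Fin d) (Fin d) ℝ) (c C : ℝ) : Prop where
  posSemidef : ∀ τ ≤ 1, (Sig τ).PosSemidef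
  norm_le : ∀ τ ≤ 1, ‖Sig τ‖ ≤ C
  sigma_posDef : ∀ τ ∈ Icc (0 : ℝ) 1, (Sig τ - c • 1).PosSemidef
  omega_posDef : ∀ τ ∈ Icc (0 : ℝ) 1, ((Sig τ)⁻¹ - c • 1).PosSemidef
  smooth_sigma : EntrywiseC2 Sig
  smooth_omega : EntrywiseC2 fun τ => (Sig τ)⁻¹

/-! ### The estimators -/

/-- The grid point `τ_{t+1} = (t+1)/n`, `t = 0, …, n-1`. An index `t : Fin n` stands for the
observation time `t+1`. -/
def tau (n : ℕ) (t : Fin n) : ℝ := scaledTime n ((t : ℤ) + 1)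

/-- `K_h(x) = K(x/h)/h`. -/
def scaledKernel (K : ℝ → ℝ) (h x : ℝ) : ℝ := K (x / h) / h

/-- Euclidean norm of a finite family of reals. -/
def l2 {ι : Type*} [Fintype ι] (v : ι → ℝ) : ℝ := √(∑ t, v t ^ 2)

/-- Euclidean norm of the deviations from the average. -/
def l2dev {n : ℕ} (v : Fin n → ℝ) : ℝ := l2 fun t => v t - (1 / (n : ℝ)) * ∑ s, v s

/-- The local linear objective `L_i(α, β | τ)` for the realisation `x` of the series. -/
def locLinLoss {d : ℕ} (n : ℕ) (K : ℝ → ℝ) (h : ℝ) (x : ℤ → Fin d → ℝ) (i : Fin d)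
    (τ : ℝ) (α β : Fin d → ℝ) : ℝ :=
  (1 / (n : ℝ)) * ∑ t : Fin n,
    (x ((t : ℤ) + 1) i - ∑ j, (α j + β j * (tau n t - τ)) * x (t : ℤ) j) ^ 2 *
      scaledKernel K h (tau n t - τ)

/-- The first-stage LASSO objective `L_i^*(α, β | τ)`. -/
def lassoObj {d : ℕ} (n : ℕ) (K : ℝ → ℝ) (h lam : ℝ) (x : ℤ → Fin d → ℝ) (i : Fin d)
    (τ : ℝ) (α β : Fin d → ℝ) : ℝ :=
  locLinLoss n K h x i τ α β + lam * (∑ j, |α j| + h * ∑ j, |β j|)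

/-- The SCAD constant. -/
def a₀ : ℝ := 3.7

/-- The derivative `p'_λ(z)` of the SCAD penalty. -/
def scadDeriv (lam z : ℝ) : ℝ :=
  lam * (if z ≤ lam then 1 else max (a₀ * lam - z) 0 / ((a₀ - 1) * lam))

/-- The weighted group LASSO objective `Q_i(𝐀, 𝐁)`; `prelim t j` is the first-stage estimate of
the `j`-th coefficient at the grid point `t`. -/
def groupLassoObj {d : ℕ} (n : ℕ) (K : ℝ → ℝ) (h lam : ℝ) (x : ℤ → Fin d → ℝ) (i : Fin d)
    (prelim : Fin n → Fin d → ℝ) (α β : Fin n → Fin d → ℝ) : ℝ :=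
  ∑ t, locLinLoss n K h x i (tau n t) (α t) (β t)
    + ∑ j, scadDeriv lam (l2 fun t => prelim t j) * l2 (fun t => α t j)
    + ∑ j, scadDeriv lam (l2dev fun t => prelim t j) * l2 (fun t => h * β t j)

/-- `(α, β)` minimises the first-stage objectives of all equations at all grid points
(`α i t j` is the estimate for the `(i,j)` coefficient at the grid point `t`). -/
def IsPrelimEstimate {d : ℕ} (n : ℕ) (K : ℝ → ℝ) (h lam : ℝ) (x : ℤ → Fin d → ℝ)
    (α β : Fin d → Fin n → Fin d → ℝ) : Prop :=
  ∀ i t (a b : Fin d → ℝ),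
    lassoObj n K h lam x i (tau n t) (α i t) (β i t) ≤ lassoObj n K h lam x i (tau n t) a b

/-- `(α, β)` minimises the weighted group LASSO objectives of all equations. -/
def IsGroupLassoEstimate {d : ℕ} (n : ℕ) (K : ℝ → ℝ) (h lam : ℝ) (x : ℤ → Fin d → ℝ)
    (prelim α β : Fin d → Fin n → Fin d → ℝ) : Prop :=
  ∀ i (a b : Fin n → Fin d → ℝ),
    groupLassoObj n K h lam x i (prelim i) (α i) (β i) ≤
      groupLassoObj n K h lam x i (prelim i) a b

/-! ### Index sets, sparsity, and the networks -/

/-- The derivative `α'_{ij}(τ)` of the coefficient function on `[0,1]`. -/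
def coefDeriv {d : ℕ} (A : ℝ → Matrix (Fin d) (Fin d) ℝ) (τ : ℝ) (i j : Fin d) : ℝ :=
  derivWithin (fun σ => A σ i j) (Icc 0 1) τ

open Classical in
/-- `J_i(τ)`. -/
def suppAt {d : ℕ} (A : ℝ → Matrix (Fin d) (Fin d) ℝ) (i : Fin d) (τ : ℝ) : Finset (Fin d) :=
  Finset.univ.filter fun j => A τ i j ≠ 0

open Classical in
/-- `J'_i(τ)`. -/
def derivSuppAt {d : ℕ} (A : ℝ → Matrix (Fin d) (Fin d) ℝ) (i : Fin d) (τ : ℝ) :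
    Finset (Fin d) :=
  Finset.univ.filter fun j => coefDeriv A τ i j ≠ 0

/-- `J_i = ⋃_t J_i(τ_t)`. -/
def supp {d : ℕ} (n : ℕ) (A : ℝ → Matrix (Fin d) (Fin d) ℝ) (i : Fin d) : Finset (Fin d) :=
  Finset.univ.biUnion fun t : Fin n => suppAt A i (tau n t)

/-- `J'_i = ⋃_t J'_i(τ_t)`. -/
def derivSupp {d : ℕ} (n : ℕ) (A : ℝ → Matrix (Fin d) (Fin d) ℝ) (i : Fin d) :
    Finset (Fin d) :=
  Finset.univ.biUnion fun t : Fin n => derivSuppAt A i (tau n t)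

/-- `s = max_i |J_i|`. -/
def sparsity {d : ℕ} (n : ℕ) (A : ℝ → Matrix (Fin d) (Fin d) ℝ) : ℕ :=
  Finset.univ.sup fun i => (supp n A i).card

/-- `log (n ∨ d)`. -/
def logMax (n d : ℕ) : ℝ := Real.log (max n d : ℕ)

/-- `ζ_{n,d} = log(n ∨ d) [(nh)^{-1/2} + s h²]`. -/
def zeta (n d s : ℕ) (h : ℝ) : ℝ := logMax n d * (1 / √(n * h) + s * h ^ 2)

/-- The matrix `Ψ_k(τ)`. -/
def PsiBlock {d : ℕ} (n : ℕ) (K : ℝ → ℝ) (h : ℝ) (x : ℤ → Fin d → ℝ) (τ : ℝ) (k : ℕ) :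
    Matrix (Fin d) (Fin d) ℝ :=
  (1 / (n : ℝ)) • ∑ t : Fin n,
    (((tau n t - τ) / h) ^ k * scaledKernel K h (tau n t - τ)) •
      Matrix.vecMulVec (x (t : ℤ)) (x (t : ℤ))

/-- The matrix `Ψ(τ)` with blocks `Ψ_0, Ψ_1, Ψ_1, Ψ_2`. -/
def Psi {d : ℕ} (n : ℕ) (K : ℝ → ℝ) (h : ℝ) (x : ℤ → Fin d → ℝ) (τ : ℝ) :
    Matrix (Fin d ⊕ Fin d) (Fin d ⊕ Fin d) ℝ :=
  Matrix.fromBlocks (PsiBlock n K h x τ 0) (PsiBlock n K h x τ 1)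
    (PsiBlock n K h x τ 1) (PsiBlock n K h x τ 2)

/-- The set `B_i(τ)` of unit vectors `u = (u₁, u₂)` in the restricted cone. -/
def restrictedCone {d : ℕ} (A : ℝ → Matrix (Fin d) (Fin d) ℝ) (i : Fin d) (τ : ℝ) :
    Set (Fin d ⊕ Fin d → ℝ) :=
  {u | ∑ j, u (.inl j) ^ 2 + ∑ j, u (.inr j) ^ 2 = 1 ∧
    ∑ j, (|u (.inl j)| + |u (.inr j)|) ≤
      3 * (∑ j ∈ suppAt A i τ, |u (.inl j)| + ∑ j ∈ derivSuppAt A i τ, |u (.inr j)|)}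

/-- The restricted eigenvalue inequality with constant `κ₀`, at all grid points and for all
equations. -/
def RestrictedEigenvalue {d : ℕ} (n : ℕ) (K : ℝ → ℝ) (h : ℝ)
    (A : ℝ → Matrix (Fin d) (Fin d) ℝ) (x : ℤ → Fin d → ℝ) (κ₀ : ℝ) : Prop :=
  ∀ (i : Fin d) (t : Fin n), ∀ u ∈ restrictedCone A i (tau n t),
    κ₀ ≤ u ⬝ᵥ (Psi n K h x (tau n t) *ᵥ u)

/-- The kernel conditions: a continuous symmetric probability density supported in `[-1,1]`
(such a function is bounded). -/
structure IsKernel (K : ℝ → ℝ) : Prop where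
  continuous : Continuous K
  nonneg : ∀ x, 0 ≤ K x
  symm : ∀ x, K (-x) = K x
  support : ∀ x, 1 < |x| → K x = 0
  integral_one : ∫ x, K x = 1

/-- The lower bounds on the significant coefficients and on their deviations. -/
def MinimalSignal {d : ℕ} (n : ℕ) (A : ℝ → Matrix (Fin d) (Fin d) ℝ) (lam : ℝ) : Prop :=
  ∀ i, (∀ j ∈ supp n A i, (a₀ + 1) * lam ≤ l2 fun t : Fin n => A (tau n t) i j) ∧
    (∀ j ∈ derivSupp n A i, (a₀ + 1) * lam ≤ l2dev fun t : Fin n => A (tau n t) i j)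

/-- The uniform Granger-causality edge set `E_n^G`. -/
def grangerEdges {d : ℕ} (n : ℕ) (A : ℝ → Matrix (Fin d) (Fin d) ℝ) : Set (Fin d × Fin d) :=
  {e | ∃ t : Fin n, A (tau n t) e.1 e.2 ≠ 0}

/-- The estimated edge set: the pairs whose estimated coefficient path is not zero. -/
def estimatedEdges {d n : ℕ} (α : Fin d → Fin n → Fin d → ℝ) : Set (Fin d × Fin d) :=
  {e | 0 < ∑ t, α e.1 t e.2 ^ 2}

/-- The events `E n` hold with probability approaching one. The complement is measured, so that
this is also the right notion for events that are not known to be measurable. -/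
def WithProbApproachingOne {Ω : ℕ → Type*} [∀ n, MeasurableSpace (Ω n)]
    (P : ∀ n, Measure (Ω n)) (E : ∀ n, Set (Ω n)) : Prop :=
  Tendsto (fun n => P n (E n)ᶜ) atTop (𝓝 0)

end TVNet

end

/-! Write L = log(n∨d). All randomness is confined to the event `GoodPath`, whose complement has
probability at most 22/(n∨d) (`measure_not_goodPath_le`). On this event, for all large n, the two
edge sets agree deterministically, whichever minimisers are chosen
(`LocalRegular.estimatedEdges_eq`).

Probability. The event bounds the series by a multiple of √L, and bounds kernel-weighted sums of
(past-measurable factor) × (centred function of the next innovation) by a multiple of L/√(nh). The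
weights are O(1/(nh)) and their squares sum to O(1/(nh)), so a Chernoff bound with parameter √(nh),
proved by integrating out one innovation at a time (`lintegral_exp_sum_le`), is strong enough for a
union over 3nd² sums.

Curvature. With X_{r+1} = y + e, y = A X_r, and any vector b, (b·X_{r+1})² ≥ 2(b·y)(b·e) + (b·e)².
The right side has conditional mean bᵀΣb ≥ c|b|², and its fluctuation is controlled by the event.
With a lower bound for the deterministic kernel design this gives localQuad(v) ≥ κ|v|² − δ|v|₁² for
some κ > 0 and δ of order L/√(nh) (`GoodPath.le_localQuad`). The rates give δs → 0, so the second
term is harmless on sparse cones.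

Optimisation. The score at the true coefficients is noise plus Taylor bias, a multiple of ζ, hence
at most λ₁/6. The LASSO error at each grid point is then O(λ₁√s), so coefficient paths are off by
O(√(ns)λ₁) = o(λ₂) in Euclidean norm. With the minimal signal this makes every SCAD weight exactly 0
on the support and exactly λ₂ off it (`prelim_scadDeriv`). The second stage is therefore a group
LASSO with oracle weights. Its path errors are O(ζ√(ns)) = o(λ₂), too small to erase an active path.
An inactive path must vanish, since shrinking it would save more penalty than it could cost in loss
(`groupLasso_eq_zero`). -/

noncomputable section

namespace TVNet

/-! ### Exponential moments -/

/-- `E exp(θ Y) ≤ exp(σ θ²)` for all `|θ| ≤ ℓ`. -/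
def HasMGFBound {Ω : Type*} [MeasurableSpace Ω] (P : Measure Ω) (Y : Ω → ℝ) (σ ℓ : ℝ) : Prop :=
  ∀ θ : ℝ, |θ| ≤ ℓ →
    ∫⁻ ω, ENNReal.ofReal (Real.exp (θ * Y ω)) ∂P ≤ ENNReal.ofReal (Real.exp (σ * θ ^ 2))

/-- A second-order bound with no restriction on x: Taylor's formula for |x| ≤ 1, and beyond that the
quadratic term alone dominates. Keeping the linear term exact lets centring remove it after
integration. -/
theorem exp_le_one_add_add_sq_mul_exp_abs (x : ℝ) :
    Real.exp x ≤ 1 + x + x ^ 2 * Real.exp |x| := by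
  have h1 : 1 ≤ Real.exp |x| := Real.one_le_exp (abs_nonneg x)
  rcases le_or_gt |x| 1 with h | h
  · have := (abs_le.1 (Real.abs_exp_sub_one_sub_id_le h)).2
    nlinarith [sq_nonneg x]
  · rcases le_or_gt 0 x with h0 | h0
    · rw [abs_of_nonneg h0] at h h1 ⊢
      nlinarith [mul_nonneg (by nlinarith : (0 : ℝ) ≤ x ^ 2 - 1) (Real.exp_pos x).le]
    · rw [abs_of_neg h0] at h h1 ⊢
      have : Real.exp x ≤ 1 := Real.exp_le_one_iff.2 h0.le
      nlinarith [sq_nonneg x]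

section MGF

variable {Ω : Type*} [mΩ : MeasurableSpace Ω] {P : Measure Ω}

theorem lintegral_ofReal_mul_le {f g : Ω → ℝ} {c K : ℝ} (hc : 0 ≤ c)
    (hfg : ∀ ω, f ω ≤ c * g ω)
    (h : ∫⁻ ω, ENNReal.ofReal (g ω) ∂P ≤ ENNReal.ofReal K) :
    ∫⁻ ω, ENNReal.ofReal (f ω) ∂P ≤ ENNReal.ofReal (c * K) := by
  calc ∫⁻ ω, ENNReal.ofReal (f ω) ∂P
      ≤ ∫⁻ ω, ENNReal.ofReal c * ENNReal.ofReal (g ω) ∂P := by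
        refine lintegral_mono fun ω => ?_
        rw [← ENNReal.ofReal_mul hc]
        exact ENNReal.ofReal_le_ofReal (hfg ω)
    _ = ENNReal.ofReal c * ∫⁻ ω, ENNReal.ofReal (g ω) ∂P :=
        lintegral_const_mul' _ _ ENNReal.ofReal_ne_top
    _ ≤ ENNReal.ofReal c * ENNReal.ofReal K := by gcongr
    _ = _ := (ENNReal.ofReal_mul hc).symm

theorem integrable_of_lintegral_ofReal_le {g : Ω → ℝ} (hg : Measurable g) (h0 : ∀ ω, 0 ≤ g ω)
    {K : ℝ} (h : ∫⁻ ω, ENNReal.ofReal (g ω) ∂P ≤ ENNReal.ofReal K) : Integrable g P := by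
  refine ⟨hg.aestronglyMeasurable, ?_⟩
  rw [hasFiniteIntegral_iff_ofReal (Eventually.of_forall h0)]
  exact h.trans_lt ENNReal.ofReal_lt_top

theorem integrable_of_exp_moment {W : Ω → ℝ} (hW : Measurable W) {a K : ℝ} (ha : 0 < a)
    (hK : ∫⁻ ω, ENNReal.ofReal (Real.exp (a * |W ω|)) ∂P ≤ ENNReal.ofReal K) :
    Integrable W P := by
  have hexp : Integrable (fun ω => Real.exp (a * |W ω|)) P :=
    integrable_of_lintegral_ofReal_le (by fun_prop) (fun ω => (Real.exp_pos _).le) hK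
  refine (hexp.const_mul (1 / a)).mono' hW.aestronglyMeasurable
    (Eventually.of_forall fun ω => ?_)
  rw [Real.norm_eq_abs, one_div, inv_mul_eq_div, le_div_iff₀ ha]
  linarith [Real.add_one_le_exp (a * |W ω|)]

/-- `ENNReal.ofReal` forgets the sign of K. Since the integrand is at least 1 and the total mass is
1, the bound itself forces K to be a genuine positive constant. -/
theorem one_le_of_exp_moment [IsProbabilityMeasure P] {W : Ω → ℝ} {a K : ℝ} (ha : 0 ≤ a)
    (hK : ∫⁻ ω, ENNReal.ofReal (Real.exp (a * |W ω|)) ∂P ≤ ENNReal.ofReal K) : 1 ≤ K := by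
  have h1 : (1 : ENNReal) ≤ ∫⁻ ω, ENNReal.ofReal (Real.exp (a * |W ω|)) ∂P := by
    calc (1 : ENNReal) = ∫⁻ _, 1 ∂P := by simp
      _ ≤ _ := lintegral_mono fun ω => by
        rw [← ENNReal.ofReal_one]
        exact ENNReal.ofReal_le_ofReal (Real.one_le_exp (by positivity))
  have := h1.trans hK
  rw [← ENNReal.ofReal_one, ENNReal.ofReal_le_ofReal_iff'] at this
  exact this.resolve_right (by norm_num)

/-- In exp(θW) ≤ 1 + θW + θ²W² exp|θW| the linear term has mean zero. Half of the exponential moment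
pays for W², through (a|W|/2)²/2 ≤ exp(a|W|/2), whence 8/a²; the other half pays for exp|θW|, whence
the range |θ| ≤ a/2. -/
theorem hasMGFBound_of_exp_moment [IsProbabilityMeasure P] {W : Ω → ℝ} (hW : Measurable W)
    {a K : ℝ} (ha : 0 < a)
    (hK : ∫⁻ ω, ENNReal.ofReal (Real.exp (a * |W ω|)) ∂P ≤ ENNReal.ofReal K)
    (hmean : ∫ ω, W ω ∂P = 0) : HasMGFBound P W (8 * K / a ^ 2) (a / 2) := by
  intro θ hθ
  have hK1 : 1 ≤ K := one_le_of_exp_moment ha.le hK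
  have hexp : Integrable (fun ω => Real.exp (a * |W ω|)) P :=
    integrable_of_lintegral_ofReal_le (by fun_prop) (fun ω => (Real.exp_pos _).le) hK
  have hexpK : ∫ ω, Real.exp (a * |W ω|) ∂P ≤ K := by
    rw [← ofReal_integral_eq_lintegral_ofReal hexp
      (Eventually.of_forall fun ω => (Real.exp_pos _).le), ENNReal.ofReal_le_ofReal_iff'] at hK
    exact hK.elim id fun h => h.trans (by linarith)
  have hWint : Integrable W P := integrable_of_exp_moment hW ha hK
  have hpt : ∀ ω, Real.exp (θ * W ω) ≤
      1 + θ * W ω + θ ^ 2 * (8 / a ^ 2) * Real.exp (a * |W ω|) := by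
    intro ω
    have h1 := exp_le_one_add_add_sq_mul_exp_abs (θ * W ω)
    have h2 : Real.exp |θ * W ω| ≤ Real.exp (a / 2 * |W ω|) := by
      rw [abs_mul]; gcongr
    have h3 : (W ω) ^ 2 ≤ 8 / a ^ 2 * Real.exp (a / 2 * |W ω|) := by
      have h4 := Real.quadratic_le_exp_of_nonneg (x := a / 2 * |W ω|) (by positivity)
      have h5 : 0 ≤ a / 2 * |W ω| := by positivity
      have h6 : (a / 2 * |W ω|) ^ 2 / 2 = a ^ 2 / 8 * (W ω) ^ 2 := by
        rw [mul_pow, sq_abs]; ring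
      rw [h6] at h4
      have h7 : a ^ 2 / 8 * (W ω) ^ 2 ≤ Real.exp (a / 2 * |W ω|) := by linarith
      rw [div_mul_eq_mul_div, le_div_iff₀ (by positivity)]
      linarith
    have h8 : Real.exp (a * |W ω|) = Real.exp (a / 2 * |W ω|) * Real.exp (a / 2 * |W ω|) := by
      rw [← Real.exp_add]; congr 1; ring
    have h9 : (θ * W ω) ^ 2 * Real.exp |θ * W ω| ≤
        θ ^ 2 * (8 / a ^ 2 * Real.exp (a / 2 * |W ω|)) * Real.exp (a / 2 * |W ω|) := by
      rw [mul_pow]; gcongr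
    rw [h8]
    linarith
  have hint : Integrable
      (fun ω => 1 + θ * W ω + θ ^ 2 * (8 / a ^ 2) * Real.exp (a * |W ω|)) P :=
    ((integrable_const 1).add (hWint.const_mul θ)).add (hexp.const_mul _)
  calc ∫⁻ ω, ENNReal.ofReal (Real.exp (θ * W ω)) ∂P
      ≤ ∫⁻ ω, ENNReal.ofReal
          (1 + θ * W ω + θ ^ 2 * (8 / a ^ 2) * Real.exp (a * |W ω|)) ∂P :=
        lintegral_mono fun ω => ENNReal.ofReal_le_ofReal (hpt ω)
    _ = ENNReal.ofReal
          (∫ ω, (1 + θ * W ω + θ ^ 2 * (8 / a ^ 2) * Real.exp (a * |W ω|)) ∂P) :=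
        (ofReal_integral_eq_lintegral_ofReal hint
          (Eventually.of_forall fun ω => (Real.exp_pos _).le.trans (hpt ω))).symm
    _ ≤ _ := by
      apply ENNReal.ofReal_le_ofReal
      have e1 : ∫ ω, (1 + θ * W ω + θ ^ 2 * (8 / a ^ 2) * Real.exp (a * |W ω|)) ∂P =
          1 + θ ^ 2 * (8 / a ^ 2) * ∫ ω, Real.exp (a * |W ω|) ∂P := by
        have i1 : Integrable (fun ω => 1 + θ * W ω) P :=
          (integrable_const 1).add (hWint.const_mul θ)
        rw [integral_add i1 (hexp.const_mul _),
          integral_add (integrable_const 1) (hWint.const_mul θ), integral_const_mul,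
          integral_const_mul, hmean]
        simp
      rw [e1]
      have e2 : θ ^ 2 * (8 / a ^ 2) * ∫ ω, Real.exp (a * |W ω|) ∂P ≤
          θ ^ 2 * (8 / a ^ 2) * K := by gcongr
      have e3 := Real.add_one_le_exp (8 * K / a ^ 2 * θ ^ 2)
      have e4 : θ ^ 2 * (8 / a ^ 2) * K = 8 * K / a ^ 2 * θ ^ 2 := by ring
      linarith

/-- The variance proxy of a centred variable with `E exp(ι Y²) ≤ C₀`. -/
def subgaussianProxy (ι C₀ : ℝ) : ℝ :=
  8 * (Real.exp (1 / (4 * ι)) * C₀) + (1 / (4 * ι) + 4 * C₀)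

theorem mul_le_sq_div_add_mul_sq {ι : ℝ} (hι : 0 < ι) (x y : ℝ) :
    x * y ≤ x ^ 2 / (4 * ι) + ι * y ^ 2 := by
  have : x ^ 2 / (4 * ι) + ι * y ^ 2 - x * y = (x - 2 * ι * y) ^ 2 / (4 * ι) := by
    field_simp
    ring
  have h2 : 0 ≤ (x - 2 * ι * y) ^ 2 / (4 * ι) := by positivity
  linarith

/-- Two regimes, one for each part of the proxy. For |θ| ≤ 1/2 centring gives a quadratic exponent.
For larger θ Young's inequality gives exp(θ²/(4ι))·C₀, and the factor C₀ is absorbed by exp(4C₀θ²)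
because θ² ≥ 1/4. Hence no restriction on the range of θ. -/
theorem hasMGFBound_of_exp_sq_moment [IsProbabilityMeasure P] {Y : Ω → ℝ} (hY : Measurable Y)
    {ι C₀ : ℝ} (hι : 0 < ι)
    (hC : ∫⁻ ω, ENNReal.ofReal (Real.exp (ι * Y ω ^ 2)) ∂P ≤ ENNReal.ofReal C₀)
    (hmean : ∫ ω, Y ω ∂P = 0) (ℓ : ℝ) : HasMGFBound P Y (subgaussianProxy ι C₀) ℓ := by
  intro θ _
  have hK : ∫⁻ ω, ENNReal.ofReal (Real.exp (1 * |Y ω|)) ∂P ≤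
      ENNReal.ofReal (Real.exp (1 / (4 * ι)) * C₀) := by
    refine lintegral_ofReal_mul_le (Real.exp_pos _).le (fun ω => ?_) hC
    rw [← Real.exp_add]
    have := mul_le_sq_div_add_mul_sq hι 1 |Y ω|
    rw [sq_abs, one_pow] at this
    exact Real.exp_le_exp.2 this
  have hC1 : 1 ≤ C₀ := by
    have hC' : ∫⁻ ω, ENNReal.ofReal (Real.exp (ι * |Y ω ^ 2|)) ∂P ≤ ENNReal.ofReal C₀ := by
      simpa only [abs_pow, sq_abs] using hC
    exact one_le_of_exp_moment hι.le hC'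
  have hp : 0 < 1 / (4 * ι) := by positivity
  rcases le_or_gt |θ| (1 / 2) with h | h
  · refine (hasMGFBound_of_exp_moment hY one_pos hK hmean θ h).trans
      (ENNReal.ofReal_le_ofReal (Real.exp_le_exp.2 ?_))
    rw [subgaussianProxy]
    gcongr
    rw [one_pow, div_one]
    linarith
  · have hθ : 1 / 4 ≤ θ ^ 2 := by
      rw [← sq_abs]; nlinarith
    calc ∫⁻ ω, ENNReal.ofReal (Real.exp (θ * Y ω)) ∂P
        ≤ ENNReal.ofReal (Real.exp (θ ^ 2 / (4 * ι)) * C₀) := by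
          refine lintegral_ofReal_mul_le (Real.exp_pos _).le (fun ω => ?_) hC
          rw [← Real.exp_add]
          exact Real.exp_le_exp.2 (mul_le_sq_div_add_mul_sq hι _ _)
      _ ≤ ENNReal.ofReal (Real.exp (θ ^ 2 / (4 * ι)) * Real.exp (4 * C₀ * θ ^ 2)) := by
          gcongr
          have := Real.add_one_le_exp (4 * C₀ * θ ^ 2)
          nlinarith
      _ ≤ _ := by
          rw [← Real.exp_add]
          refine ENNReal.ofReal_le_ofReal (Real.exp_le_exp.2 ?_)
          rw [subgaussianProxy]
          have h1 : 0 ≤ 8 * (Real.exp (1 / (4 * ι)) * C₀) * θ ^ 2 := by positivity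
          have h2 : θ ^ 2 / (4 * ι) = 1 / (4 * ι) * θ ^ 2 := by ring
          rw [h2]
          linarith

theorem HasMGFBound.mono {Y : Ω → ℝ} {σ σ' ℓ ℓ' : ℝ} (h : HasMGFBound P Y σ ℓ) (hσ : σ ≤ σ')
    (hℓ : ℓ' ≤ ℓ) : HasMGFBound P Y σ' ℓ' := fun θ hθ =>
  (h θ (hθ.trans hℓ)).trans (ENNReal.ofReal_le_ofReal (Real.exp_le_exp.2 (by gcongr)))

/-- A Markov bound for both tails. -/
theorem measure_lt_abs_le_of_exp {Y : Ω → ℝ} (hY : Measurable Y) {θ V r : ℝ} (hθ : 0 < θ)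
    (h₁ : ∫⁻ ω, ENNReal.ofReal (Real.exp (θ * Y ω)) ∂P ≤ ENNReal.ofReal (Real.exp V))
    (h₂ : ∫⁻ ω, ENNReal.ofReal (Real.exp (-θ * Y ω)) ∂P ≤ ENNReal.ofReal (Real.exp V)) :
    P {ω | r < |Y ω|} ≤ ENNReal.ofReal (2 * Real.exp (V - θ * r)) := by
  have key : ∀ θ' : ℝ, ∫⁻ ω, ENNReal.ofReal (Real.exp (θ' * Y ω)) ∂P ≤
      ENNReal.ofReal (Real.exp V) →
      P {ω | θ * r ≤ θ' * Y ω} ≤ ENNReal.ofReal (Real.exp (V - θ * r)) := by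
    intro θ' h
    have hm := mul_meas_ge_le_lintegral (μ := P)
      (f := fun ω => ENNReal.ofReal (Real.exp (θ' * Y ω))) (by fun_prop)
      (ENNReal.ofReal (Real.exp (θ * r)))
    have hset : {ω | ENNReal.ofReal (Real.exp (θ * r)) ≤
        ENNReal.ofReal (Real.exp (θ' * Y ω))} = {ω | θ * r ≤ θ' * Y ω} := by
      ext ω
      simp [ENNReal.ofReal_le_ofReal_iff (Real.exp_pos _).le]
    rw [hset] at hm
    rw [Real.exp_sub, ENNReal.ofReal_div_of_pos (Real.exp_pos _),
      ENNReal.le_div_iff_mul_le (Or.inl (by simp [Real.exp_pos])) (Or.inl ENNReal.ofReal_ne_top),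
      mul_comm]
    exact hm.trans h
  have hsub : {ω | r < |Y ω|} ⊆ {ω | θ * r ≤ θ * Y ω} ∪ {ω | θ * r ≤ -θ * Y ω} := by
    intro ω hω
    rcases lt_abs.1 (show r < |Y ω| from hω) with h | h
    · left; exact mul_le_mul_of_nonneg_left h.le hθ.le
    · right
      show θ * r ≤ -θ * Y ω
      nlinarith
  calc P {ω | r < |Y ω|} ≤ _ := measure_mono hsub
    _ ≤ _ := measure_union_le _ _
    _ ≤ ENNReal.ofReal (Real.exp (V - θ * r)) + ENNReal.ofReal (Real.exp (V - θ * r)) :=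
        add_le_add (key _ h₁) (key _ h₂)
    _ = _ := by
        rw [← ENNReal.ofReal_add (Real.exp_pos _).le (Real.exp_pos _).le, two_mul]

/-- Exponential moment of a sum of products of a predictable bounded factor and an innovation. -/
theorem lintegral_exp_sum_le [IsProbabilityMeasure P] (F : ℕ → MeasurableSpace Ω)
    (hF : Monotone F) (hle : ∀ t, F t ≤ mΩ) (a ξ : ℕ → Ω → ℝ) (b : ℕ → ℝ) {σ ℓ : ℝ}
    (hσ : 0 ≤ σ) (m : ℕ)
    (ha : ∀ t, Measurable[F t] (a t)) (hab : ∀ t < m, ∀ ω, |a t ω| ≤ b t) (hbl : ∀ t < m, b t ≤ ℓ)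
    (hξ : ∀ t, Measurable[F (t + 1)] (ξ t))
    (hind : ∀ t < m, Indep (F t) (MeasurableSpace.comap (ξ t) inferInstance) P)
    (hm : ∀ t < m, HasMGFBound P (ξ t) σ ℓ) :
    ∫⁻ ω, ENNReal.ofReal (Real.exp (∑ t ∈ Finset.range m, a t ω * ξ t ω)) ∂P ≤
      ENNReal.ofReal (Real.exp (σ * ∑ t ∈ Finset.range m, b t ^ 2)) := by
  have hS : ∀ m, Measurable[F m] fun ω => ∑ t ∈ Finset.range m, a t ω * ξ t ω := by
    intro m
    refine Finset.measurable_sum _ fun t ht => ?_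
    have ht' : t + 1 ≤ m := Finset.mem_range.1 ht
    exact ((ha t).mono (hF (by omega)) le_rfl).mul ((hξ t).mono (hF ht') le_rfl)
  induction m with
  | zero => simp
  | succ m ih =>
    have ih := ih (fun t ht => hab t (by omega)) (fun t ht => hbl t (by omega))
      (fun t ht => hind t (by omega)) (fun t ht => hm t (by omega))
    -- Conditioning on `F m` is done through laws: the pair (past sum, next factor) is `F
    -- m`-measurable, hence independent of `ξ m`, so the joint law is a product and the last
    -- innovation can be integrated first with the pair frozen.
    let U : Ω → ℝ × ℝ := fun ω => (∑ t ∈ Finset.range m, a t ω * ξ t ω, a m ω)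
    have hU : Measurable[F m] U := (hS m).prodMk (ha m)
    have hU' : Measurable U := hU.mono (hle m) le_rfl
    have hξ' : Measurable (ξ m) := (hξ m).mono (hle _) le_rfl
    have hindU : IndepFun U (ξ m) P :=
      indep_of_indep_of_le_left (hind m (by omega)) hU.comap_le
    have hlaw := (indepFun_iff_map_prod_eq_prod_map_map hU'.aemeasurable
      hξ'.aemeasurable).1 hindU
    have hprob : IsProbabilityMeasure (P.map (ξ m)) :=
      Measure.isProbabilityMeasure_map hξ'.aemeasurable
    let G : (ℝ × ℝ) × ℝ → ENNReal := fun p => ENNReal.ofReal (Real.exp (p.1.1 + p.1.2 * p.2))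
    have hG : Measurable G := by fun_prop
    have e1 : ∫⁻ ω, ENNReal.ofReal
        (Real.exp (∑ t ∈ Finset.range (m + 1), a t ω * ξ t ω)) ∂P =
        ∫⁻ u, ∫⁻ z, G (u, z) ∂(P.map (ξ m)) ∂(P.map U) := by
      rw [← lintegral_prod _ hG.aemeasurable, ← hlaw, lintegral_map hG (hU'.prodMk hξ')]
      refine lintegral_congr fun ω => ?_
      simp only [G, U, Finset.sum_range_succ]
    rw [e1, lintegral_map (by exact hG.lintegral_prod_right') hU']
    calc ∫⁻ ω, ∫⁻ z, G (U ω, z) ∂(P.map (ξ m)) ∂P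
        ≤ ∫⁻ ω, ENNReal.ofReal (Real.exp (∑ t ∈ Finset.range m, a t ω * ξ t ω)) *
            ENNReal.ofReal (Real.exp (σ * b m ^ 2)) ∂P := by
          refine lintegral_mono fun ω => ?_
          have hG2 : Measurable fun z => G (U ω, z) := hG.comp measurable_prodMk_left
          simp only []
          rw [lintegral_map hG2 hξ']
          have : ∀ ω', G (U ω, ξ m ω') =
              ENNReal.ofReal (Real.exp (∑ t ∈ Finset.range m, a t ω * ξ t ω)) *
              ENNReal.ofReal (Real.exp (a m ω * ξ m ω')) := by
            intro ω'
            rw [← ENNReal.ofReal_mul (Real.exp_pos _).le, ← Real.exp_add]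
          simp_rw [this]
          rw [lintegral_const_mul' _ _ ENNReal.ofReal_ne_top]
          gcongr
          refine (hm m (by omega) (a m ω)
            ((hab m (by omega) ω).trans (hbl m (by omega)))).trans ?_
          refine ENNReal.ofReal_le_ofReal (Real.exp_le_exp.2 (mul_le_mul_of_nonneg_left ?_ hσ))
          rw [← sq_abs]
          exact pow_le_pow_left₀ (abs_nonneg _) (hab m (by omega) ω) 2
      _ = (∫⁻ ω, ENNReal.ofReal (Real.exp (∑ t ∈ Finset.range m, a t ω * ξ t ω)) ∂P) *
            ENNReal.ofReal (Real.exp (σ * b m ^ 2)) :=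
          lintegral_mul_const' _ _ ENNReal.ofReal_ne_top
      _ ≤ ENNReal.ofReal (Real.exp (σ * ∑ t ∈ Finset.range m, b t ^ 2)) *
            ENNReal.ofReal (Real.exp (σ * b m ^ 2)) := by gcongr
      _ = _ := by
          rw [← ENNReal.ofReal_mul (Real.exp_pos _).le, ← Real.exp_add, Finset.sum_range_succ,
            mul_add]

end MGF

/-! ### The square root of the volatility matrix -/

/-- Row i is the image of the i-th basis vector under the transpose, which has the same operator
norm. -/
theorem sum_sq_row_le_norm_sq {d : ℕ} (M : Matrix (Fin d) (Fin d) ℝ) (i : Fin d) :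
    ∑ k, M i k ^ 2 ≤ ‖M‖ ^ 2 := by
  have h := Matrix.l2_opNorm_mulVec Mᴴ (EuclideanSpace.single i (1 : ℝ))
  rw [Matrix.l2_opNorm_conjTranspose, PiLp.norm_single, norm_one, mul_one] at h
  have h2 := pow_le_pow_left₀ (norm_nonneg _) h 2
  rw [EuclideanSpace.norm_sq_eq] at h2
  refine le_trans (le_of_eq ?_) h2
  refine Finset.sum_congr rfl fun k _ => ?_
  simp

section Volatility

variable {d : ℕ} {Sig : ℝ → Matrix (Fin d) (Fin d) ℝ} {c C : ℝ}

theorem sqrt_mul_sqrt_of_posSemidef {S : Matrix (Fin d) (Fin d) ℝ} (hS : S.PosSemidef) :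
    CFC.sqrt S * CFC.sqrt S = S :=
  CFC.sqrt_mul_sqrt_self S (Matrix.nonneg_iff_posSemidef.2 hS)

theorem sqrt_isHermitian (S : Matrix (Fin d) (Fin d) ℝ) : (CFC.sqrt S).IsHermitian :=
  (Matrix.nonneg_iff_posSemidef.1 (CFC.sqrt_nonneg S)).isHermitian

theorem norm_sqrt_sq {S : Matrix (Fin d) (Fin d) ℝ} (hS : S.PosSemidef) :
    ‖CFC.sqrt S‖ ^ 2 = ‖S‖ := by
  have h := Matrix.l2_opNorm_conjTranspose_mul_self (CFC.sqrt S)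
  rw [(sqrt_isHermitian S).eq, sqrt_mul_sqrt_of_posSemidef hS] at h
  rw [h, sq]

theorem sqrt_row_dotProduct {S : Matrix (Fin d) (Fin d) ℝ} (hS : S.PosSemidef) (j l : Fin d) :
    CFC.sqrt S j ⬝ᵥ CFC.sqrt S l = S j l := by
  conv_rhs => rw [← sqrt_mul_sqrt_of_posSemidef hS, Matrix.mul_apply]
  refine Finset.sum_congr rfl fun k _ => ?_
  have : CFC.sqrt S k l = CFC.sqrt S l k := by
    conv_lhs => rw [← (sqrt_isHermitian S).eq]
    simp
  rw [this]

theorem VolatilityRegular.sum_sq_sqrt_row_le (h : VolatilityRegular Sig c C) {τ : ℝ} (hτ : τ ≤ 1)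
    (i : Fin d) : ∑ k, CFC.sqrt (Sig τ) i k ^ 2 ≤ C :=
  (sum_sq_row_le_norm_sq _ i).trans ((norm_sqrt_sq (h.posSemidef τ hτ)).trans_le (h.norm_le τ hτ))

theorem VolatilityRegular.sum_sq_mul_sqrt_row_le (h : VolatilityRegular Sig c C) {τ : ℝ}
    (hτ : τ ≤ 1) (M : Matrix (Fin d) (Fin d) ℝ) (i : Fin d) :
    ∑ k, (M * CFC.sqrt (Sig τ)) i k ^ 2 ≤ ‖M‖ ^ 2 * C := by
  refine (sum_sq_row_le_norm_sq _ i).trans ?_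
  calc ‖M * CFC.sqrt (Sig τ)‖ ^ 2 ≤ (‖M‖ * ‖CFC.sqrt (Sig τ)‖) ^ 2 := by
        gcongr; exact norm_mul_le _ _
    _ = ‖M‖ ^ 2 * ‖Sig τ‖ := by rw [mul_pow, norm_sqrt_sq (h.posSemidef τ hτ)]
    _ ≤ _ := by gcongr; exact h.norm_le τ hτ

theorem VolatilityRegular.le_quadraticForm (h : VolatilityRegular Sig c C) {τ : ℝ}
    (hτ : τ ∈ Icc (0 : ℝ) 1) (b : Fin d → ℝ) :
    c * ∑ j, b j ^ 2 ≤ ∑ j, ∑ l, b j * b l * Sig τ j l := by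
  have h1 := (h.sigma_posDef τ hτ).dotProduct_mulVec_nonneg b
  have e1 : star b ⬝ᵥ (Sig τ - c • 1) *ᵥ b =
      (∑ j, ∑ l, b j * b l * Sig τ j l) - c * ∑ j, b j ^ 2 := by
    rw [Matrix.sub_mulVec, dotProduct_sub, Matrix.smul_mulVec, Matrix.one_mulVec,
      dotProduct_smul]
    congr 1
    · simp only [dotProduct, Matrix.mulVec, star_trivial, Finset.mul_sum]
      refine Finset.sum_congr rfl fun j _ => Finset.sum_congr rfl fun l _ => ?_
      ring
    · simp only [dotProduct, star_trivial, smul_eq_mul]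
      congr 1
      exact Finset.sum_congr rfl fun j _ => by ring
  rw [e1] at h1
  linarith

end Volatility

/-! ### Linear forms and products of linear forms of the innovations -/

section Innovations

variable {Ω : Type*} [mΩ : MeasurableSpace Ω] {P : Measure Ω} {d : ℕ}
  {eps : ℤ → Ω → Fin d → ℝ} {ι₁ C₀ : ℝ}

theorem IsInnovationSequence.measurable_dotProduct (h : IsInnovationSequence P eps ι₁ C₀) (t : ℤ)
    (u : Fin d → ℝ) : Measurable fun ω => u ⬝ᵥ eps t ω := by
  have := h.measurable t
  simp only [dotProduct]
  fun_prop

variable [IsProbabilityMeasure P]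

theorem sum_sq_single (i : Fin d) : ∑ k, (Pi.single i (1 : ℝ) : Fin d → ℝ) k ^ 2 = 1 := by
  simp [Pi.single_apply]

theorem IsInnovationSequence.one_le (h : IsInnovationSequence P eps ι₁ C₀) (hι : 0 < ι₁)
    (i : Fin d) : 1 ≤ C₀ := by
  have h1 := h.subGaussian 0 (Pi.single i 1) (sum_sq_single i)
  refine one_le_of_exp_moment (P := P) (W := fun ω => (Pi.single i 1 ⬝ᵥ eps 0 ω) ^ 2) hι.le ?_
  simpa only [abs_pow, sq_abs] using h1

/-- The square exponential moment of a linear form of norm at most `√V`. -/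
theorem IsInnovationSequence.exp_sq_moment (h : IsInnovationSequence P eps ι₁ C₀) (hι : 0 < ι₁)
    (t : ℤ) {u : Fin d → ℝ} {V : ℝ} (hu : ∑ k, u k ^ 2 ≤ V) (i : Fin d) :
    ∫⁻ ω, ENNReal.ofReal (Real.exp (ι₁ / V * (u ⬝ᵥ eps t ω) ^ 2)) ∂P ≤ ENNReal.ofReal C₀ := by
  have hC := h.one_le hι i
  by_cases h0 : ∑ k, u k ^ 2 = 0
  · have hu0 : u = 0 := by
      funext k
      rw [Finset.sum_eq_zero_iff_of_nonneg fun _ _ => sq_nonneg _] at h0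
      simpa using h0 k (Finset.mem_univ k)
    subst hu0
    simpa using hC
  · have hpos : 0 < ∑ k, u k ^ 2 :=
      lt_of_le_of_ne (Finset.sum_nonneg fun _ _ => sq_nonneg _) (Ne.symm h0)
    set q := ∑ k, u k ^ 2 with hq
    have hunit : ∑ k, ((√q)⁻¹ * u k) ^ 2 = 1 := by
      simp_rw [mul_pow]
      rw [← Finset.mul_sum, inv_pow, Real.sq_sqrt hpos.le, ← hq, inv_mul_cancel₀ h0]
    refine le_trans (lintegral_mono fun ω => ENNReal.ofReal_le_ofReal ?_)
      (h.subGaussian t (fun k => (√q)⁻¹ * u k) hunit)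
    refine Real.exp_le_exp.2 ?_
    have e1 : (fun k => (√q)⁻¹ * u k) ⬝ᵥ eps t ω = (√q)⁻¹ * (u ⬝ᵥ eps t ω) := by
      simp only [dotProduct, Finset.mul_sum, mul_assoc]
    rw [e1, mul_pow, inv_pow, Real.sq_sqrt hpos.le, div_eq_mul_inv, mul_assoc]
    gcongr

theorem IsInnovationSequence.integrable_apply (h : IsInnovationSequence P eps ι₁ C₀)
    (hι : 0 < ι₁) (t : ℤ) (i : Fin d) : Integrable (fun ω => eps t ω i) P := by
  have h1 := h.exp_sq_moment hι t (sum_sq_single i).le i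
  simp only [single_one_dotProduct, div_one] at h1
  have hm : Measurable fun ω => eps t ω i := (measurable_pi_apply i).comp (h.measurable t)
  refine integrable_of_exp_moment hm one_pos (K := Real.exp (1 / (4 * ι₁)) * C₀) ?_
  refine lintegral_ofReal_mul_le (Real.exp_pos _).le (fun ω => ?_) h1
  rw [← Real.exp_add]
  have := mul_le_sq_div_add_mul_sq hι 1 |eps t ω i|
  rw [sq_abs, one_pow] at this
  exact Real.exp_le_exp.2 this

theorem IsInnovationSequence.integrable_mul (h : IsInnovationSequence P eps ι₁ C₀)
    (hι : 0 < ι₁) (t : ℤ) (i j : Fin d) : Integrable (fun ω => eps t ω i * eps t ω j) P := by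
  have hsq : ∀ i, Integrable (fun ω => eps t ω i ^ 2) P := by
    intro i
    have h1 := h.exp_sq_moment hι t (sum_sq_single i).le i
    simp only [single_one_dotProduct, div_one] at h1
    have hm : Measurable fun ω => eps t ω i := (measurable_pi_apply i).comp (h.measurable t)
    refine integrable_of_exp_moment (by fun_prop) hι (K := C₀) ?_
    simpa only [abs_pow, sq_abs] using h1
  have hm : ∀ i, Measurable fun ω => eps t ω i :=
    fun i => (measurable_pi_apply i).comp (h.measurable t)
  refine ((hsq i).add (hsq j)).mono' ((hm i).mul (hm j)).aestronglyMeasurable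
    (Eventually.of_forall fun ω => ?_)
  rw [Real.norm_eq_abs, abs_le]
  simp only [Pi.add_apply]
  constructor <;> nlinarith [sq_nonneg (eps t ω i + eps t ω j), sq_nonneg (eps t ω i - eps t ω j)]

theorem IsInnovationSequence.integral_dotProduct (h : IsInnovationSequence P eps ι₁ C₀)
    (hι : 0 < ι₁) (t : ℤ) (u : Fin d → ℝ) : ∫ ω, u ⬝ᵥ eps t ω ∂P = 0 := by
  simp only [dotProduct]
  rw [integral_finsetSum _ fun i _ => (h.integrable_apply hι t i).const_mul _]
  simp [integral_const_mul, h.mean_zero]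

theorem IsInnovationSequence.integral_dotProduct_mul (h : IsInnovationSequence P eps ι₁ C₀)
    (hι : 0 < ι₁) (t : ℤ) (u w : Fin d → ℝ) :
    Integrable (fun ω => (u ⬝ᵥ eps t ω) * (w ⬝ᵥ eps t ω)) P ∧
      ∫ ω, (u ⬝ᵥ eps t ω) * (w ⬝ᵥ eps t ω) ∂P = u ⬝ᵥ w := by
  have e1 : ∀ ω, (u ⬝ᵥ eps t ω) * (w ⬝ᵥ eps t ω) =
      ∑ i, ∑ j, u i * w j * (eps t ω i * eps t ω j) := by
    intro ω
    simp only [dotProduct]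
    rw [Finset.sum_mul_sum]
    refine Finset.sum_congr rfl fun i _ => Finset.sum_congr rfl fun j _ => by ring
  have hint : ∀ i j, Integrable (fun ω => u i * w j * (eps t ω i * eps t ω j)) P :=
    fun i j => (h.integrable_mul hι t i j).const_mul _
  simp_rw [e1]
  refine ⟨integrable_finsetSum _ fun i _ => integrable_finsetSum _ fun j _ => hint i j, ?_⟩
  rw [integral_finsetSum _ fun i _ => integrable_finsetSum _ fun j _ => hint i j]
  simp_rw [fun i => integral_finsetSum Finset.univ fun j _ => hint i j, integral_const_mul,
    h.cov_one]
  simp [dotProduct]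

theorem subgaussianProxy_nonneg {ι C : ℝ} (hι : 0 < ι) (hC : 0 ≤ C) : 0 ≤ subgaussianProxy ι C := by
  rw [subgaussianProxy]
  positivity

theorem IsInnovationSequence.hasMGFBound_dotProduct (h : IsInnovationSequence P eps ι₁ C₀)
    (hι : 0 < ι₁) (t : ℤ) (u : Fin d → ℝ) (ℓ : ℝ) :
    HasMGFBound P (fun ω => u ⬝ᵥ eps t ω) (subgaussianProxy ι₁ C₀ * ∑ k, u k ^ 2) ℓ := by
  by_cases h0 : ∑ k, u k ^ 2 = 0
  · have hu0 : u = 0 := by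
      funext k
      rw [Finset.sum_eq_zero_iff_of_nonneg fun _ _ => sq_nonneg _] at h0
      simpa using h0 k (Finset.mem_univ k)
    subst hu0
    intro θ _
    simp
  · have hpos : 0 < ∑ k, u k ^ 2 :=
      lt_of_le_of_ne (Finset.sum_nonneg fun _ _ => sq_nonneg _) (Ne.symm h0)
    set q := ∑ k, u k ^ 2 with hq
    have hunit : ∑ k, ((√q)⁻¹ * u k) ^ 2 = 1 := by
      simp_rw [mul_pow]
      rw [← Finset.mul_sum, inv_pow, Real.sq_sqrt hpos.le, ← hq, inv_mul_cancel₀ h0]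
    have hb := hasMGFBound_of_exp_sq_moment (P := P)
      (h.measurable_dotProduct t fun k => (√q)⁻¹ * u k) hι (h.subGaussian t _ hunit)
      (h.integral_dotProduct hι t _)
    intro θ _
    have h2 := hb |θ * √q| (θ * √q) le_rfl
    have e1 : ∀ ω, θ * √q * ((fun k => (√q)⁻¹ * u k) ⬝ᵥ eps t ω) = θ * (u ⬝ᵥ eps t ω) := by
      intro ω
      have : (fun k => (√q)⁻¹ * u k) ⬝ᵥ eps t ω = (√q)⁻¹ * (u ⬝ᵥ eps t ω) := by
        simp only [dotProduct, Finset.mul_sum, mul_assoc]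
      rw [this]
      have := (Real.sqrt_pos.2 hpos).ne'
      field_simp
    simp_rw [e1] at h2
    rw [mul_pow, Real.sq_sqrt hpos.le] at h2
    convert h2 using 3
    ring

/-- Products of sub-Gaussian forms are only sub-exponential: |xy| ≤ max(x², y²) gives an exponential
moment at ι₁/V, hence a bound for bounded θ only. Subtracting the mean, which Cauchy–Schwarz bounds
by V, costs the factor exp ι₁. -/
theorem IsInnovationSequence.hasMGFBound_mul (h : IsInnovationSequence P eps ι₁ C₀)
    (hι : 0 < ι₁) (t : ℤ) {u w : Fin d → ℝ} {V : ℝ} (hV : 0 < V) (hu : ∑ k, u k ^ 2 ≤ V)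
    (hw : ∑ k, w k ^ 2 ≤ V) (i : Fin d) :
    HasMGFBound P (fun ω => (u ⬝ᵥ eps t ω) * (w ⬝ᵥ eps t ω) - u ⬝ᵥ w)
      (8 * (Real.exp ι₁ * (C₀ + C₀)) / (ι₁ / V) ^ 2) (ι₁ / V / 2) := by
  have hC := h.one_le hι i
  have hmu := h.measurable_dotProduct t u
  have hmw := h.measurable_dotProduct t w
  have ha : 0 < ι₁ / V := by positivity
  refine hasMGFBound_of_exp_moment (by fun_prop) ha ?_ ?_
  · have h1 := h.exp_sq_moment hι t hu i
    have h2 := h.exp_sq_moment hι t hw i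
    have h3 : ∫⁻ ω, ENNReal.ofReal (Real.exp (ι₁ / V * (u ⬝ᵥ eps t ω) ^ 2) +
        Real.exp (ι₁ / V * (w ⬝ᵥ eps t ω) ^ 2)) ∂P ≤ ENNReal.ofReal (C₀ + C₀) := by
      simp_rw [fun ω => ENNReal.ofReal_add (Real.exp_pos (ι₁ / V * (u ⬝ᵥ eps t ω) ^ 2)).le
        (Real.exp_pos (ι₁ / V * (w ⬝ᵥ eps t ω) ^ 2)).le]
      rw [lintegral_add_left (by fun_prop), ENNReal.ofReal_add (by linarith) (by linarith)]
      exact add_le_add h1 h2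
    refine lintegral_ofReal_mul_le (Real.exp_pos _).le (fun ω => ?_) h3
    set x := u ⬝ᵥ eps t ω
    set y := w ⬝ᵥ eps t ω
    have huw : |u ⬝ᵥ w| ≤ V := by
      have hcs : (u ⬝ᵥ w) ^ 2 ≤ (∑ k, u k ^ 2) * ∑ k, w k ^ 2 := Finset.sum_mul_sq_le_sq_mul_sq _ _ _
      have : (u ⬝ᵥ w) ^ 2 ≤ V ^ 2 := by
        refine hcs.trans ?_
        rw [sq]
        exact mul_le_mul hu hw (Finset.sum_nonneg fun _ _ => sq_nonneg _) hV.le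
      exact abs_le_of_sq_le_sq this hV.le
    have hxy : |x * y - u ⬝ᵥ w| ≤ |x * y| + V := (abs_sub _ _).trans (by linarith)
    have h4 : ι₁ / V * |x * y - u ⬝ᵥ w| ≤ ι₁ + ι₁ / V * |x * y| := by
      calc _ ≤ ι₁ / V * (|x * y| + V) := by gcongr
        _ = _ := by field_simp; ring
    refine (Real.exp_le_exp.2 h4).trans ?_
    rw [Real.exp_add]
    gcongr
    rcases le_total |x| |y| with hle | hle
    · have : |x * y| ≤ y ^ 2 := by
        rw [abs_mul, ← sq_abs y, sq]; gcongr
      have h5 : Real.exp (ι₁ / V * |x * y|) ≤ Real.exp (ι₁ / V * y ^ 2) := by gcongr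
      linarith [Real.exp_pos (ι₁ / V * x ^ 2)]
    · have : |x * y| ≤ x ^ 2 := by
        rw [abs_mul, ← sq_abs x, sq]; gcongr
      have h5 : Real.exp (ι₁ / V * |x * y|) ≤ Real.exp (ι₁ / V * x ^ 2) := by gcongr
      linarith [Real.exp_pos (ι₁ / V * y ^ 2)]
  · obtain ⟨hi, he⟩ := h.integral_dotProduct_mul hι t u w
    rw [integral_sub hi (integrable_const _), he]
    simp

end Innovations

/-! ### The past of the innovations and a measurable version of the solution -/

section Past

variable {Ω : Type*} {d : ℕ}

/-- The σ-algebra generated by the innovations with indices in `T`. -/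
@[reducible]
def sigmaOf (eps : ℤ → Ω → Fin d → ℝ) (T : Set ℤ) : MeasurableSpace Ω :=
  ⨆ s ∈ T, MeasurableSpace.comap (eps s) inferInstance

theorem sigmaOf_mono (eps : ℤ → Ω → Fin d → ℝ) {S T : Set ℤ} (h : S ⊆ T) :
    sigmaOf eps S ≤ sigmaOf eps T := biSup_mono h

theorem measurable_sigmaOf (eps : ℤ → Ω → Fin d → ℝ) {T : Set ℤ} {t : ℤ} (ht : t ∈ T) :
    Measurable[sigmaOf eps T] (eps t) := by
  rw [measurable_iff_comap_le]
  exact le_biSup (fun s => MeasurableSpace.comap (eps s) inferInstance) ht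

theorem measurable_dotProduct_sigmaOf (eps : ℤ → Ω → Fin d → ℝ) {T : Set ℤ} {t : ℤ} (ht : t ∈ T)
    (u : Fin d → ℝ) : Measurable[sigmaOf eps T] fun ω => u ⬝ᵥ eps t ω := by
  have h := measurable_sigmaOf eps ht
  have h2 : Measurable fun v : Fin d → ℝ => u ⬝ᵥ v := by
    simp only [dotProduct]
    fun_prop
  exact h2.comp h

variable [mΩ : MeasurableSpace Ω] {P : Measure Ω} {eps : ℤ → Ω → Fin d → ℝ} {ι₁ C₀ : ℝ}

theorem IsInnovationSequence.sigmaOf_le (h : IsInnovationSequence P eps ι₁ C₀) (T : Set ℤ) :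
    sigmaOf eps T ≤ mΩ := iSup₂_le fun t _ => (h.measurable t).comap_le

theorem IsInnovationSequence.indep_sigmaOf (h : IsInnovationSequence P eps ι₁ C₀) {T : Set ℤ}
    {t : ℤ} (ht : t ∉ T) {ξ : Ω → ℝ} {g : (Fin d → ℝ) → ℝ} (hg : Measurable g)
    (hξ : ξ = fun ω => g (eps t ω)) :
    Indep (sigmaOf eps T) (MeasurableSpace.comap ξ inferInstance) P := by
  have h1 := indep_iSup_of_disjoint (fun s => (h.measurable s).comap_le) h.indep
    (S := T) (T := {t}) (Set.disjoint_singleton_right.2 ht)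
  refine indep_of_indep_of_le_right h1 ?_
  have h2 : Measurable[sigmaOf eps {t}] ξ := by
    rw [hξ]
    exact hg.comp (measurable_sigmaOf eps (Set.mem_singleton t))
  exact h2.comap_le

end Past

section Solution

variable {Ω : Type*} {d n : ℕ} {A Sig : ℝ → Matrix (Fin d) (Fin d) ℝ}
  {eps X : ℤ → Ω → Fin d → ℝ} {ι₁ C₀ M C₁ ρ c C : ℝ}

/-- The coefficient vector of `ε_{t-k}` in the moving-average representation of `x_{t,j}`. -/
def waveRow (n : ℕ) (A Sig : ℝ → Matrix (Fin d) (Fin d) ℝ) (t : ℤ) (j : Fin d) (k : ℕ) :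
    Fin d → ℝ :=
  (woldCoef n A k t * CFC.sqrt (Sig (scaledTime n (t - k)))) j

/-- Partial sums of the moving-average representation of `x_{t,j}`. -/
def partialSol (n : ℕ) (A Sig : ℝ → Matrix (Fin d) (Fin d) ℝ) (eps : ℤ → Ω → Fin d → ℝ) (t : ℤ)
    (j : Fin d) (N : ℕ) (ω : Ω) : ℝ :=
  ∑ k ∈ Finset.range N, waveRow n A Sig t j k ⬝ᵥ eps (t - k) ω

/-- A version of the solution that is measurable with respect to the past innovations. -/
def solVersion (n : ℕ) (A Sig : ℝ → Matrix (Fin d) (Fin d) ℝ) (eps : ℤ → Ω → Fin d → ℝ) (t : ℤ)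
    (ω : Ω) (j : Fin d) : ℝ :=
  limsup (fun N => partialSol n A Sig eps t j N ω) atTop

theorem measurable_partialSol (t : ℤ) (j : Fin d) (N : ℕ) :
    Measurable[sigmaOf eps (Iic t)] (partialSol n A Sig eps t j N) := by
  refine Finset.measurable_sum _ fun k _ => measurable_dotProduct_sigmaOf eps ?_ _
  simp

/-- The process X is only known almost surely, as the sum of its series. The limsup of the partial
sums is defined everywhere, depends on past innovations only, and equals X almost surely; it is the
factor to which the predictable exponential bound is applied. -/
theorem measurable_solVersion (t : ℤ) (j : Fin d) :
    Measurable[sigmaOf eps (Iic t)] fun ω => solVersion n A Sig eps t ω j :=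
  @Measurable.limsup _ _ _ _ _ (sigmaOf eps (Iic t)) _ _ _ _ fun N => measurable_partialSol t j N

variable [mΩ : MeasurableSpace Ω] {P : Measure Ω}

theorem IsTVVAR.tendsto_partialSol (h : IsTVVAR P n A Sig eps X) {t : ℤ} (h0 : 0 ≤ t)
    (hn : t ≤ n) : ∀ᵐ ω ∂P, ∀ j,
      Tendsto (fun N => partialSol n A Sig eps t j N ω) atTop (𝓝 (X t ω j)) := by
  filter_upwards [h.wold t h0 hn] with ω hω j
  have h1 := (Pi.hasSum.1 hω j).tendsto_sum_nat
  refine h1.congr fun N => Finset.sum_congr rfl fun k _ => ?_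
  rw [innovation, Matrix.mulVec_mulVec]
  rfl

theorem IsTVVAR.solVersion_eq (h : IsTVVAR P n A Sig eps X) {t : ℤ} (h0 : 0 ≤ t)
    (hn : t ≤ n) : ∀ᵐ ω ∂P, solVersion n A Sig eps t ω = X t ω := by
  filter_upwards [h.tendsto_partialSol h0 hn] with ω hω
  funext j
  exact (hω j).limsup_eq

theorem scaledTime_le_one {n : ℕ} {t : ℤ} (ht : t ≤ n) : scaledTime n t ≤ 1 := by
  rw [scaledTime]
  refine div_le_one_of_le₀ ?_ (by positivity)
  exact_mod_cast ht

theorem scaledTime_mem_Icc {n : ℕ} {t : ℤ} (h0 : 0 ≤ t) (ht : t ≤ n) :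
    scaledTime n t ∈ Icc (0 : ℝ) 1 := by
  refine ⟨?_, scaledTime_le_one ht⟩
  rw [scaledTime]
  have : (0 : ℝ) ≤ t := by exact_mod_cast h0
  positivity

/-- The variance proxy of the coordinates of the solution. -/
def solProxy (ι₁ C₀ C₁ ρ C : ℝ) : ℝ :=
  subgaussianProxy ι₁ C₀ * (C₁ ^ 2 * C) * (1 - ρ ^ 2)⁻¹

variable [IsProbabilityMeasure P]

theorem VolatilityRegular.nonneg (h : VolatilityRegular Sig c C) : 0 ≤ C :=
  (norm_nonneg _).trans (h.norm_le 0 zero_le_one)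

/-- The geometric decay is moved into the deterministic factors θρᵏ. What remains are linear forms
of independent innovations whose rows, rescaled by ρ⁻ᵏ, have squared norm at most C₁²C. The variance
proxies then sum to a geometric series, uniformly in N. -/
theorem hasMGFBound_partialSol (hA : TransitionRegular n A M C₁ ρ)
    (hSig : VolatilityRegular Sig c C) (heps : IsInnovationSequence P eps ι₁ C₀) (hι : 0 < ι₁)
    (hρ₀ : 0 < ρ) (hρ₁ : ρ < 1) {t : ℤ} (h0 : 0 ≤ t) (hn : t ≤ n) (j : Fin d) (N : ℕ) (ℓ : ℝ) :
    HasMGFBound P (partialSol n A Sig eps t j N) (solProxy ι₁ C₀ C₁ ρ C) ℓ := by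
  intro θ _
  have hC₀ := heps.one_le hι j
  have hσ := subgaussianProxy_nonneg hι (zero_le_one.trans hC₀)
  have hC := hSig.nonneg
  -- The filtration reveals innovations backwards from time t, so that the k-th summand involves the
  -- newly revealed `eps (t - k)`.
  let F : ℕ → MeasurableSpace Ω := fun m => sigmaOf eps (Ioc (t - m) t)
  have hrow : ∀ k : ℕ, ∑ i, (ρ ^ k)⁻¹ ^ 2 * waveRow n A Sig t j k i ^ 2 ≤ C₁ ^ 2 * C := by
    intro k
    have hk : scaledTime n (t - k) ≤ 1 := scaledTime_le_one (by omega)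
    have h1 := hSig.sum_sq_mul_sqrt_row_le hk (woldCoef n A k t) j
    have h2 := hA.decay k t h0 hn
    rw [← Finset.mul_sum, inv_pow, inv_mul_le_iff₀ (by positivity)]
    refine h1.trans ?_
    calc ‖woldCoef n A k t‖ ^ 2 * C ≤ (C₁ * ρ ^ k) ^ 2 * C := by gcongr
      _ = _ := by ring
  have key := lintegral_exp_sum_le (P := P) F
    (fun a b hab => sigmaOf_mono eps (Ioc_subset_Ioc_left (by omega)))
    (fun m => heps.sigmaOf_le _)
    (fun k _ => θ * ρ ^ k)
    (fun k ω => (fun i => (ρ ^ k)⁻¹ * waveRow n A Sig t j k i) ⬝ᵥ eps (t - k) ω)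
    (fun k => |θ| * ρ ^ k) (σ := subgaussianProxy ι₁ C₀ * (C₁ ^ 2 * C)) (ℓ := |θ|)
    (by positivity) N (fun k => measurable_const)
    (fun k _ ω => by rw [abs_mul, abs_of_nonneg (pow_nonneg hρ₀.le k)])
    (fun k _ => mul_le_of_le_one_right (abs_nonneg θ) (pow_le_one₀ hρ₀.le hρ₁.le))
    (fun k => measurable_dotProduct_sigmaOf eps (by simp) _)
    (fun k _ => heps.indep_sigmaOf (t := t - k) (by simp)
      (g := fun v => (fun i => (ρ ^ k)⁻¹ * waveRow n A Sig t j k i) ⬝ᵥ v)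
      (by simp only [dotProduct]; fun_prop) rfl)
    (fun k _ => (heps.hasMGFBound_dotProduct hι (t - k) _ |θ|).mono (by
      gcongr
      simpa only [mul_pow] using hrow k) le_rfl)
  have e1 : ∀ ω, θ * partialSol n A Sig eps t j N ω = ∑ k ∈ Finset.range N, θ * ρ ^ k *
      ((fun i => (ρ ^ k)⁻¹ * waveRow n A Sig t j k i) ⬝ᵥ eps (t - k) ω) := by
    intro ω
    rw [partialSol, Finset.mul_sum]
    refine Finset.sum_congr rfl fun k _ => ?_
    simp only [dotProduct, mul_assoc]
    rw [← Finset.mul_sum]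
    have : ρ ^ k ≠ 0 := by positivity
    field_simp
  simp_rw [e1]
  refine key.trans (ENNReal.ofReal_le_ofReal (Real.exp_le_exp.2 ?_))
  have hρ2 : ρ ^ 2 < 1 := by nlinarith
  have hgeo : ∑ k ∈ Finset.range N, (|θ| * ρ ^ k) ^ 2 ≤ (1 - ρ ^ 2)⁻¹ * θ ^ 2 := by
    have e2 : ∀ k, (|θ| * ρ ^ k) ^ 2 = θ ^ 2 * (ρ ^ 2) ^ k := by
      intro k
      rw [mul_pow, sq_abs, ← pow_mul, ← pow_mul, mul_comm k 2]
    simp_rw [e2]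
    rw [← Finset.mul_sum, mul_comm]
    gcongr
    have := (summable_geometric_of_lt_one (by positivity) hρ2).sum_le_tsum (Finset.range N)
      (fun k _ => by positivity)
    rwa [tsum_geometric_of_lt_one (by positivity) hρ2] at this
  rw [solProxy, mul_assoc _ _ (θ ^ 2)]
  gcongr

/-- Fatou's lemma along the partial sums, whose bound does not depend on their length. -/
theorem hasMGFBound_solVersion (hX : IsTVVAR P n A Sig eps X) (hA : TransitionRegular n A M C₁ ρ)
    (hSig : VolatilityRegular Sig c C) (heps : IsInnovationSequence P eps ι₁ C₀) (hι : 0 < ι₁)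
    (hρ₀ : 0 < ρ) (hρ₁ : ρ < 1) {t : ℤ} (h0 : 0 ≤ t) (hn : t ≤ n) (j : Fin d) (ℓ : ℝ) :
    HasMGFBound P (fun ω => solVersion n A Sig eps t ω j) (solProxy ι₁ C₀ C₁ ρ C) ℓ := by
  intro θ hθ
  have hmeas : ∀ N, Measurable fun ω =>
      ENNReal.ofReal (Real.exp (θ * partialSol n A Sig eps t j N ω)) := by
    intro N
    have := (measurable_partialSol (n := n) (A := A) (Sig := Sig) (eps := eps) t j N).mono
      (heps.sigmaOf_le _) le_rfl
    fun_prop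
  calc ∫⁻ ω, ENNReal.ofReal (Real.exp (θ * solVersion n A Sig eps t ω j)) ∂P
      = ∫⁻ ω, liminf (fun N =>
          ENNReal.ofReal (Real.exp (θ * partialSol n A Sig eps t j N ω))) atTop ∂P := by
        refine lintegral_congr_ae ?_
        filter_upwards [hX.tendsto_partialSol h0 hn, hX.solVersion_eq h0 hn] with ω h1 h2
        rw [h2]
        refine (Tendsto.liminf_eq ?_).symm
        exact ENNReal.tendsto_ofReal
          ((Real.continuous_exp.tendsto _).comp ((h1 j).const_mul θ))
    _ ≤ liminf (fun N => ∫⁻ ω,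
          ENNReal.ofReal (Real.exp (θ * partialSol n A Sig eps t j N ω)) ∂P) atTop :=
        lintegral_liminf_le hmeas
    _ ≤ liminf (fun _ : ℕ => ENNReal.ofReal (Real.exp (solProxy ι₁ C₀ C₁ ρ C * θ ^ 2))) atTop :=
        liminf_le_liminf (Eventually.of_forall fun N =>
          hasMGFBound_partialSol hA hSig heps hι hρ₀ hρ₁ h0 hn j N ℓ θ hθ)
    _ = _ := liminf_const _

end Solution

/-! ### Kernel weights on the grid -/

/-- The weight of the observation with index `r` in the `k`-th local moment at the grid point with
index `t`. -/
def gridWeight (n : ℕ) (K : ℝ → ℝ) (h : ℝ) (t k r : ℕ) : ℝ :=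
  1 / (n : ℝ) * ((((r : ℝ) - t) / (n * h)) ^ k * (K (((r : ℝ) - t) / (n * h)) / h))

section Weights

variable {n : ℕ} {K : ℝ → ℝ} {h W : ℝ}

theorem IsKernel.exists_bound (hK : IsKernel K) : ∃ W, 0 < W ∧ ∀ x, K x ≤ W := by
  obtain ⟨x₀, -, hx₀⟩ := (isCompact_Icc (a := (-1 : ℝ)) (b := 1)).exists_isMaxOn
    ⟨0, by constructor <;> norm_num⟩ hK.continuous.continuousOn
  refine ⟨K x₀ + 1, by linarith [hK.nonneg x₀], fun x => ?_⟩
  by_cases hx : |x| ≤ 1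
  · have := hx₀ (abs_le.1 hx)
    have h2 : K x ≤ K x₀ := this
    linarith
  · rw [hK.support x (not_le.1 hx)]
    linarith [hK.nonneg x₀]

theorem gridWeight_eq_zero (hK : IsKernel K) (hν : 0 < (n : ℝ) * h) {t k r : ℕ}
    (hr : (n : ℝ) * h < |(r : ℝ) - t|) : gridWeight n K h t k r = 0 := by
  have : 1 < |((r : ℝ) - t) / (n * h)| := by
    rw [abs_div, abs_of_pos hν, lt_div_iff₀ hν, one_mul]
    exact hr
  simp [gridWeight, hK.support _ this]

theorem abs_gridWeight_le (hK : IsKernel K) (hW : ∀ x, K x ≤ W) (hn : 0 < n) (hh : 0 < h)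
    (t k r : ℕ) : |gridWeight n K h t k r| ≤ W / (n * h) := by
  have hn' : (0 : ℝ) < n := by exact_mod_cast hn
  have hν : 0 < (n : ℝ) * h := by positivity
  have hW0 : 0 ≤ W := (hK.nonneg 0).trans (hW 0)
  by_cases hr : (n : ℝ) * h < |(r : ℝ) - t|
  · rw [gridWeight_eq_zero hK hν hr, abs_zero]
    positivity
  · have hv : |((r : ℝ) - t) / (n * h)| ≤ 1 := by
      rw [abs_div, abs_of_pos hν, div_le_one hν]
      exact not_lt.1 hr
    rw [gridWeight, abs_mul, abs_mul, abs_pow, abs_div (K _), abs_of_nonneg (hK.nonneg _),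
      abs_of_pos hh, abs_of_pos (by positivity : (0 : ℝ) < 1 / n)]
    calc 1 / (n : ℝ) * (|((r : ℝ) - t) / (n * h)| ^ k * (K (((r : ℝ) - t) / (n * h)) / h))
        ≤ 1 / (n : ℝ) * (1 * (W / h)) := by
          gcongr
          · exact div_nonneg (hK.nonneg _) hh.le
          · exact pow_le_one₀ (abs_nonneg _) hv
          · exact hW _
      _ = W / (n * h) := by field_simp

theorem card_filter_near_le {ν : ℝ} (hν : 1 ≤ ν) (n t : ℕ) :
    (((Finset.range n).filter fun r : ℕ => |(r : ℝ) - t| ≤ ν).card : ℝ) ≤ 3 * ν := by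
  have hsub : ((Finset.range n).filter fun r : ℕ => |(r : ℝ) - t| ≤ ν) ⊆
      Finset.Icc (t - ⌊ν⌋₊) (t + ⌊ν⌋₊) := by
    intro r hr
    have hr2 := (Finset.mem_filter.1 hr).2
    rw [Finset.mem_Icc]
    rcases le_total r t with hrt | hrt
    · have : ((t - r : ℕ) : ℝ) ≤ ν := by
        push_cast [hrt]
        linarith [(abs_le.1 hr2).1]
      have := Nat.le_floor this
      omega
    · have : ((r - t : ℕ) : ℝ) ≤ ν := by
        push_cast [hrt]
        linarith [(abs_le.1 hr2).2]
      have := Nat.le_floor this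
      omega
  have h1 := Finset.card_le_card hsub
  rw [Nat.card_Icc] at h1
  have h2 : ((Finset.range n).filter fun r : ℕ => |(r : ℝ) - t| ≤ ν).card ≤ 2 * ⌊ν⌋₊ + 1 := by
    omega
  have h3 : (⌊ν⌋₊ : ℝ) ≤ ν := Nat.floor_le (by linarith)
  calc _ ≤ ((2 * ⌊ν⌋₊ + 1 : ℕ) : ℝ) := by exact_mod_cast h2
    _ ≤ 3 * ν := by push_cast; linarith

/-- At most 2⌊nh⌋ + 1 ≤ 3nh indices fall in the kernel window, each with weight at most W/(nh). -/
theorem sum_abs_gridWeight_le (hK : IsKernel K) (hW : ∀ x, K x ≤ W) (hn : 0 < n) (hh : 0 < h)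
    (hν : 1 ≤ (n : ℝ) * h) (t k : ℕ) :
    ∑ r ∈ Finset.range n, |gridWeight n K h t k r| ≤ 3 * W := by
  have hν0 : 0 < (n : ℝ) * h := by linarith
  have hW0 : 0 ≤ W := (hK.nonneg 0).trans (hW 0)
  rw [← Finset.sum_filter_of_ne (p := fun r : ℕ => |(r : ℝ) - t| ≤ n * h)]
  · calc _ ≤ ∑ _r ∈ (Finset.range n).filter (fun r : ℕ => |(r : ℝ) - t| ≤ n * h), W / (n * h) :=
          Finset.sum_le_sum fun r _ => abs_gridWeight_le hK hW hn hh t k r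
      _ = (((Finset.range n).filter fun r : ℕ => |(r : ℝ) - t| ≤ n * h).card : ℝ) *
            (W / (n * h)) := by rw [Finset.sum_const, nsmul_eq_mul]
      _ ≤ 3 * (n * h) * (W / (n * h)) := by gcongr; exact card_filter_near_le hν n t
      _ = 3 * W := by field_simp
  · intro r _ hr
    by_contra hcon
    exact hr (by rw [gridWeight_eq_zero hK hν0 (not_le.1 hcon), abs_zero])

theorem sum_sq_gridWeight_le (hK : IsKernel K) (hW : ∀ x, K x ≤ W) (hn : 0 < n) (hh : 0 < h)
    (hν : 1 ≤ (n : ℝ) * h) (t k : ℕ) :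
    ∑ r ∈ Finset.range n, gridWeight n K h t k r ^ 2 ≤ 3 * W ^ 2 / (n * h) := by
  have hν0 : 0 < (n : ℝ) * h := by linarith
  have hW0 : 0 ≤ W := (hK.nonneg 0).trans (hW 0)
  calc ∑ r ∈ Finset.range n, gridWeight n K h t k r ^ 2
      ≤ ∑ r ∈ Finset.range n, W / (n * h) * |gridWeight n K h t k r| := by
        refine Finset.sum_le_sum fun r _ => ?_
        rw [← sq_abs, sq]
        gcongr
        exact abs_gridWeight_le hK hW hn hh t k r
    _ ≤ W / (n * h) * (3 * W) := by
        rw [← Finset.mul_sum]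
        gcongr
        exact sum_abs_gridWeight_le hK hW hn hh hν t k
    _ = _ := by ring

end Weights

/-! ### Tails of weighted sums -/

section Tails

variable {Ω : Type*} [mΩ : MeasurableSpace Ω] {P : Measure Ω} [IsProbabilityMeasure P] {d : ℕ}
  {eps : ℤ → Ω → Fin d → ℝ} {ι₁ C₀ : ℝ}

/-- Chernoff's bound with parameter √ν. Since the squared weights sum to at most V/ν, the exponent
is at most σVb² whatever ν is, and a deviation r/√ν costs exactly r. The condition `hq` keeps the
effective parameter inside the range `ℓ` where the moment bound on the innovations holds. -/
theorem measure_weightedSum_le (heps : IsInnovationSequence P eps ι₁ C₀) {m : ℕ} {w : ℕ → ℝ}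
    {a : ℕ → Ω → ℝ} {g : ℕ → (Fin d → ℝ) → ℝ} {b q σ ℓ ν V r : ℝ} (hb : 0 ≤ b) (hσ : 0 ≤ σ)
    (hν : 0 < ν)
    (ha : ∀ r : ℕ, Measurable[sigmaOf eps (Iic (r : ℤ))] (a r)) (hab : ∀ r < m, ∀ ω, |a r ω| ≤ b)
    (hg : ∀ r, Measurable (g r))
    (hmgf : ∀ r < m, HasMGFBound P (fun ω => g r (eps (r + 1) ω)) σ ℓ)
    (hwq : ∀ r < m, |w r| ≤ q) (hq : √ν * (q * b) ≤ ℓ)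
    (hV : ∑ r ∈ Finset.range m, w r ^ 2 ≤ V / ν) :
    P {ω | r / √ν < |∑ k ∈ Finset.range m, w k * (a k ω * g k (eps (k + 1) ω))|} ≤
      ENNReal.ofReal (2 * Real.exp (σ * (V * b ^ 2) - r)) := by
  have hsν : 0 < √ν := Real.sqrt_pos.2 hν
  have hmeas : Measurable fun ω =>
      ∑ k ∈ Finset.range m, w k * (a k ω * g k (eps (k + 1) ω)) := by
    refine Finset.measurable_sum _ fun k _ => ?_
    have h1 := (ha k).mono (heps.sigmaOf_le _) le_rfl
    have h2 := (hg k).comp (heps.measurable (k + 1))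
    exact (h1.mul h2).const_mul _
  have hexp : ∀ θ : ℝ, |θ| = √ν → ∫⁻ ω, ENNReal.ofReal (Real.exp (θ *
      ∑ k ∈ Finset.range m, w k * (a k ω * g k (eps (k + 1) ω)))) ∂P ≤
      ENNReal.ofReal (Real.exp (σ * (V * b ^ 2))) := by
    intro θ hθ
    have key := lintegral_exp_sum_le (P := P) (fun k => sigmaOf eps (Iic (k : ℤ)))
      (fun i j hij => sigmaOf_mono eps (Iic_subset_Iic.2 (by exact_mod_cast hij)))
      (fun k => heps.sigmaOf_le _) (fun k ω => θ * w k * a k ω)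
      (fun k ω => g k (eps (k + 1) ω)) (fun k => √ν * |w k| * b) hσ m
      (fun k => (ha k).const_mul _)
      (fun k hk ω => by
        rw [abs_mul, abs_mul, hθ]
        gcongr
        exact hab k hk ω)
      (fun k hk => by
        refine le_trans ?_ hq
        rw [mul_assoc]
        gcongr
        exact hwq k hk)
      (fun k => (hg k).comp (measurable_sigmaOf eps (by simp)))
      (fun k _ => heps.indep_sigmaOf (by simp) (hg k) rfl) hmgf
    refine le_trans (le_of_eq (lintegral_congr fun ω => ?_))
      (key.trans (ENNReal.ofReal_le_ofReal (Real.exp_le_exp.2 ?_)))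
    · congr 2
      rw [Finset.mul_sum]
      exact Finset.sum_congr rfl fun k _ => by ring
    · refine mul_le_mul_of_nonneg_left ?_ hσ
      have e1 : ∑ k ∈ Finset.range m, (√ν * |w k| * b) ^ 2 =
          ν * b ^ 2 * ∑ k ∈ Finset.range m, w k ^ 2 := by
        rw [Finset.mul_sum]
        refine Finset.sum_congr rfl fun k _ => ?_
        rw [mul_pow, mul_pow, Real.sq_sqrt hν.le, sq_abs]
        ring
      rw [e1]
      calc ν * b ^ 2 * ∑ k ∈ Finset.range m, w k ^ 2 ≤ ν * b ^ 2 * (V / ν) := by gcongr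
        _ = V * b ^ 2 := by field_simp
  have := measure_lt_abs_le_of_exp (P := P) hmeas hsν (r := r / √ν)
    (hexp _ (abs_of_pos hsν)) (hexp _ (by rw [abs_neg, abs_of_pos hsν]))
  rwa [mul_div_cancel₀ _ hsν.ne'] at this

end Tails

theorem measure_exists_le {Ω : Type*} [MeasurableSpace Ω] {P : Measure Ω} {ι : Type*} [Fintype ι] {p : ι → Ω → Prop} {ε : ENNReal}
    (hp : ∀ i, P {ω | p i ω} ≤ ε) : P {ω | ∃ i, p i ω} ≤ Fintype.card ι * ε := by
  have : {ω | ∃ i, p i ω} = ⋃ i, {ω | p i ω} := by ext; simp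
  rw [this]
  calc P (⋃ i, {ω | p i ω}) ≤ ∑ i, P {ω | p i ω} := measure_iUnion_fintype_le _ _
    _ ≤ ∑ _i : ι, ε := Finset.sum_le_sum fun i _ => hp i
    _ = _ := by simp [Finset.sum_const, nsmul_eq_mul]

/-! ### A path-wise regularity event of high probability -/

/-- Path-wise bounds: maxima of the series, correlations of regressors and noise, and deviations
of the local second moments of the innovations. -/
structure GoodPath {d : ℕ} (n : ℕ) (K : ℝ → ℝ) (h : ℝ) (A Sig : ℝ → Matrix (Fin d) (Fin d) ℝ)
    (L B : ℝ) (x e : ℤ → Fin d → ℝ) : Prop where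
  recursion : ∀ r : ℕ, r < n → x (r + 1) = A (scaledTime n (r + 1)) *ᵥ x r + e (r + 1)
  bound : ∀ r : ℕ, r < n → ∀ j, |x r j| ≤ B * √L
  noise : ∀ t < n, ∀ k < 3, ∀ i j,
    |∑ r ∈ Finset.range n, gridWeight n K h t k r * (x r j * e (r + 1) i)| ≤ B * L / √(n * h)
  gram : ∀ t < n, ∀ k < 3, ∀ j l,
    |∑ r ∈ Finset.range (n - 1), gridWeight n K h t k (r + 1) *
      (2 * ((A (scaledTime n (r + 1)) *ᵥ x r) j * e (r + 1) l) +
        (e (r + 1) j * e (r + 1) l - Sig (scaledTime n (r + 1)) j l))| ≤ B * L / √(n * h)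

/-! ### Truncation, levels and union bounds for the regularity event. -/

theorem VolatilityRegular.mono {d : ℕ} {Sig : ℝ → Matrix (Fin d) (Fin d) ℝ} {c C C' : ℝ}
    (h : VolatilityRegular Sig c C) (hC : C ≤ C') : VolatilityRegular Sig c C' :=
  { h with norm_le := fun τ hτ => (h.norm_le τ hτ).trans hC }

/-- Truncation at level `b`. -/
def trunc (b x : ℝ) : ℝ := if |x| ≤ b then x else 0

theorem measurable_trunc (b : ℝ) : Measurable (trunc b) :=
  Measurable.ite (measurableSet_le (by fun_prop) measurable_const) measurable_id measurable_const

theorem abs_trunc_le {b : ℝ} (hb : 0 ≤ b) (x : ℝ) : |trunc b x| ≤ b := by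
  rw [trunc]
  split_ifs with h
  · exact h
  · simpa using hb

theorem trunc_of_le {b x : ℝ} (h : |x| ≤ b) : trunc b x = x := if_pos h

/-- The level of the maxima of the series. -/
def maxLevel (ι₁ C₀ C₁ ρ C : ℝ) : ℝ :=
  solProxy ι₁ C₀ C₁ ρ C + subgaussianProxy ι₁ C₀ * C + 3

/-- The proxy of centred products of innovations. -/
def productProxy (ι₁ C₀ C : ℝ) : ℝ := 8 * (Real.exp ι₁ * (C₀ + C₀)) / (ι₁ / C) ^ 2

/-- The constant of the path-wise regularity event. -/
def pathLevel (ι₁ C₀ C₁ ρ C W : ℝ) : ℝ :=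
  maxLevel ι₁ C₀ C₁ ρ C +
    (subgaussianProxy ι₁ C₀ * C * (3 * W ^ 2 * maxLevel ι₁ C₀ C₁ ρ C ^ 2) + 4) +
    (2 * (subgaussianProxy ι₁ C₀ * C * (3 * W ^ 2 * (2 * maxLevel ι₁ C₀ C₁ ρ C) ^ 2) + 4) +
      (productProxy ι₁ C₀ C * (3 * W ^ 2) + 4))

theorem exp_neg_mul_logMax {n d : ℕ} (hn : 0 < n) (k : ℕ) :
    Real.exp (-(k * logMax n d)) = (((max n d : ℕ) : ℝ) ^ k)⁻¹ := by
  have hN : (0 : ℝ) < (max n d : ℕ) := by exact_mod_cast lt_max_of_lt_left hn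
  rw [Real.exp_neg, logMax, mul_comm, Real.exp_mul, Real.exp_log hN, Real.rpow_natCast]

/-- A union over at most a·Nᵏ events, N = n∨d, is beaten by tails N^{-(k+1)}, leaving 2a/N. This
explains the summands 3 and 4 in the levels: the maxima run over nd ≤ N² pairs, the weighted sums
over 3nd² ≤ 3N³ tuples. -/
theorem card_mul_exp_le {n d m k a : ℕ} (hn : 0 < n) (hm : m ≤ a * max n d ^ k) {r : ℝ}
    (hr : r ≤ -((k + 1 : ℕ) * logMax n d)) :
    (m : ENNReal) * ENNReal.ofReal (2 * Real.exp r) ≤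
      ENNReal.ofReal (2 * a / (max n d : ℕ)) := by
  have hN : (0 : ℝ) < (max n d : ℕ) := by exact_mod_cast lt_max_of_lt_left hn
  rw [← ENNReal.ofReal_natCast, ← ENNReal.ofReal_mul (by positivity)]
  refine ENNReal.ofReal_le_ofReal ?_
  have hm' : (m : ℝ) ≤ a * ((max n d : ℕ) : ℝ) ^ k := by exact_mod_cast hm
  calc (m : ℝ) * (2 * Real.exp r)
      ≤ (a * ((max n d : ℕ) : ℝ) ^ k) * (2 * (((max n d : ℕ) : ℝ) ^ (k + 1))⁻¹) := by
        rw [← exp_neg_mul_logMax hn]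
        gcongr
    _ = _ := by
        rw [pow_succ]
        field_simp

section

variable {Ω : Type*} [mΩ : MeasurableSpace Ω] {P : Measure Ω} {d n : ℕ}
  {A Sig : ℝ → Matrix (Fin d) (Fin d) ℝ}
  {eps X : ℤ → Ω → Fin d → ℝ} {ι₁ C₀ M C₁ ρ c C : ℝ}

/-- Chernoff at θ = √L: the exponent is σL − BL ≤ −3L. -/
theorem measure_sqrt_lt_abs_le {Y : Ω → ℝ} (hY : Measurable Y) {σ L B : ℝ} (hL : 0 < L)
    (h : HasMGFBound P Y σ (√L)) (hB : σ + 3 ≤ B) :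
    P {ω | B * √L < |Y ω|} ≤ ENNReal.ofReal (2 * Real.exp (-(3 * L))) := by
  have hs : 0 < √L := Real.sqrt_pos.2 hL
  have h1 := h (√L) (abs_of_pos hs).le
  have h2 := h (-√L) (by rw [abs_neg, abs_of_pos hs])
  rw [neg_sq] at h2
  refine (measure_lt_abs_le_of_exp hY hs h1 h2).trans (ENNReal.ofReal_le_ofReal ?_)
  have : √L * (B * √L) = B * L := by
    rw [mul_comm, mul_assoc, Real.mul_self_sqrt hL.le]
  rw [this, Real.sq_sqrt hL.le]
  gcongr
  nlinarith

-- Five exceptional families: maxima of the series, maxima of the innovations, regressor–noise sums,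
-- cross terms (A X_r)e_{r+1}, and centred products of innovations. Their bounds 2, 2, 6, 6, 6 over
-- n∨d add up to 22. The Gram deviation of `GoodPath` is twice the fourth sum plus the fifth.
set_option maxHeartbeats 1000000 in
theorem measure_not_goodPath_le [IsProbabilityMeasure P] {K : ℝ → ℝ} {h W : ℝ} (hn : 0 < n)
    (hX : IsTVVAR P n A Sig eps X) (hA : TransitionRegular n A M C₁ ρ)
    (hSig : VolatilityRegular Sig c C) (heps : IsInnovationSequence P eps ι₁ C₀) (hι : 0 < ι₁)
    (hρ₀ : 0 < ρ) (hρ₁ : ρ < 1) (hC : 0 < C) (hK : IsKernel K) (hW : ∀ x, K x ≤ W) (hh : 0 < h)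
    (hν : 1 ≤ (n : ℝ) * h) (hνW : √(n * h) * (W / (n * h)) ≤ ι₁ / C / 2)
    (hL : 1 ≤ logMax n d) (i₀ : Fin d) :
    P {ω | ¬ GoodPath n K h A Sig (logMax n d) (pathLevel ι₁ C₀ C₁ ρ C W) (fun t => X t ω)
      (innovation n Sig fun s => eps s ω)} ≤ ENNReal.ofReal (22 / (max n d : ℕ)) := by
  set L := logMax n d with hLdef
  set B₁ := maxLevel ι₁ C₀ C₁ ρ C with hB₁
  set σ₀ := subgaussianProxy ι₁ C₀ with hσ₀
  have hL0 : 0 < L := by linarith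
  have hν0 : 0 < (n : ℝ) * h := by linarith
  have hC₀ := heps.one_le hι i₀
  have hσ0 : 0 ≤ σ₀ := subgaussianProxy_nonneg hι (by linarith)
  have hσX : 0 ≤ solProxy ι₁ C₀ C₁ ρ C := by
    have : 0 ≤ (1 - ρ ^ 2)⁻¹ := inv_nonneg.2 (by nlinarith)
    rw [solProxy]
    positivity
  have hσ' : 0 ≤ productProxy ι₁ C₀ C := by
    rw [productProxy]
    positivity
  have hσC : 0 ≤ σ₀ * C := mul_nonneg hσ0 hC.le
  have hB₁eq : B₁ = solProxy ι₁ C₀ C₁ ρ C + σ₀ * C + 3 := rfl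
  have hB₁le : solProxy ι₁ C₀ C₁ ρ C + 3 ≤ B₁ := by linarith
  have hB₁le' : σ₀ * C + 3 ≤ B₁ := by linarith
  have hB₁pos : 0 ≤ B₁ := by linarith
  have hW0 : 0 ≤ W := (hK.nonneg 0).trans (hW 0)
  have hNd : d ≤ max n d := le_max_right _ _
  have hNn : n ≤ max n d := le_max_left _ _
  -- the innovations and the measurable version of the solution
  let e : Ω → ℤ → Fin d → ℝ := fun ω => innovation n Sig fun s => eps s ω
  let Z : ℤ → Ω → Fin d → ℝ := solVersion n A Sig eps
  have hτ : ∀ r : ℕ, r < n → scaledTime n (r + 1) ≤ 1 := fun r hr => scaledTime_le_one (by omega)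
  have hrow : ∀ r : ℕ, r < n → ∀ i, ∑ k, CFC.sqrt (Sig (scaledTime n (r + 1))) i k ^ 2 ≤ C :=
    fun r hr i => hSig.sum_sq_sqrt_row_le (hτ r hr) i
  have hemgf : ∀ r : ℕ, r < n → ∀ i ℓ, HasMGFBound P (fun ω => e ω (r + 1) i) (σ₀ * C) ℓ :=
    fun r hr i ℓ => (heps.hasMGFBound_dotProduct hι (r + 1) _ ℓ).mono
      (mul_le_mul_of_nonneg_left (hrow r hr i) hσ0) le_rfl
  have hemeas : ∀ (r : ℕ) i, Measurable fun ω => e ω (r + 1) i :=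
    fun r i => heps.measurable_dotProduct (r + 1) _
  have hZmeas : ∀ (t : ℤ) j, Measurable fun ω => Z t ω j :=
    fun t j => (measurable_solVersion t j).mono (heps.sigmaOf_le _) le_rfl
  -- maxima
  have hE1 : P {ω | ∃ p : Fin n × Fin d, B₁ * √L < |Z (p.1 : ℕ) ω p.2|} ≤
      ENNReal.ofReal (2 * (1 : ℕ) / (max n d : ℕ)) := by
    have hp : ∀ p : Fin n × Fin d, P {ω | B₁ * √L < |Z (p.1 : ℕ) ω p.2|} ≤
        ENNReal.ofReal (2 * Real.exp (-(3 * L))) := fun p =>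
      measure_sqrt_lt_abs_le (hZmeas _ _) hL0
        (hasMGFBound_solVersion hX hA hSig heps hι hρ₀ hρ₁ (by omega) (by omega) p.2 _) hB₁le
    refine (measure_exists_le hp).trans (card_mul_exp_le (k := 2) hn ?_ ?_)
    · rw [Fintype.card_prod, Fintype.card_fin, Fintype.card_fin, sq, one_mul]
      exact Nat.mul_le_mul hNn hNd
    · rw [← hLdef]; norm_num
  have hE2 : P {ω | ∃ p : Fin n × Fin d, B₁ * √L < |e ω ((p.1 : ℕ) + 1) p.2|} ≤
      ENNReal.ofReal (2 * (1 : ℕ) / (max n d : ℕ)) := by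
    have hp : ∀ p : Fin n × Fin d, P {ω | B₁ * √L < |e ω ((p.1 : ℕ) + 1) p.2|} ≤
        ENNReal.ofReal (2 * Real.exp (-(3 * L))) := fun p =>
      measure_sqrt_lt_abs_le (hemeas _ _) hL0 (hemgf _ p.1.2 p.2 _) hB₁le'
    refine (measure_exists_le hp).trans (card_mul_exp_le (k := 2) hn ?_ ?_)
    · rw [Fintype.card_prod, Fintype.card_fin, Fintype.card_fin, sq, one_mul]
      exact Nat.mul_le_mul hNn hNd
    · rw [← hLdef]; norm_num
  have hcard : Fintype.card (Fin n × Fin 3 × Fin d × Fin d) ≤ 3 * max n d ^ 3 := by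
    simp only [Fintype.card_prod, Fintype.card_fin]
    calc n * (3 * (d * d)) = 3 * (n * d * d) := by ring
      _ ≤ 3 * (max n d * max n d * max n d) := by gcongr
      _ = _ := by ring
  have hwle : ∀ t k r : ℕ, |gridWeight n K h t k r| ≤ W / (n * h) :=
    fun t k r => abs_gridWeight_le hK hW hn hh t k r
  have hwsum : ∀ t k : ℕ, ∑ r ∈ Finset.range n, gridWeight n K h t k r ^ 2 ≤
      3 * W ^ 2 / (n * h) := fun t k => sum_sq_gridWeight_le hK hW hn hh hν t k
  have hwsum' : ∀ t k : ℕ, ∑ r ∈ Finset.range (n - 1), gridWeight n K h t k (r + 1) ^ 2 ≤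
      3 * W ^ 2 / (n * h) := by
    intro t k
    refine le_trans ?_ (hwsum t k)
    obtain ⟨m, rfl⟩ : ∃ m, n = m + 1 := ⟨n - 1, by omega⟩
    rw [Finset.sum_range_succ' _ m, Nat.add_sub_cancel]
    exact le_add_of_nonneg_right (sq_nonneg _)
  -- noise
  have hE3 : P {ω | ∃ p : Fin n × Fin 3 × Fin d × Fin d,
      (σ₀ * C * (3 * W ^ 2 * B₁ ^ 2) + 4) * L / √(n * h) <
        |∑ r ∈ Finset.range n, gridWeight n K h p.1 p.2.1 r *
          (trunc (B₁ * √L) (Z r ω p.2.2.1) * e ω (r + 1) p.2.2.2)|} ≤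
      ENNReal.ofReal (2 * (3 : ℕ) / (max n d : ℕ)) := by
    -- Truncation supplies the bound for every ω that the exponential inequality requires; outside
    -- the first exceptional family it changes nothing.
    have hp : ∀ p : Fin n × Fin 3 × Fin d × Fin d, P {ω |
      (σ₀ * C * (3 * W ^ 2 * B₁ ^ 2) + 4) * L / √(n * h) <
        |∑ r ∈ Finset.range n, gridWeight n K h p.1 p.2.1 r *
          (trunc (B₁ * √L) (Z r ω p.2.2.1) * e ω (r + 1) p.2.2.2)|} ≤
        ENNReal.ofReal (2 * Real.exp (σ₀ * C * (3 * W ^ 2 * (B₁ * √L) ^ 2) -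
          (σ₀ * C * (3 * W ^ 2 * B₁ ^ 2) + 4) * L)) := by
      intro p
      refine measure_weightedSum_le heps
        (b := B₁ * √L) (σ := σ₀ * C) (by positivity) (by positivity) hν0
        (fun r => (measurable_trunc _).comp (measurable_solVersion (r : ℤ) _))
        (fun r _ ω => abs_trunc_le (by positivity) _)
        (g := fun r v => CFC.sqrt (Sig (scaledTime n (r + 1))) p.2.2.2 ⬝ᵥ v)
        (fun r => by simp only [dotProduct]; fun_prop)
        (fun r hr => hemgf r hr _ _) (fun r _ => hwle _ _ r) le_rfl (hwsum _ _)
    refine (measure_exists_le hp).trans (card_mul_exp_le (k := 3) hn hcard ?_)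
    rw [← hLdef, mul_pow, Real.sq_sqrt hL0.le]
    push_cast
    linarith
  -- cross terms
  have hE4 : P {ω | ∃ p : Fin n × Fin 3 × Fin d × Fin d,
      (σ₀ * C * (3 * W ^ 2 * (2 * B₁) ^ 2) + 4) * L / √(n * h) <
        |∑ r ∈ Finset.range (n - 1), gridWeight n K h p.1 p.2.1 (r + 1) *
          (trunc (2 * B₁ * √L) ((A (scaledTime n (r + 1)) *ᵥ Z r ω) p.2.2.1) *
            e ω (r + 1) p.2.2.2)|} ≤
      ENNReal.ofReal (2 * (3 : ℕ) / (max n d : ℕ)) := by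
    -- The level is doubled because A X_r = X_{r+1} − e_{r+1} is a difference of two quantities
    -- bounded by B₁√L; no bound on the rows of A is needed.
    have hp : ∀ p : Fin n × Fin 3 × Fin d × Fin d, P {ω |
      (σ₀ * C * (3 * W ^ 2 * (2 * B₁) ^ 2) + 4) * L / √(n * h) <
        |∑ r ∈ Finset.range (n - 1), gridWeight n K h p.1 p.2.1 (r + 1) *
          (trunc (2 * B₁ * √L) ((A (scaledTime n (r + 1)) *ᵥ Z r ω) p.2.2.1) *
            e ω (r + 1) p.2.2.2)|} ≤
        ENNReal.ofReal (2 * Real.exp (σ₀ * C * (3 * W ^ 2 * (2 * B₁ * √L) ^ 2) -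
          (σ₀ * C * (3 * W ^ 2 * (2 * B₁) ^ 2) + 4) * L)) := by
      intro p
      refine measure_weightedSum_le heps
        (w := fun r => gridWeight n K h p.1 p.2.1 (r + 1))
        (b := 2 * B₁ * √L) (σ := σ₀ * C) (by positivity) (by positivity) hν0
        (fun r => (measurable_trunc _).comp ?_)
        (fun r _ ω => abs_trunc_le (by positivity) _)
        (g := fun r v => CFC.sqrt (Sig (scaledTime n (r + 1))) p.2.2.2 ⬝ᵥ v)
        (fun r => by simp only [dotProduct]; fun_prop)
        (fun r hr => hemgf r (by omega) _ _) (fun r _ => hwle _ _ (r + 1)) le_rfl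
        (hwsum' _ _)
      simp only [Matrix.mulVec, dotProduct]
      exact Finset.measurable_sum _ fun j _ => (measurable_solVersion (r : ℤ) j).const_mul _
    refine (measure_exists_le hp).trans (card_mul_exp_le (k := 3) hn hcard ?_)
    rw [← hLdef, mul_pow, Real.sq_sqrt hL0.le]
    push_cast
    linarith
  -- products of innovations
  have hE5 : P {ω | ∃ p : Fin n × Fin 3 × Fin d × Fin d,
      (productProxy ι₁ C₀ C * (3 * W ^ 2) + 4) * L / √(n * h) <
        |∑ r ∈ Finset.range (n - 1), gridWeight n K h p.1 p.2.1 (r + 1) *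
          (1 * (e ω (r + 1) p.2.2.1 * e ω (r + 1) p.2.2.2 -
            Sig (scaledTime n (r + 1)) p.2.2.1 p.2.2.2))|} ≤
      ENNReal.ofReal (2 * (3 : ℕ) / (max n d : ℕ)) := by
    have hp : ∀ p : Fin n × Fin 3 × Fin d × Fin d, P {ω |
      (productProxy ι₁ C₀ C * (3 * W ^ 2) + 4) * L / √(n * h) <
        |∑ r ∈ Finset.range (n - 1), gridWeight n K h p.1 p.2.1 (r + 1) *
          (1 * (e ω (r + 1) p.2.2.1 * e ω (r + 1) p.2.2.2 -
            Sig (scaledTime n (r + 1)) p.2.2.1 p.2.2.2))|} ≤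
        ENNReal.ofReal (2 * Real.exp (productProxy ι₁ C₀ C * (3 * W ^ 2 * 1 ^ 2) -
          (productProxy ι₁ C₀ C * (3 * W ^ 2) + 4) * L)) := by
      intro p
      refine measure_weightedSum_le heps
        (w := fun r => gridWeight n K h p.1 p.2.1 (r + 1)) (a := fun _ _ => 1)
        (b := 1) zero_le_one hσ' hν0
        (fun r => measurable_const) (fun r _ ω => by simp)
        (g := fun r v => (CFC.sqrt (Sig (scaledTime n (r + 1))) p.2.2.1 ⬝ᵥ v) *
          (CFC.sqrt (Sig (scaledTime n (r + 1))) p.2.2.2 ⬝ᵥ v) -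
            Sig (scaledTime n (r + 1)) p.2.2.1 p.2.2.2)
        (fun r => by simp only [dotProduct]; fun_prop)
        (fun r hr => ?_) (fun r _ => hwle _ _ (r + 1)) (by simpa using hνW)
        (hwsum' _ _)
      have hr' : r < n := by omega
      rw [← sqrt_row_dotProduct (hSig.posSemidef _ (hτ r hr'))]
      exact heps.hasMGFBound_mul hι (r + 1) hC (hrow r hr' _) (hrow r hr' _) i₀
    refine (measure_exists_le hp).trans (card_mul_exp_le (k := 3) hn hcard ?_)
    have hσW : 0 ≤ productProxy ι₁ C₀ C * (3 * W ^ 2) := by positivity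
    have := mul_le_mul_of_nonneg_left hL hσW
    rw [← hLdef]
    push_cast
    linarith
  -- the union of the exceptional events
  have hrec : ∀ᵐ ω ∂P, ∀ r : ℕ, r < n → X (r + 1) ω = A (scaledTime n (r + 1)) *ᵥ X r ω +
      e ω (r + 1) := by
    rw [ae_all_iff]
    intro r
    rw [eventually_imp_distrib_left]
    intro hr
    have := hX.recursion (r + 1) (by omega) (by omega)
    filter_upwards [this] with ω hω
    have e1 : (((r + 1 : ℤ)) - 1) = r := by ring
    rw [hω, e1]
  have hver : ∀ᵐ ω ∂P, ∀ r : ℕ, r < n → Z r ω = X r ω := by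
    rw [ae_all_iff]
    intro r
    rw [eventually_imp_distrib_left]
    intro hr
    exact hX.solVersion_eq (by omega) (by omega)
  have hsub : ∀ᵐ ω ∂P, (¬ GoodPath n K h A Sig L (pathLevel ι₁ C₀ C₁ ρ C W) (fun t => X t ω)
      (e ω)) → ω ∈ ({ω | ∃ p : Fin n × Fin d, B₁ * √L < |Z (p.1 : ℕ) ω p.2|} ∪
        {ω | ∃ p : Fin n × Fin d, B₁ * √L < |e ω ((p.1 : ℕ) + 1) p.2|}) ∪
      (({ω | ∃ p : Fin n × Fin 3 × Fin d × Fin d,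
        (σ₀ * C * (3 * W ^ 2 * B₁ ^ 2) + 4) * L / √(n * h) <
        |∑ r ∈ Finset.range n, gridWeight n K h p.1 p.2.1 r *
          (trunc (B₁ * √L) (Z r ω p.2.2.1) * e ω (r + 1) p.2.2.2)|} ∪
      {ω | ∃ p : Fin n × Fin 3 × Fin d × Fin d,
        (σ₀ * C * (3 * W ^ 2 * (2 * B₁) ^ 2) + 4) * L / √(n * h) <
        |∑ r ∈ Finset.range (n - 1), gridWeight n K h p.1 p.2.1 (r + 1) *
          (trunc (2 * B₁ * √L) ((A (scaledTime n (r + 1)) *ᵥ Z r ω) p.2.2.1) *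
            e ω (r + 1) p.2.2.2)|}) ∪
      {ω | ∃ p : Fin n × Fin 3 × Fin d × Fin d,
        (productProxy ι₁ C₀ C * (3 * W ^ 2) + 4) * L / √(n * h) <
        |∑ r ∈ Finset.range (n - 1), gridWeight n K h p.1 p.2.1 (r + 1) *
          (1 * (e ω (r + 1) p.2.2.1 * e ω (r + 1) p.2.2.2 -
            Sig (scaledTime n (r + 1)) p.2.2.1 p.2.2.2))|}) := by
    filter_upwards [hrec, hver] with ω h1 h2
    contrapose!
    intro hω
    simp only [mem_union, mem_ofPred_eq, not_or, not_exists, not_lt, Prod.forall] at hω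
    obtain ⟨⟨b1, b2⟩, ⟨b3, b4⟩, b5⟩ := hω
    have hq : 0 ≤ L / √(n * h) := by positivity
    have hbX : ∀ r : ℕ, r < n → ∀ j, |X r ω j| ≤ B₁ * √L := by
      intro r hr j
      rw [← h2 r hr]
      exact b1 ⟨r, hr⟩ j
    have hx1 : 0 ≤ σ₀ * C * (3 * W ^ 2 * B₁ ^ 2) + 4 := by positivity
    have hx2 : 0 ≤ σ₀ * C * (3 * W ^ 2 * (2 * B₁) ^ 2) + 4 := by positivity
    have hx3 : 0 ≤ productProxy ι₁ C₀ C * (3 * W ^ 2) + 4 := by positivity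
    refine ⟨h1, fun r hr j => (hbX r hr j).trans ?_, fun t ht k hk i j => ?_,
      fun t ht k hk j l => ?_⟩
    · gcongr
      rw [pathLevel, ← hB₁, ← hσ₀]
      linarith
    · have := b3 ⟨t, ht⟩ ⟨k, hk⟩ j i
      rw [Finset.sum_congr rfl fun r hr => by
        rw [h2 r (Finset.mem_range.1 hr), trunc_of_le (hbX r (Finset.mem_range.1 hr) j)]] at this
      refine this.trans ?_
      rw [mul_div_assoc, mul_div_assoc]
      gcongr
      rw [pathLevel, ← hB₁, ← hσ₀]
      linarith
    · have c4 := b4 ⟨t, ht⟩ ⟨k, hk⟩ j l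
      have c5 := b5 ⟨t, ht⟩ ⟨k, hk⟩ j l
      rw [Finset.sum_congr rfl fun r hr => by
        have hr1 : r + 1 < n := by have := Finset.mem_range.1 hr; omega
        rw [h2 r (by omega), trunc_of_le (by
          have e1 : (A (scaledTime n (r + 1)) *ᵥ X r ω) j = X (r + 1) ω j - e ω (r + 1) j := by
            rw [h1 r (by omega)]; simp
          rw [e1]
          have u1 := hbX (r + 1) hr1 j
          have u2 := b2 ⟨r, by omega⟩ j
          push_cast at u1
          refine (abs_sub _ _).trans ?_
          simp only at u2
          linarith)]] at c4
      have hsplit : ∑ r ∈ Finset.range (n - 1), gridWeight n K h t k (r + 1) *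
          (2 * ((A (scaledTime n (r + 1)) *ᵥ X r ω) j * e ω (r + 1) l) +
            (e ω (r + 1) j * e ω (r + 1) l - Sig (scaledTime n (r + 1)) j l)) =
          2 * ∑ r ∈ Finset.range (n - 1), gridWeight n K h t k (r + 1) *
            ((A (scaledTime n (r + 1)) *ᵥ X r ω) j * e ω (r + 1) l) +
          ∑ r ∈ Finset.range (n - 1), gridWeight n K h t k (r + 1) *
            (1 * (e ω (r + 1) j * e ω (r + 1) l - Sig (scaledTime n (r + 1)) j l)) := by
        rw [Finset.mul_sum, ← Finset.sum_add_distrib]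
        exact Finset.sum_congr rfl fun r _ => by ring
      rw [hsplit]
      refine (abs_add_le _ _).trans ?_
      rw [abs_mul, abs_two]
      refine (add_le_add (mul_le_mul_of_nonneg_left c4 zero_le_two) c5).trans ?_
      rw [mul_div_assoc, mul_div_assoc, mul_div_assoc, ← mul_assoc, ← add_mul]
      gcongr
      rw [pathLevel, ← hB₁, ← hσ₀]
      linarith
  refine (measure_mono_ae hsub).trans ?_
  refine (measure_union_le _ _).trans ((add_le_add ((measure_union_le _ _).trans
    (add_le_add hE1 hE2)) ((measure_union_le _ _).trans (add_le_add
      ((measure_union_le _ _).trans (add_le_add hE3 hE4)) hE5))).trans ?_)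
  rw [← ENNReal.ofReal_add (by positivity) (by positivity),
    ← ENNReal.ofReal_add (by positivity) (by positivity),
    ← ENNReal.ofReal_add (by positivity) (by positivity),
    ← ENNReal.ofReal_add (by positivity) (by positivity)]
  refine ENNReal.ofReal_le_ofReal (le_of_eq ?_)
  push_cast
  ring

end

/-! ### Local linear approximation -/

section Taylor

variable {f : ℝ → ℝ} {M : ℝ}

theorem abs_derivWithin_sub_le (hf : ContDiffOn ℝ 2 f (Icc 0 1))
    (hM : ∀ τ ∈ Icc (0 : ℝ) 1, |iteratedDerivWithin 2 f (Icc 0 1) τ| ≤ M) {x y : ℝ}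
    (hx : x ∈ Icc (0 : ℝ) 1) (hy : y ∈ Icc (0 : ℝ) 1) :
    |derivWithin f (Icc 0 1) x - derivWithin f (Icc 0 1) y| ≤ M * |x - y| := by
  have hu : UniqueDiffOn ℝ (Icc (0 : ℝ) 1) := uniqueDiffOn_Icc zero_lt_one
  have h1 : ContDiffOn ℝ 1 (derivWithin f (Icc 0 1)) (Icc 0 1) :=
    hf.derivWithin hu (by norm_num)
  refine Convex.norm_image_sub_le_of_norm_derivWithin_le (h1.differentiableOn one_ne_zero)
    (fun z hz => ?_) (convex_Icc 0 1) hy hx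
  have := hM z hz
  rwa [iteratedDerivWithin_succ, iteratedDerivWithin_one] at this

/-- The mean value inequality for z ↦ f z − f'(y) z, whose derivative is at most M|x − y| on the
segment. The missing factor 1/2 is immaterial. -/
theorem abs_sub_linear_le (hf : ContDiffOn ℝ 2 f (Icc 0 1))
    (hM : ∀ τ ∈ Icc (0 : ℝ) 1, |iteratedDerivWithin 2 f (Icc 0 1) τ| ≤ M) {x y : ℝ}
    (hx : x ∈ Icc (0 : ℝ) 1) (hy : y ∈ Icc (0 : ℝ) 1) :
    |f x - f y - derivWithin f (Icc 0 1) y * (x - y)| ≤ M * (x - y) ^ 2 := by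
  have hM0 : 0 ≤ M := (abs_nonneg _).trans (hM x hx)
  have hd : DifferentiableOn ℝ f (Icc 0 1) := hf.differentiableOn (by norm_num)
  have hsub : uIcc y x ⊆ Icc (0 : ℝ) 1 := uIcc_subset_Icc hy hx
  have hg : ∀ z ∈ uIcc y x, HasDerivWithinAt
      (fun z => f z - derivWithin f (Icc 0 1) y * z)
      (derivWithin f (Icc 0 1) z - derivWithin f (Icc 0 1) y * 1) (uIcc y x) z := by
    intro z hz
    have h1 := ((hd z (hsub hz)).hasDerivWithinAt).mono hsub
    exact h1.sub ((hasDerivWithinAt_id z _).const_mul _)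
  have := (convex_uIcc y x).norm_image_sub_le_of_norm_hasDerivWithin_le
    (C := M * |x - y|) hg (fun z hz => ?_) left_mem_uIcc right_mem_uIcc
  · rw [Real.norm_eq_abs, Real.norm_eq_abs, mul_assoc, abs_mul_abs_self, ← sq] at this
    convert this using 2
    ring
  · rw [mul_one, Real.norm_eq_abs]
    refine (abs_derivWithin_sub_le hf hM (hsub hz) hy).trans ?_
    have hz' : |z - y| ≤ |x - y| := abs_sub_left_of_mem_uIcc hz
    gcongr

/-- A function whose derivative vanishes at the grid points `1/n, …, n/n` varies little. -/
theorem abs_sub_le_of_derivWithin_grid_eq_zero {n : ℕ} (hn : 0 < n)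
    (hf : ContDiffOn ℝ 2 f (Icc 0 1))
    (hM : ∀ τ ∈ Icc (0 : ℝ) 1, |iteratedDerivWithin 2 f (Icc 0 1) τ| ≤ M)
    (h0 : ∀ r : ℕ, r < n → derivWithin f (Icc 0 1) (((r : ℝ) + 1) / n) = 0) {x y : ℝ}
    (hx : x ∈ Icc (1 / (n : ℝ)) 1) (hy : y ∈ Icc (1 / (n : ℝ)) 1) : |f x - f y| ≤ M / n := by
  have hn' : (0 : ℝ) < n := by exact_mod_cast hn
  have hd : DifferentiableOn ℝ f (Icc 0 1) := hf.differentiableOn (by norm_num)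
  have hsub : Icc (1 / (n : ℝ)) 1 ⊆ Icc 0 1 := Icc_subset_Icc_left (by positivity)
  have hM0 : 0 ≤ M := (abs_nonneg _).trans (hM x (hsub hx))
  have hbound : ∀ z ∈ Icc (1 / (n : ℝ)) 1, ‖derivWithin f (Icc 0 1) z‖ ≤ M / n := by
    intro z hz
    have hz0 : 0 ≤ (n : ℝ) * z := mul_nonneg hn'.le (hsub hz).1
    have hz1 : 1 ≤ (n : ℝ) * z := by
      have := hz.1
      rw [div_le_iff₀ hn'] at this
      linarith
    have hfl : 1 ≤ ⌊(n : ℝ) * z⌋₊ := Nat.le_floor (by exact_mod_cast hz1)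
    have hfl2 : (⌊(n : ℝ) * z⌋₊ : ℝ) ≤ n * z := Nat.floor_le hz0
    have hfl3 := Nat.lt_floor_add_one ((n : ℝ) * z)
    have hfln : ⌊(n : ℝ) * z⌋₊ ≤ n := by
      have : (⌊(n : ℝ) * z⌋₊ : ℝ) ≤ n := hfl2.trans (mul_le_of_le_one_right hn'.le hz.2)
      exact_mod_cast this
    -- The derivative at z is compared with that at the grid point ⌊nz⌋/n just below it, which is at
    -- least 1/n because z is; hence the index shift by one.
    have hr := h0 (⌊(n : ℝ) * z⌋₊ - 1) (by omega)
    have hcast : ((⌊(n : ℝ) * z⌋₊ - 1 : ℕ) : ℝ) + 1 = ⌊(n : ℝ) * z⌋₊ := by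
      push_cast [hfl]
      ring
    rw [hcast] at hr
    have hmem : (⌊(n : ℝ) * z⌋₊ : ℝ) / n ∈ Icc (0 : ℝ) 1 := by
      refine ⟨by positivity, ?_⟩
      rw [div_le_one hn']
      exact_mod_cast hfln
    have := abs_derivWithin_sub_le hf hM (hsub hz) hmem
    rw [hr, sub_zero] at this
    refine this.trans ?_
    rw [div_eq_mul_one_div M]
    gcongr
    have h5 : (⌊(n : ℝ) * z⌋₊ : ℝ) / n ≤ z := by
      rw [div_le_iff₀ hn']
      linarith
    rw [abs_of_nonneg (by linarith), sub_le_iff_le_add, ← add_div, le_div_iff₀ hn']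
    linarith
  have hC : 0 ≤ M / n := by positivity
  have := Convex.norm_image_sub_le_of_norm_hasDerivWithin_le
    (fun z hz => (hd z (hsub hz)).hasDerivWithinAt.mono hsub) hbound
    (convex_Icc _ _) hy hx
  refine this.trans (mul_le_of_le_one_right hC ?_)
  rw [Real.norm_eq_abs, abs_le]
  have := (hsub hx).1
  have := (hsub hy).1
  constructor <;> linarith [hx.2, hy.2]

end Taylor

/-! ### Positivity of the local design -/

/-- An affine function is determined by its values at two points: b is the difference quotient over
a gap of at least η, and then a = x − vb with v ≤ 1. -/
theorem sq_add_sq_le_of_two_points {a b v v' η : ℝ} (hη : 0 < η) (hv : 0 ≤ v) (hvv : v + η ≤ v')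
    (hv' : v' ≤ 1) : η ^ 2 / 8 * (a ^ 2 + b ^ 2) ≤ (a + v * b) ^ 2 + (a + v' * b) ^ 2 := by
  set x := a + v * b with hx
  set y := a + v' * b with hy
  have h1 : b ^ 2 * η ^ 2 ≤ 2 * (x ^ 2 + y ^ 2) := by
    have : b ^ 2 * η ^ 2 ≤ b ^ 2 * (v' - v) ^ 2 := by
      gcongr
      linarith
    have h2 : b ^ 2 * (v' - v) ^ 2 = (y - x) ^ 2 := by rw [hx, hy]; ring
    nlinarith [sq_nonneg (x + y)]
  have h3 : a ^ 2 ≤ 2 * x ^ 2 + 2 * b ^ 2 := by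
    have e : a = x - v * b := by rw [hx]; ring
    have h4 : (v * b) ^ 2 ≤ b ^ 2 := by
      rw [mul_pow]
      exact mul_le_of_le_one_left (sq_nonneg b) (pow_le_one₀ hv (by linarith))
    have h5 : a ^ 2 = x ^ 2 - 2 * x * (v * b) + (v * b) ^ 2 := by rw [e]; ring
    nlinarith [sq_nonneg (x + v * b)]
  have hη1 : η ^ 2 ≤ 1 := pow_le_one₀ hη.le (by linarith)
  have h6 : a ^ 2 * η ^ 2 ≤ (2 * x ^ 2 + 2 * b ^ 2) * η ^ 2 := by gcongr
  have h7 : x ^ 2 * η ^ 2 ≤ x ^ 2 := mul_le_of_le_one_right (sq_nonneg x) hη1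
  nlinarith [sq_nonneg y]

/-- K is positive somewhere, by symmetry at some y in [0,1], and by continuity near y. The interval
extends to the right or to the left of y according as y ≤ 1/2 or not, so that it stays in [0,1]. -/
theorem IsKernel.exists_interval {K : ℝ → ℝ} (hK : IsKernel K) :
    ∃ p q k₀ : ℝ, 0 ≤ p ∧ p < q ∧ q ≤ 1 ∧ 0 < k₀ ∧ ∀ x ∈ Icc p q, k₀ ≤ K x := by
  obtain ⟨x₀, hx₀⟩ : ∃ x, 0 < K x := by
    by_contra! hcon
    have h0 : K = fun _ => 0 := funext fun x => le_antisymm (hcon x) (hK.nonneg x)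
    have := hK.integral_one
    rw [h0] at this
    simp at this
  set y := |x₀| with hy
  have hKy : K y = K x₀ := by
    rcases abs_choice x₀ with h | h
    · rw [hy, h]
    · rw [hy, h, hK.symm]
  have hy1 : y ≤ 1 := by
    by_contra hcon
    rw [hK.support x₀ (not_le.1 hcon)] at hx₀
    exact lt_irrefl _ hx₀
  have hy0 : 0 ≤ y := abs_nonneg _
  obtain ⟨δ, hδ, hball⟩ := Metric.continuous_iff.1 hK.continuous y (K x₀ / 2) (by positivity)
  have hlow : ∀ x, |x - y| ≤ min (δ / 2) (1 / 2) → K x₀ / 2 ≤ K x := by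
    intro x hx
    have h1 := hball x (by
      rw [Real.dist_eq]
      exact lt_of_le_of_lt (hx.trans (min_le_left _ _)) (by linarith))
    rw [Real.dist_eq, hKy] at h1
    linarith [(abs_lt.1 h1).1]
  have hm : 0 < min (δ / 2) (1 / 2) := by positivity
  have hm2 : min (δ / 2) (1 / 2) ≤ 1 / 2 := min_le_right _ _
  rcases le_total y (1 / 2) with h | h
  · refine ⟨y, y + min (δ / 2) (1 / 2), K x₀ / 2, hy0, by linarith, by linarith, by positivity,
      fun x hx => hlow x ?_⟩
    rw [abs_of_nonneg (by linarith [hx.1])]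
    linarith [hx.2]
  · refine ⟨y - min (δ / 2) (1 / 2), y, K x₀ / 2, by linarith, by linarith, hy1, by positivity,
      fun x hx => hlow x ?_⟩
    rw [abs_of_nonpos (by linarith [hx.2])]
    linarith [hx.1]

theorem sum_comp_le_sum_range {m N : ℕ} {F : ℕ → ℝ} (hF : ∀ r, 0 ≤ F r) {φ : ℕ → ℕ}
    (hφ : ∀ i < m, φ i < N) (hinj : Set.InjOn φ (Finset.range m)) :
    ∑ i ∈ Finset.range m, F (φ i) ≤ ∑ r ∈ Finset.range N, F r := by
  rw [← Finset.sum_image hinj]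
  refine Finset.sum_le_sum_of_subset_of_nonneg ?_ fun r _ _ => hF r
  intro r hr
  obtain ⟨i, hi, rfl⟩ := Finset.mem_image.1 hr
  exact Finset.mem_range.2 (hφ i (Finset.mem_range.1 hi))

theorem gridWeight_zero_nonneg {K : ℝ → ℝ} (hK : IsKernel K) (n : ℕ) {h : ℝ} (hh : 0 < h)
    (t r : ℕ) : 0 ≤ gridWeight n K h t 0 r := by
  have := hK.nonneg (((r : ℝ) - t) / (n * h))
  rw [gridWeight]
  positivity

/-- About nh(q − p) rescaled grid points fall where K ≥ k₀. They are split into two consecutive runs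
and paired across a gap of at least η, and each pair contributes the two-point bound. For t in the
first half of the sample the points to the right are used, otherwise those to the left, so boundary
points need no separate treatment; h ≤ 1/4 makes the runs fit. -/
theorem IsKernel.exists_design_lower_bound {K : ℝ → ℝ} (hK : IsKernel K) :
    ∃ κ ν₀ : ℝ, 0 < κ ∧ ∀ (n : ℕ) (h : ℝ), 0 < n → 0 < h → h ≤ 1 / 4 → ν₀ ≤ n * h →
      ∀ t < n, ∀ a b : ℝ, κ * (a ^ 2 + b ^ 2) ≤
        ∑ r ∈ Finset.range (n - 1), gridWeight n K h t 0 (r + 1) *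
          (a + (((r + 1 : ℕ) : ℝ) - t) / (n * h) * b) ^ 2 := by
  obtain ⟨p, q, k₀, hp, hpq, hq, hk₀, hlow⟩ := hK.exists_interval
  set η := (q - p) / 4 with hηdef
  have hη : 0 < η := by rw [hηdef]; linarith
  refine ⟨k₀ * η ^ 3 / 8, 1 / η, by positivity, fun n h hn hh hh4 hν t ht a b => ?_⟩
  have hn' : (0 : ℝ) < n := by exact_mod_cast hn
  set ν := (n : ℝ) * h with hνdef
  have hν0 : 0 < ν := by positivity
  have hνn : ν ≤ n / 4 := by rw [hνdef]; nlinarith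
  have hνη : 1 ≤ ν * η := by rwa [div_le_iff₀ hη] at hν
  set m₁ := ⌊p * ν⌋₊ + 1 with hm₁
  -- Two runs of length M₀ have total length at most 4νη = (q − p)ν, so they stay below qν; and νη ≥
  -- 1 gives M₀ ≥ νη, so the shift by M₀ separates paired points by at least η after rescaling.
  set M₀ := ⌊2 * (ν * η)⌋₊ with hM₀
  have hm₁l : p * ν ≤ m₁ := by
    have := Nat.lt_floor_add_one (p * ν)
    rw [hm₁]; push_cast; linarith
  have hm₁u : (m₁ : ℝ) ≤ p * ν + 1 := by
    have := Nat.floor_le (by positivity : 0 ≤ p * ν)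
    rw [hm₁]; push_cast; linarith
  have hM₀u : (M₀ : ℝ) ≤ 2 * (ν * η) := Nat.floor_le (by positivity)
  have hM₀l : ν * η ≤ M₀ := by
    have := Nat.lt_floor_add_one (2 * (ν * η))
    linarith
  have hrange : ∀ i < M₀ + M₀, ((m₁ + i : ℕ) : ℝ) ≤ q * ν := by
    intro i hi
    have hi' : (i : ℝ) + 1 ≤ M₀ + M₀ := by exact_mod_cast hi
    have e : 4 * (ν * η) = q * ν - p * ν := by rw [hηdef]; ring
    push_cast
    linarith
  have hrangeN : ∀ i < M₀ + M₀, 4 * (m₁ + i) ≤ n := by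
    intro i hi
    have h1 := hrange i hi
    have h2 : q * ν ≤ ν := mul_le_of_le_one_left hν0.le hq
    have : ((4 * (m₁ + i) : ℕ) : ℝ) ≤ n := by
      push_cast at h1 ⊢
      linarith
    exact_mod_cast this
  have hvmem : ∀ i < M₀ + M₀, ((m₁ + i : ℕ) : ℝ) / ν ∈ Icc p q := by
    intro i hi
    refine ⟨?_, ?_⟩
    · rw [le_div_iff₀ hν0]
      push_cast
      have : (0 : ℝ) ≤ i := by positivity
      linarith
    · rw [div_le_iff₀ hν0]
      exact hrange i hi
  -- lower bound along a monotone run of grid points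
  have hrun : ∀ b : ℝ, k₀ * η ^ 3 / 8 * (a ^ 2 + b ^ 2) ≤
      ∑ i ∈ Finset.range (M₀ + M₀), k₀ / ν * (a + ((m₁ + i : ℕ) : ℝ) / ν * b) ^ 2 := by
    intro b
    rw [← Finset.mul_sum, Finset.sum_range_add, ← Finset.sum_add_distrib]
    have h1 : ∀ i ∈ Finset.range M₀, η ^ 2 / 8 * (a ^ 2 + b ^ 2) ≤
        (a + ((m₁ + i : ℕ) : ℝ) / ν * b) ^ 2 + (a + ((m₁ + (M₀ + i) : ℕ) : ℝ) / ν * b) ^ 2 := by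
      intro i hi
      have hi' := Finset.mem_range.1 hi
      refine sq_add_sq_le_of_two_points hη (hp.trans (hvmem i (by omega)).1) ?_
        ((hvmem (M₀ + i) (by omega)).2.trans hq)
      have : η ≤ M₀ / ν := by
        rw [le_div_iff₀ hν0]
        linarith
      push_cast
      rw [add_div, add_div, add_div]
      linarith
    have h2 := Finset.sum_le_sum h1
    rw [Finset.sum_const, Finset.card_range, nsmul_eq_mul] at h2
    calc k₀ * η ^ 3 / 8 * (a ^ 2 + b ^ 2)
        = k₀ / ν * (ν * η * (η ^ 2 / 8 * (a ^ 2 + b ^ 2))) := by field_simp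
      _ ≤ k₀ / ν * (M₀ * (η ^ 2 / 8 * (a ^ 2 + b ^ 2))) := by gcongr
      _ ≤ _ := by gcongr
  have hF : ∀ r : ℕ, 0 ≤ gridWeight n K h t 0 (r + 1) *
      (a + (((r + 1 : ℕ) : ℝ) - t) / ν * b) ^ 2 := fun r =>
    mul_nonneg (gridWeight_zero_nonneg hK n hh _ _) (sq_nonneg _)
  have hweight : ∀ r : ℕ, gridWeight n K h t 0 r = K (((r : ℝ) - t) / ν) / ν := by
    intro r
    rw [gridWeight, hνdef]
    field_simp
  rcases le_or_gt (2 * t) n with hcase | hcase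
  · refine (hrun b).trans (le_trans (Finset.sum_le_sum fun i hi => ?_)
      (sum_comp_le_sum_range (φ := fun i => t + (m₁ + i) - 1) hF (fun i hi => ?_) ?_))
    · have e1 : t + (m₁ + i) - 1 + 1 = t + (m₁ + i) := by omega
      have e2 : ((t + (m₁ + i) : ℕ) : ℝ) - t = ((m₁ + i : ℕ) : ℝ) := by push_cast; ring
      simp only [e1, hweight, e2]
      have := hlow _ (hvmem i (Finset.mem_range.1 hi))
      gcongr
    · have := hrangeN i hi
      show t + (m₁ + i) - 1 < n - 1
      omega
    · intro i _ j _ hij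
      simp only at hij
      omega
  · have hb := hrun (-b)
    rw [neg_sq] at hb
    refine hb.trans (le_trans (Finset.sum_le_sum fun i hi => ?_)
      (sum_comp_le_sum_range (φ := fun i => t - (m₁ + i) - 1) hF (fun i hi => ?_) ?_))
    · have hi' := hrangeN i (Finset.mem_range.1 hi)
      have e1 : t - (m₁ + i) - 1 + 1 = t - (m₁ + i) := by omega
      have e2 : ((t - (m₁ + i) : ℕ) : ℝ) - t = -((m₁ + i : ℕ) : ℝ) := by
        rw [Nat.cast_sub (by omega)]; ring
      simp only [e1, hweight, e2, neg_div, hK.symm]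
      have := hlow _ (hvmem i (Finset.mem_range.1 hi))
      rw [mul_neg, neg_mul]
      gcongr
    · have := hrangeN i hi
      show t - (m₁ + i) - 1 < n - 1
      omega
    · intro i hi j hj hij
      have h1 := hrangeN i (Finset.mem_range.1 hi)
      have h2 := hrangeN j (Finset.mem_range.1 hj)
      simp only at hij
      omega

/-! ### Euclidean norms of finite families -/

section Norms

variable {ι : Type*} [Fintype ι]

theorem l2_eq_norm (v : ι → ℝ) : l2 v = ‖(WithLp.toLp 2 v : EuclideanSpace ℝ ι)‖ := by
  rw [l2, EuclideanSpace.norm_eq]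
  simp

theorem l2_nonneg (v : ι → ℝ) : 0 ≤ l2 v := Real.sqrt_nonneg _

theorem l2_sq (v : ι → ℝ) : l2 v ^ 2 = ∑ t, v t ^ 2 :=
  Real.sq_sqrt (Finset.sum_nonneg fun _ _ => sq_nonneg _)

theorem l2_zero : l2 (fun _ : ι => (0 : ℝ)) = 0 := by simp [l2]

theorem l2_eq_zero {v : ι → ℝ} : l2 v = 0 ↔ ∀ t, v t = 0 := by
  rw [l2, Real.sqrt_eq_zero (Finset.sum_nonneg fun _ _ => sq_nonneg _),
    Finset.sum_eq_zero_iff_of_nonneg fun _ _ => sq_nonneg _]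
  simp

theorem l2_add_le (v w : ι → ℝ) : l2 (fun t => v t + w t) ≤ l2 v + l2 w := by
  simp only [l2_eq_norm]
  exact norm_add_le (WithLp.toLp 2 v) (WithLp.toLp 2 w)

theorem l2_neg (v : ι → ℝ) : l2 (fun t => -v t) = l2 v := by simp [l2]

theorem l2_smul {c : ℝ} (hc : 0 ≤ c) (v : ι → ℝ) : l2 (fun t => c * v t) = c * l2 v := by
  simp only [l2, mul_pow]
  rw [← Finset.mul_sum, Real.sqrt_mul (sq_nonneg c), Real.sqrt_sq hc]

theorem l2_abs (v : ι → ℝ) : l2 (fun t => |v t|) = l2 v := by simp [l2]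

theorem l2_le_add_sub (v w : ι → ℝ) : l2 v ≤ l2 w + l2 (fun t => v t - w t) := by
  have := l2_add_le w fun t => v t - w t
  simpa using this

theorem l2_sum_le {κ : Type*} (S : Finset κ) (v : κ → ι → ℝ) :
    l2 (fun t => ∑ j ∈ S, v j t) ≤ ∑ j ∈ S, l2 (v j) := by
  simp only [l2_eq_norm]
  have e : (WithLp.toLp 2 fun t => ∑ j ∈ S, v j t : EuclideanSpace ℝ ι) =
      ∑ j ∈ S, WithLp.toLp 2 (v j) := by
    ext t
    simp
  rw [e]
  exact norm_sum_le S _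

theorem sum_abs_mul_le_l2 (v w : ι → ℝ) : |∑ t, v t * w t| ≤ l2 v * l2 w := by
  have h := Finset.sum_mul_sq_le_sq_mul_sq Finset.univ v w
  rw [← l2_sq, ← l2_sq, ← mul_pow] at h
  exact abs_le_of_sq_le_sq h (mul_nonneg (l2_nonneg _) (l2_nonneg _))

theorem abs_le_l2 (v : ι → ℝ) (t : ι) : |v t| ≤ l2 v := by
  rw [← Real.sqrt_sq_eq_abs, l2]
  exact Real.sqrt_le_sqrt
    (Finset.single_le_sum (f := fun t => v t ^ 2) (fun _ _ => sq_nonneg _) (Finset.mem_univ t))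

theorem l2_le_sqrt_mul {v : ι → ℝ} {b : ℝ} (hb : 0 ≤ b) (h : ∀ t, |v t| ≤ b) :
    l2 v ≤ √(Fintype.card ι) * b := by
  rw [l2, ← Real.sqrt_sq hb, ← Real.sqrt_mul (by positivity)]
  refine Real.sqrt_le_sqrt ?_
  calc ∑ t, v t ^ 2 ≤ ∑ _t : ι, b ^ 2 := Finset.sum_le_sum fun t _ => by
        rw [← sq_abs]
        exact pow_le_pow_left₀ (abs_nonneg _) (h t) 2
    _ = _ := by simp

theorem sum_abs_sq_le {S : Finset ι} (v : ι → ℝ) :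
    (∑ j ∈ S, |v j|) ^ 2 ≤ S.card * ∑ j, v j ^ 2 := by
  refine sq_sum_le_card_mul_sum_sq.trans ?_
  gcongr
  simp only [sq_abs]
  exact Finset.sum_le_sum_of_subset_of_nonneg (Finset.subset_univ _) fun _ _ _ => sq_nonneg _

end Norms

theorem l2dev_le_l2 {n : ℕ} (v : Fin n → ℝ) : l2dev v ≤ l2 v := by
  rcases Nat.eq_zero_or_pos n with rfl | hn
  · simp [l2dev, l2]
  have hn' : (n : ℝ) ≠ 0 := by exact_mod_cast hn.ne'
  rw [l2dev, l2, l2]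
  refine Real.sqrt_le_sqrt ?_
  set a := 1 / (n : ℝ) * ∑ s, v s with ha
  have hsum : ∑ s, v s = n * a := by rw [ha]; field_simp
  have e : ∑ t, (v t - a) ^ 2 = ∑ t, v t ^ 2 - n * a ^ 2 := by
    simp only [sub_sq]
    rw [Finset.sum_add_distrib, Finset.sum_sub_distrib, ← Finset.sum_mul, ← Finset.mul_sum, hsum]
    simp only [Finset.sum_const, Finset.card_univ, Fintype.card_fin, nsmul_eq_mul]
    ring
  rw [e]
  have : 0 ≤ (n : ℝ) * a ^ 2 := by positivity
  linarith

theorem l2dev_le_add_l2_sub {n : ℕ} (v w : Fin n → ℝ) :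
    l2dev v ≤ l2dev w + l2 (fun t => v t - w t) := by
  have h1 := l2_add_le (fun t => w t - 1 / (n : ℝ) * ∑ s, w s)
    (fun t => (v t - w t) - 1 / (n : ℝ) * ∑ s, (v s - w s))
  have h2 := l2dev_le_l2 fun t => v t - w t
  rw [l2dev] at h2 ⊢
  refine (le_of_eq ?_).trans (h1.trans (add_le_add le_rfl h2))
  congr 1
  funext t
  rw [Finset.sum_sub_distrib]
  ring

/-! ### The error of the LASSO -/

theorem sum_abs_split {ι : Type*} [Fintype ι] [DecidableEq ι] (S : Finset ι) (f : ι → ℝ) :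
    ∑ j, f j = ∑ j ∈ S, f j + ∑ j ∈ Sᶜ, f j := (Finset.sum_add_sum_compl S f).symm

/-- Here θ is the truth, u the error and g the score. A score below lam/6 turns minimality into the
cone condition b ≤ 2a, so |u|₁ ≤ 3a with a² ≤ m|u|². The defect δ|u|₁² then consumes at most half of
the curvature κ, and (κ/2)|u|² ≤ (4/3)·lam·√m·|u| remains. -/
theorem lasso_error_bound {ι : Type*} [Fintype ι] [DecidableEq ι] {q κ δ lam : ℝ}
    {g θ u : ι → ℝ} {S : Finset ι} {m : ℕ} (hκ : 0 < κ) (hδ : 0 ≤ δ) (hlam : 0 < lam)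
    (hq0 : 0 ≤ q) (hq : κ * ∑ j, u j ^ 2 - δ * (∑ j, |u j|) ^ 2 ≤ q)
    (hg : ∀ j, |g j| ≤ lam / 6) (hθ : ∀ j, j ∉ S → θ j = 0) (hS : S.card ≤ m)
    (hδm : 9 * δ * m ≤ κ / 2)
    (hmin : q - 2 * ∑ j, g j * u j + lam * ∑ j, |θ j + u j| ≤ lam * ∑ j, |θ j|) :
    l2 u ≤ 8 / (3 * κ) * (lam * √m) := by
  set a := ∑ j ∈ S, |u j| with ha
  set b := ∑ j ∈ Sᶜ, |u j| with hb
  have ha0 : 0 ≤ a := Finset.sum_nonneg fun _ _ => abs_nonneg _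
  have hb0 : 0 ≤ b := Finset.sum_nonneg fun _ _ => abs_nonneg _
  have hab : ∑ j, |u j| = a + b := sum_abs_split S _
  have h1 : ∑ j, |θ j| - a + b ≤ ∑ j, |θ j + u j| := by
    rw [sum_abs_split S fun j => |θ j|, sum_abs_split S fun j => |θ j + u j|]
    have hz : ∑ j ∈ Sᶜ, |θ j| = 0 := Finset.sum_eq_zero fun j hj => by
      rw [hθ j (Finset.mem_compl.1 hj), abs_zero]
    have hc : ∑ j ∈ Sᶜ, |θ j + u j| = b := Finset.sum_congr rfl fun j hj => by
      rw [hθ j (Finset.mem_compl.1 hj), zero_add]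
    have hs : ∑ j ∈ S, |θ j| - a ≤ ∑ j ∈ S, |θ j + u j| := by
      rw [ha, ← Finset.sum_sub_distrib]
      refine Finset.sum_le_sum fun j _ => ?_
      have := abs_sub (θ j + u j) (u j)
      rw [add_sub_cancel_right] at this
      linarith
    rw [hz, hc]
    linarith
  have h2 : 2 * ∑ j, g j * u j ≤ lam / 3 * (a + b) := by
    have : ∑ j, g j * u j ≤ ∑ j, lam / 6 * |u j| := Finset.sum_le_sum fun j _ => by
      calc g j * u j ≤ |g j * u j| := le_abs_self _
        _ = |g j| * |u j| := abs_mul _ _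
        _ ≤ _ := by gcongr; exact hg j
    rw [← Finset.mul_sum, hab] at this
    linarith
  have h3 : q + lam * (b - a) ≤ lam / 3 * (a + b) := by
    have := mul_le_mul_of_nonneg_left h1 hlam.le
    linarith
  have h4 : b ≤ 2 * a := by
    have : lam * b ≤ lam * (2 * a) := by linarith
    exact le_of_mul_le_mul_left this hlam
  have h5 : q ≤ 4 / 3 * (lam * a) := by
    have : 0 ≤ lam * b := by positivity
    linarith
  have ham : a ^ 2 ≤ m * l2 u ^ 2 := by
    rw [l2_sq]
    refine (sum_abs_sq_le u).trans ?_
    have : (S.card : ℝ) ≤ m := by exact_mod_cast hS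
    gcongr
  have ham' : a ≤ √m * l2 u := by
    refine (le_abs_self a).trans
      (abs_le_of_sq_le_sq ?_ (mul_nonneg (Real.sqrt_nonneg _) (l2_nonneg _)))
    rwa [mul_pow, Real.sq_sqrt (by positivity)]
  have h6 : δ * (∑ j, |u j|) ^ 2 ≤ κ / 2 * l2 u ^ 2 := by
    calc δ * (∑ j, |u j|) ^ 2 ≤ δ * (3 * a) ^ 2 := by
          rw [hab]; gcongr; linarith
      _ = 9 * δ * a ^ 2 := by ring
      _ ≤ 9 * δ * (m * l2 u ^ 2) := by gcongr
      _ = 9 * δ * m * l2 u ^ 2 := by ring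
      _ ≤ _ := by gcongr
  rw [← l2_sq] at hq
  have h7 : κ / 2 * l2 u ^ 2 ≤ 4 / 3 * (lam * (√m * l2 u)) := by
    have : lam * a ≤ lam * (√m * l2 u) := by gcongr
    linarith
  rcases (l2_nonneg u).eq_or_lt with h0 | hpos
  · rw [← h0]; positivity
  · have h8 : l2 u * (κ / 2 * l2 u) ≤ l2 u * (4 / 3 * (lam * √m)) := by linarith
    have h9 := le_of_mul_le_mul_left h8 hpos
    rw [div_mul_eq_mul_div, le_div_iff₀ (by positivity)]
    linarith

/-! ### The error and the support of the group LASSO -/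

/-- The quadratic form `∑_r w_r (z_r ⬝ v)²`. -/
def wQuad {ι : Type*} [Fintype ι] (R : Finset ℕ) (w : ℕ → ℝ) (z : ℕ → ι → ℝ) (v : ι → ℝ) : ℝ :=
  ∑ r ∈ R, w r * (∑ j, z r j * v j) ^ 2

section GroupLasso

variable {T ι : Type*} [Fintype T] [Fintype ι] [DecidableEq ι]

theorem wQuad_nonneg {ι : Type*} [Fintype ι] {R : Finset ℕ} {w : ℕ → ℝ} (hw : ∀ r, 0 ≤ w r) (z : ℕ → ι → ℝ) (v : ι → ℝ) :
    0 ≤ wQuad R w z v := Finset.sum_nonneg fun r _ => mul_nonneg (hw r) (sq_nonneg _)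

/-- The centred group LASSO objective. -/
def groupObj (Q : T → (ι → ℝ) → ℝ) (g : T → ι → ℝ) (pen : ι → ℝ) (v : T → ι → ℝ) : ℝ :=
  ∑ t, (Q t (v t) - 2 * ∑ j, g t j * v t j) + ∑ j, pen j * l2 fun t => v t j

/-- The cone argument in the group norms N j, taken over all grid points. Coordinates in S carry no
penalty, so the basic inequality reads ∑Q + lam·b ≤ 2G(a + b); 4G ≤ lam gives b ≤ a and ∑Q ≤ 2Ga.
The error is thus governed by the score level γ and not by lam. -/
theorem groupLasso_error_bound {Q : T → (ι → ℝ) → ℝ} {g u : T → ι → ℝ} {pen : ι → ℝ}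
    {S : Finset ι} {m : ℕ} {κ δ γ lam : ℝ} (hκ : 0 < κ) (hδ : 0 ≤ δ) (hγ : 0 ≤ γ) (hlam : 0 < lam)
    (hQ0 : ∀ t, 0 ≤ Q t (u t)) (hQz : ∀ t, Q t 0 = 0)
    (hQ : ∀ t, κ * ∑ j, u t j ^ 2 - δ * (∑ j, |u t j|) ^ 2 ≤ Q t (u t))
    (hg : ∀ t j, |g t j| ≤ γ) (hpen : ∀ j, pen j = if j ∈ S then 0 else lam) (hS : S.card ≤ m)
    (hδm : 4 * δ * m ≤ κ / 2) (hγlam : 4 * (γ * √(Fintype.card T)) ≤ lam)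
    (hmin : groupObj Q g pen u ≤ groupObj Q g pen 0) :
    (∀ j, l2 (fun t => u t j) ≤ 4 / κ * (γ * √(Fintype.card T) * √m)) ∧
      ∑ t, Q t (u t) ≤ 8 / κ * (γ * √(Fintype.card T) * √m) ^ 2 := by
  set G := γ * √(Fintype.card T) with hG
  have hG0 : 0 ≤ G := by positivity
  set N : ι → ℝ := fun j => l2 fun t => u t j with hN
  have hN0 : ∀ j, 0 ≤ N j := fun j => l2_nonneg _
  set a := ∑ j ∈ S, N j with ha
  set b := ∑ j ∈ Sᶜ, N j with hb
  have ha0 : 0 ≤ a := Finset.sum_nonneg fun j _ => hN0 j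
  have hb0 : 0 ≤ b := Finset.sum_nonneg fun j _ => hN0 j
  have hab : ∑ j, N j = a + b := sum_abs_split S _
  have hpenb : ∑ j, pen j * N j = lam * b := by
    rw [sum_abs_split S, Finset.sum_eq_zero fun j hj => by rw [hpen, if_pos hj, zero_mul], zero_add,
      hb, Finset.mul_sum]
    exact Finset.sum_congr rfl fun j hj => by rw [hpen, if_neg (Finset.mem_compl.1 hj)]
  have hobj0 : groupObj Q g pen 0 = 0 := by
    have h0 : (l2 fun _ : T => (0 : ℝ)) = 0 := l2_zero
    simp only [groupObj, Pi.zero_apply, hQz, mul_zero, Finset.sum_const_zero, sub_zero, h0,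
      add_zero]
  have hgu : ∑ t, ∑ j, g t j * u t j ≤ G * (a + b) := by
    rw [Finset.sum_comm, ← hab, Finset.mul_sum]
    refine Finset.sum_le_sum fun j _ => (le_abs_self _).trans ((sum_abs_mul_le_l2 _ _).trans ?_)
    refine mul_le_mul_of_nonneg_right ?_ (hN0 j)
    rw [hG, mul_comm]
    exact l2_le_sqrt_mul hγ fun t => hg t j
  have hbasic : ∑ t, Q t (u t) + lam * b ≤ 2 * (G * (a + b)) := by
    rw [hobj0, groupObj, hpenb, Finset.sum_sub_distrib, ← Finset.mul_sum] at hmin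
    linarith
  have hsumQ : 0 ≤ ∑ t, Q t (u t) := Finset.sum_nonneg fun t _ => hQ0 t
  have hGb : 4 * (G * b) ≤ lam * b := by nlinarith
  have hGa : 4 * (G * a) ≤ lam * a := by nlinarith
  have hba : b ≤ a := by
    have : lam * b ≤ lam * a := by nlinarith
    exact le_of_mul_le_mul_left this hlam
  have hQa : ∑ t, Q t (u t) ≤ 2 * (G * a) := by nlinarith [mul_nonneg hG0 hb0]
  set τ := √(∑ j, N j ^ 2) with hτ
  have hτ2 : τ ^ 2 = ∑ j, N j ^ 2 := Real.sq_sqrt (Finset.sum_nonneg fun _ _ => sq_nonneg _)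
  have hτ0 : 0 ≤ τ := Real.sqrt_nonneg _
  have ham : a ^ 2 ≤ m * τ ^ 2 := by
    have h1 := sum_abs_sq_le (S := S) N
    simp only [abs_of_nonneg (hN0 _)] at h1
    rw [hτ2]
    refine h1.trans ?_
    have : (S.card : ℝ) ≤ m := by exact_mod_cast hS
    gcongr
  have ham' : a ≤ √m * τ := by
    refine (le_abs_self a).trans
      (abs_le_of_sq_le_sq ?_ (mul_nonneg (Real.sqrt_nonneg _) hτ0))
    rwa [mul_pow, Real.sq_sqrt (by positivity)]
  -- Minkowski's inequality exchanges the ℓ¹ norm over coordinates with the ℓ² norm over time, which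
  -- makes the pointwise defects compatible with the group cone.
  have hmink : ∑ t, (∑ j, |u t j|) ^ 2 ≤ (a + b) ^ 2 := by
    have h1 := l2_sum_le Finset.univ fun j t => |u t j|
    simp only [l2_abs] at h1
    rw [← l2_sq, ← hab]
    exact pow_le_pow_left₀ (l2_nonneg _) h1 2
  have hlower : κ * τ ^ 2 - δ * (a + b) ^ 2 ≤ ∑ t, Q t (u t) := by
    have h1 := Finset.sum_le_sum fun t (_ : t ∈ Finset.univ) => hQ t
    rw [Finset.sum_sub_distrib, ← Finset.mul_sum, ← Finset.mul_sum, Finset.sum_comm] at h1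
    have h2 : τ ^ 2 = ∑ j, ∑ t, u t j ^ 2 := by
      rw [hτ2]
      exact Finset.sum_congr rfl fun j _ => l2_sq _
    rw [h2]
    have := mul_le_mul_of_nonneg_left hmink hδ
    linarith
  have hδab : δ * (a + b) ^ 2 ≤ κ / 2 * τ ^ 2 := by
    calc δ * (a + b) ^ 2 ≤ δ * (2 * a) ^ 2 := by gcongr; linarith
      _ = 4 * δ * a ^ 2 := by ring
      _ ≤ 4 * δ * (m * τ ^ 2) := by gcongr
      _ = 4 * δ * m * τ ^ 2 := by ring
      _ ≤ _ := by gcongr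
  have hGaτ : G * a ≤ G * √m * τ := by
    calc G * a ≤ G * (√m * τ) := by gcongr
      _ = _ := by ring
  have hτle : τ ≤ 4 / κ * (G * √m) := by
    rcases hτ0.eq_or_lt with h0 | hpos
    · rw [← h0]; positivity
    · have h8 : τ * (κ / 2 * τ) ≤ τ * (2 * (G * √m)) := by nlinarith
      have h9 := le_of_mul_le_mul_left h8 hpos
      rw [div_mul_eq_mul_div, le_div_iff₀ hκ]
      linarith
  refine ⟨fun j => ?_, ?_⟩
  · refine le_trans ?_ hτle
    have := abs_le_l2 N j
    rwa [abs_of_nonneg (hN0 j)] at this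
  · have hGm : 0 ≤ G * √m := by positivity
    calc ∑ t, Q t (u t) ≤ 2 * (G * √m * τ) := by linarith
      _ ≤ 2 * (G * √m * (4 / κ * (G * √m))) := by gcongr
      _ = _ := by ring

theorem wQuad_sub_single (R : Finset ℕ) (w : ℕ → ℝ) (z : ℕ → ι → ℝ) (v : ι → ℝ) (j : ι) (c : ℝ) :
    wQuad R w z (v - Pi.single j c) = wQuad R w z v -
      2 * c * ∑ r ∈ R, w r * ((∑ l, z r l * v l) * z r j) + c ^ 2 * ∑ r ∈ R, w r * z r j ^ 2 := by
  simp only [wQuad]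
  rw [Finset.mul_sum, Finset.mul_sum, ← Finset.sum_sub_distrib, ← Finset.sum_add_distrib]
  refine Finset.sum_congr rfl fun r _ => ?_
  have : ∑ l, z r l * (v - Pi.single j c : ι → ℝ) l = ∑ l, z r l * v l - z r j * c := by
    simp only [Pi.sub_apply, mul_sub, Finset.sum_sub_distrib]
    simp [Pi.single_apply]
  rw [this]
  ring

theorem abs_wQuad_polar_le {ι : Type*} [Fintype ι] {R : Finset ℕ} {w : ℕ → ℝ} (hw : ∀ r, 0 ≤ w r) (z : ℕ → ι → ℝ)
    (v : ι → ℝ) (j : ι) :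
    |∑ r ∈ R, w r * ((∑ l, z r l * v l) * z r j)| ≤
      √(wQuad R w z v) * √(∑ r ∈ R, w r * z r j ^ 2) := by
  rw [← Real.sqrt_mul (wQuad_nonneg hw z v)]
  refine Real.abs_le_sqrt ?_
  have h := Finset.sum_mul_sq_le_sq_mul_sq R (fun r => √(w r) * ∑ l, z r l * v l)
    (fun r => √(w r) * z r j)
  have e1 : ∑ r ∈ R, w r * ((∑ l, z r l * v l) * z r j) =
      ∑ r ∈ R, (√(w r) * ∑ l, z r l * v l) * (√(w r) * z r j) :=
    Finset.sum_congr rfl fun r _ => by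
      nth_rewrite 1 [← Real.mul_self_sqrt (hw r)]
      ring
  rw [e1]
  simpa only [wQuad, mul_pow, Real.sq_sqrt (hw _)] using h

theorem nonneg_of_forall_quadratic {a b : ℝ} (h : ∀ ε : ℝ, 0 < ε → ε ≤ 1 → 0 ≤ ε * a + ε ^ 2 * b) :
    0 ≤ a := by
  by_contra hcon
  push Not at hcon
  have hb : 0 < |b| + 1 := by positivity
  -- Small enough that εb ≤ −a/2, hence a + εb < 0.
  set ε := min 1 (-a / (2 * (|b| + 1))) with hε
  have hε0 : 0 < ε := lt_min one_pos (div_pos (by linarith) (by positivity))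
  have h1 := h ε hε0 (min_le_left _ _)
  have h2 : ε * (2 * (|b| + 1)) ≤ -a := by
    rw [← le_div_iff₀ (by positivity)]
    exact min_le_right _ _
  have h3 : b ≤ |b| := le_abs_self b
  have h4 : 0 ≤ ε * (a + ε * b) := by nlinarith
  have h5 : 0 ≤ a + ε * b := nonneg_of_mul_nonneg_right h4 hε0
  nlinarith

/-- Shrinking the path of coordinate j by the factor 1 − ε lowers the penalty by ε·pen j·N. To first
order the loss rises by at most 2εN(√q√E + γ√|T|): Cauchy–Schwarz over r and then over t bounds the
fitted part through the prediction error E, and the score supplies the rest. If N > 0, a larger `pen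
j` contradicts minimality. -/
theorem groupLasso_eq_zero {R : Finset ℕ} {w : T → ℕ → ℝ} {z : T → ℕ → ι → ℝ} {g u : T → ι → ℝ}
    {pen : ι → ℝ} {γ q E : ℝ} (hw : ∀ t r, 0 ≤ w t r) (hγ : 0 ≤ γ)
    (hmin : ∀ v, groupObj (fun t => wQuad R (w t) (z t)) g pen u ≤
      groupObj (fun t => wQuad R (w t) (z t)) g pen v)
    (hg : ∀ t j, |g t j| ≤ γ) (j : ι) (hq : ∀ t, ∑ r ∈ R, w t r * z t r j ^ 2 ≤ q)
    (hE : ∑ t, wQuad R (w t) (z t) (u t) ≤ E)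
    (hpen : 2 * (√q * √E) + 2 * (γ * √(Fintype.card T)) < pen j) : ∀ t, u t j = 0 := by
  rw [← l2_eq_zero]
  by_contra hne
  have hpos : 0 < l2 fun t => u t j := lt_of_le_of_ne (l2_nonneg _) (Ne.symm hne)
  set N := l2 fun t => u t j with hN
  set B : T → ℝ := fun t => ∑ r ∈ R, w t r * ((∑ l, z t r l * u t l) * z t r j) with hB
  have key : 0 ≤ -2 * ∑ t, u t j * B t + 2 * ∑ t, g t j * u t j - pen j * N := by
    refine nonneg_of_forall_quadratic
      (b := ∑ t, u t j ^ 2 * ∑ r ∈ R, w t r * z t r j ^ 2) fun ε hε hε1 => ?_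
    -- Only coordinate j moves, by the factor 1 − ε at every t, so its group norm scales exactly and
    -- all other penalties stay fixed.
    have h1 := hmin fun t => u t - Pi.single j (ε * u t j)
    simp only [groupObj, wQuad_sub_single] at h1
    have hlin : ∀ t, ∑ l, g t l * (u t - Pi.single j (ε * u t j) : ι → ℝ) l =
        ∑ l, g t l * u t l - ε * (g t j * u t j) := by
      intro t
      simp only [Pi.sub_apply, mul_sub, Finset.sum_sub_distrib]
      simp [Pi.single_apply]
      ring
    have hpenj : ∑ l, pen l * (l2 fun t => (u t - Pi.single j (ε * u t j) : ι → ℝ) l) =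
        ∑ l, pen l * (l2 fun t => u t l) - ε * (pen j * N) := by
      have hl : ∀ l, pen l * (l2 fun t => (u t - Pi.single j (ε * u t j) : ι → ℝ) l) =
          pen l * (l2 fun t => u t l) - if l = j then ε * (pen j * N) else 0 := by
        intro l
        split_ifs with h
        · subst h
          have e : (fun t => (u t - Pi.single l (ε * u t l) : ι → ℝ) l) = fun t => (1 - ε) * u t l := by
            funext t
            simp only [Pi.sub_apply, Pi.single_eq_same]
            ring
          rw [e, l2_smul (by linarith)]
          ring
        · have e : (fun t => (u t - Pi.single j (ε * u t j) : ι → ℝ) l) = fun t => u t l := by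
            funext t
            simp [h]
          rw [e, sub_zero]
      simp_rw [hl]
      rw [Finset.sum_sub_distrib]
      simp
    simp_rw [hlin] at h1
    rw [hpenj] at h1
    have e2 : ∑ t, (wQuad R (w t) (z t) (u t) - 2 * (ε * u t j) * B t +
        (ε * u t j) ^ 2 * ∑ r ∈ R, w t r * z t r j ^ 2 -
          2 * (∑ l, g t l * u t l - ε * (g t j * u t j))) =
        ∑ t, (wQuad R (w t) (z t) (u t) - 2 * ∑ l, g t l * u t l) +
          (ε * (-2 * ∑ t, u t j * B t + 2 * ∑ t, g t j * u t j) +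
            ε ^ 2 * ∑ t, u t j ^ 2 * ∑ r ∈ R, w t r * z t r j ^ 2) := by
      have e3 : ∀ t, wQuad R (w t) (z t) (u t) - 2 * (ε * u t j) * B t +
          (ε * u t j) ^ 2 * ∑ r ∈ R, w t r * z t r j ^ 2 -
          2 * (∑ l, g t l * u t l - ε * (g t j * u t j)) =
          (wQuad R (w t) (z t) (u t) - 2 * ∑ l, g t l * u t l) +
          (ε * (-2 * (u t j * B t) + 2 * (g t j * u t j)) +
            ε ^ 2 * (u t j ^ 2 * ∑ r ∈ R, w t r * z t r j ^ 2)) := fun t => by ring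
      simp_rw [e3]
      rw [Finset.sum_add_distrib, Finset.sum_add_distrib, ← Finset.mul_sum, ← Finset.mul_sum,
        Finset.sum_add_distrib, ← Finset.mul_sum, ← Finset.mul_sum]
    rw [e2] at h1
    linarith
  have hBle : |∑ t, u t j * B t| ≤ N * (√q * √E) := by
    refine (sum_abs_mul_le_l2 _ _).trans ?_
    refine mul_le_mul_of_nonneg_left ?_ hpos.le
    have h1 : ∀ t, |B t| ≤ √q * √(wQuad R (w t) (z t) (u t)) := by
      intro t
      refine (abs_wQuad_polar_le (hw t) _ _ _).trans ?_
      rw [mul_comm]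
      gcongr
      exact hq t
    rw [l2, Real.sqrt_le_left (by positivity), mul_pow, Real.sq_sqrt']
    have h2 : ∀ t, B t ^ 2 ≤ √q ^ 2 * wQuad R (w t) (z t) (u t) := by
      intro t
      rw [← sq_abs]
      refine (pow_le_pow_left₀ (abs_nonneg _) (h1 t) 2).trans (le_of_eq ?_)
      rw [mul_pow, Real.sq_sqrt (wQuad_nonneg (hw t) _ _)]
    refine (Finset.sum_le_sum fun t _ => h2 t).trans ?_
    rw [← Finset.mul_sum, ← Real.sq_sqrt']
    gcongr
    rw [Real.sq_sqrt']
    exact hE.trans (le_max_left _ _)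
  have hgle : |∑ t, g t j * u t j| ≤ γ * √(Fintype.card T) * N := by
    refine (sum_abs_mul_le_l2 _ _).trans ?_
    refine mul_le_mul_of_nonneg_right ?_ hpos.le
    rw [mul_comm]
    exact l2_le_sqrt_mul hγ fun t => hg t j
  have h1 := (abs_le.1 hBle).1
  have h2 := (abs_le.1 hgle).2
  have h3 : N * pen j ≤ N * (2 * (√q * √E) + 2 * (γ * √(Fintype.card T))) := by linarith
  exact absurd (le_of_mul_le_mul_left h3 hpos) (not_le.2 hpen)

end GroupLasso

/-! ### The local linear loss in centred coordinates -/

section Model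

variable {d n : ℕ} {A Sig : ℝ → Matrix (Fin d) (Fin d) ℝ} {K : ℝ → ℝ} {h W : ℝ}
  {x e : ℤ → Fin d → ℝ}

/-- The regressors of the local linear fit at the grid point with index `t`. -/
def designVec (n : ℕ) (h : ℝ) (x : ℤ → Fin d → ℝ) (t r : ℕ) : Fin d ⊕ Fin d → ℝ :=
  Sum.elim (x r) fun j => ((r : ℝ) - t) / (n * h) * x r j

/-- The local quadratic form at the grid point with index `t`. -/
def localQuad (n : ℕ) (K : ℝ → ℝ) (h : ℝ) (x : ℤ → Fin d → ℝ) (t : ℕ) (v : Fin d ⊕ Fin d → ℝ) :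
    ℝ :=
  wQuad (Finset.range n) (gridWeight n K h t 0) (designVec n h x t) v

/-- The residual of the local linear approximation. -/
def localResid (n : ℕ) (A : ℝ → Matrix (Fin d) (Fin d) ℝ) (x : ℤ → Fin d → ℝ) (i : Fin d)
    (t r : ℕ) : ℝ :=
  x (r + 1) i - ∑ j, (A (scaledTime n (t + 1)) i j + coefDeriv A (scaledTime n (t + 1)) i j *
    (scaledTime n (r + 1) - scaledTime n (t + 1))) * x r j

/-- The score of the local linear loss at the true coefficients. -/
def localScore (n : ℕ) (K : ℝ → ℝ) (h : ℝ) (A : ℝ → Matrix (Fin d) (Fin d) ℝ)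
    (x : ℤ → Fin d → ℝ) (i : Fin d) (t : ℕ) (j : Fin d ⊕ Fin d) : ℝ :=
  ∑ r ∈ Finset.range n,
    gridWeight n K h t 0 r * (localResid n A x i t r * designVec n h x t r j)

/-- The scaled estimation error of local linear coefficients. -/
def centred (n : ℕ) (h : ℝ) (A : ℝ → Matrix (Fin d) (Fin d) ℝ) (i : Fin d) (t : ℕ)
    (α β : Fin d → ℝ) : Fin d ⊕ Fin d → ℝ :=
  Sum.elim (fun j => α j - A (scaledTime n (t + 1)) i j)
    fun j => h * (β j - coefDeriv A (scaledTime n (t + 1)) i j)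

theorem scaledTime_sub (n r t : ℕ) :
    scaledTime n (r + 1) - scaledTime n (t + 1) = ((r : ℝ) - t) / n := by
  simp only [scaledTime]
  push_cast
  ring

theorem locLinLoss_eq_sum (hh : 0 < h) (i : Fin d) (t : Fin n) (α β : Fin d → ℝ) :
    locLinLoss n K h x i (tau n t) α β = ∑ r ∈ Finset.range n, gridWeight n K h t 0 r *
      (localResid n A x i t r -
        ∑ j, designVec n h x t r j * centred n h A i t α β j) ^ 2 := by
  rw [locLinLoss, ← Fin.sum_univ_eq_sum_range (fun r => gridWeight n K h t 0 r *
      (localResid n A x i t r - ∑ j, designVec n h x t r j * centred n h A i t α β j) ^ 2),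
    Finset.mul_sum]
  refine Finset.sum_congr rfl fun r _ => ?_
  have e1 : tau n r - tau n t = ((r : ℕ) - (t : ℕ) : ℝ) / n := scaledTime_sub n r t
  have e2 : ∑ j, (α j + β j * (tau n r - tau n t)) * x ((r : ℕ) : ℤ) j =
      ∑ j, (A (scaledTime n ((t : ℕ) + 1)) i j + coefDeriv A (scaledTime n ((t : ℕ) + 1)) i j *
        (scaledTime n ((r : ℕ) + 1) - scaledTime n ((t : ℕ) + 1))) * x ((r : ℕ) : ℤ) j +
      ∑ j, designVec n h x t r j * centred n h A i t α β j := by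
    rw [Fintype.sum_sum_type, ← Finset.sum_add_distrib, ← Finset.sum_add_distrib]
    refine Finset.sum_congr rfl fun j _ => ?_
    simp only [designVec, centred, Sum.elim_inl, Sum.elim_inr]
    rw [scaledTime_sub, e1, div_mul_eq_div_div]
    field_simp
    ring
  rw [e2, scaledKernel, e1, gridWeight, localResid, pow_zero, one_mul, div_div]
  ring

/-- The squared loss expanded at the true coefficients. The first sum does not involve (α, β), so
each stage minimises a quadratic form minus twice the score, plus penalty, in the error. Slopes are
scaled by h so that the design stays of order one and the weight h in the penalties is absorbed. -/
theorem locLinLoss_eq (hh : 0 < h) (i : Fin d) (t : Fin n) (α β : Fin d → ℝ) :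
    locLinLoss n K h x i (tau n t) α β =
      ∑ r ∈ Finset.range n, gridWeight n K h t 0 r * localResid n A x i t r ^ 2 +
        (localQuad n K h x t (centred n h A i t α β) -
          2 * ∑ j, localScore n K h A x i t j * centred n h A i t α β j) := by
  rw [locLinLoss_eq_sum (A := A) hh]
  have e1 : ∑ j, localScore n K h A x i t j * centred n h A i t α β j =
      ∑ r ∈ Finset.range n, gridWeight n K h t 0 r * (localResid n A x i t r *
        ∑ j, designVec n h x t r j * centred n h A i t α β j) := by
    simp only [localScore, Finset.sum_mul, Finset.mul_sum]
    rw [Finset.sum_comm]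
    refine Finset.sum_congr rfl fun r _ => Finset.sum_congr rfl fun j _ => by ring
  rw [e1, localQuad, wQuad, Finset.mul_sum, ← Finset.sum_sub_distrib, ← Finset.sum_add_distrib]
  refine Finset.sum_congr rfl fun r _ => by ring

theorem gridWeight_eq_pow_mul (n : ℕ) (K : ℝ → ℝ) (h : ℝ) (t k r : ℕ) :
    gridWeight n K h t k r = (((r : ℝ) - t) / (n * h)) ^ k * gridWeight n K h t 0 r := by
  rw [gridWeight, gridWeight]
  ring

/-! ### The restricted eigenvalue inequality -/

variable {L B c C κ : ℝ}

/-- For each r the square of β·X_{r+1} = β·y + β·e is bounded below by dropping (β·y)². The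
remainder is βᵀΣβ ≥ c|β|² plus the bilinear form D in β. Here β is affine in the rescaled time, so
summing c|β|² is the design bound, while every entry of the D term is controlled by the event,
whence the ℓ¹ norm. -/
theorem GoodPath.le_localQuad (hG : GoodPath n K h A Sig L B x e)
    (hSig : VolatilityRegular Sig c C) (hc : 0 ≤ c) (hK : IsKernel K) (hh : 0 < h) {t : ℕ}
    (ht : t < n)
    (hκ : ∀ a b : ℝ, κ * (a ^ 2 + b ^ 2) ≤
      ∑ r ∈ Finset.range (n - 1), gridWeight n K h t 0 (r + 1) *
        (a + (((r + 1 : ℕ) : ℝ) - t) / (n * h) * b) ^ 2) (v : Fin d ⊕ Fin d → ℝ) :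
    c * κ * ∑ j, v j ^ 2 - B * L / √(n * h) * (∑ j, |v j|) ^ 2 ≤ localQuad n K h x t v := by
  set a : Fin d → ℝ := fun j => v (.inl j) with ha
  set b : Fin d → ℝ := fun j => v (.inr j) with hb
  set w : ℕ → ℝ := fun r => gridWeight n K h t 0 (r + 1) with hw
  set s : ℕ → ℝ := fun r => (((r + 1 : ℕ) : ℝ) - t) / (n * h) with hs
  set β : ℕ → Fin d → ℝ := fun r j => a j + s r * b j with hβ
  set y : ℕ → Fin d → ℝ := fun r => A (scaledTime n (r + 1)) *ᵥ x r with hy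
  set D : ℕ → Fin d → Fin d → ℝ := fun r j l =>
    2 * (y r j * e (r + 1) l) + (e (r + 1) j * e (r + 1) l - Sig (scaledTime n (r + 1)) j l) with hD
  have hw0 : ∀ r, 0 ≤ w r := fun r => gridWeight_zero_nonneg hK n hh t (r + 1)
  -- The regressor X_0 is discarded and the others are shifted by one, since the recursion
  -- decomposes only X_1, …, X_{n−1}.
  have hdrop : ∑ r ∈ Finset.range (n - 1), w r * (∑ j, β r j * x (r + 1) j) ^ 2 ≤
      localQuad n K h x t v := by
    obtain ⟨m, rfl⟩ : ∃ m, n = m + 1 := ⟨n - 1, by omega⟩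
    rw [localQuad, wQuad, Finset.sum_range_succ' _ m, Nat.add_sub_cancel]
    refine le_add_of_le_of_nonneg (le_of_eq (Finset.sum_congr rfl fun r _ => ?_))
      (mul_nonneg (gridWeight_zero_nonneg hK _ hh _ _) (sq_nonneg _))
    rw [Fintype.sum_sum_type, ← Finset.sum_add_distrib]
    simp only [hw, hβ, hs, ha, hb, designVec, Sum.elim_inl, Sum.elim_inr]
    congr 2
    refine Finset.sum_congr rfl fun j _ => ?_
    push_cast
    ring
  have hstep : ∀ r ∈ Finset.range (n - 1),
      w r * (c * ∑ j, β r j ^ 2) + w r * ∑ j, ∑ l, β r j * β r l * D r j l ≤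
        w r * (∑ j, β r j * x (r + 1) j) ^ 2 := by
    intro r hr
    have hr' : r < n := by have := Finset.mem_range.1 hr; omega
    rw [← mul_add]
    refine mul_le_mul_of_nonneg_left ?_ (hw0 r)
    have h1 := hSig.le_quadraticForm
      (scaledTime_mem_Icc (n := n) (t := r + 1) (by omega) (by omega)) (β r)
    have h2 : ∑ j, β r j * x (r + 1) j = ∑ j, β r j * y r j + ∑ j, β r j * e (r + 1) j := by
      rw [← Finset.sum_add_distrib]
      refine Finset.sum_congr rfl fun j _ => ?_
      rw [hG.recursion r hr']
      simp only [Pi.add_apply, hy]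
      ring
    have h3 : ∑ j, ∑ l, β r j * β r l * D r j l =
        2 * ((∑ j, β r j * y r j) * ∑ j, β r j * e (r + 1) j) + (∑ j, β r j * e (r + 1) j) ^ 2 -
          ∑ j, ∑ l, β r j * β r l * Sig (scaledTime n (r + 1)) j l := by
      rw [sq, Finset.sum_mul_sum, Finset.sum_mul_sum, Finset.mul_sum, ← Finset.sum_add_distrib,
        ← Finset.sum_sub_distrib]
      refine Finset.sum_congr rfl fun j _ => ?_
      rw [Finset.mul_sum, ← Finset.sum_add_distrib, ← Finset.sum_sub_distrib]
      refine Finset.sum_congr rfl fun l _ => ?_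
      simp only [hD]
      ring
    rw [h2, h3]
    nlinarith [sq_nonneg (∑ j, β r j * y r j)]
  have hsum := Finset.sum_le_sum hstep
  rw [Finset.sum_add_distrib] at hsum
  have hmain : c * κ * ∑ j, v j ^ 2 ≤ ∑ r ∈ Finset.range (n - 1), w r * (c * ∑ j, β r j ^ 2) := by
    have e1 : ∑ r ∈ Finset.range (n - 1), w r * (c * ∑ j, β r j ^ 2) =
        c * ∑ j, ∑ r ∈ Finset.range (n - 1), w r * β r j ^ 2 := by
      rw [Finset.sum_comm, Finset.mul_sum]
      refine Finset.sum_congr rfl fun r _ => ?_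
      rw [← Finset.mul_sum]
      ring
    rw [e1, mul_assoc, Fintype.sum_sum_type, ← Finset.sum_add_distrib, Finset.mul_sum]
    refine mul_le_mul_of_nonneg_left (Finset.sum_le_sum fun j _ => hκ (a j) (b j)) hc
  have hdev : |∑ r ∈ Finset.range (n - 1), w r * ∑ j, ∑ l, β r j * β r l * D r j l| ≤
      B * L / √(n * h) * (∑ j, |v j|) ^ 2 := by
    set E : ℕ → Fin d → Fin d → ℝ := fun k j l =>
      ∑ r ∈ Finset.range (n - 1), gridWeight n K h t k (r + 1) * D r j l with hE
    have hEle : ∀ k < 3, ∀ j l, |E k j l| ≤ B * L / √(n * h) := fun k hk j l =>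
      hG.gram t ht k hk j l
    -- β is affine in the rescaled time, so its products have degree two and only the kernel moments
    -- k = 0, 1, 2 occur.
    have e1 : ∑ r ∈ Finset.range (n - 1), w r * ∑ j, ∑ l, β r j * β r l * D r j l =
        ∑ j, ∑ l, (a j * a l * E 0 j l + (a j * b l + b j * a l) * E 1 j l +
          b j * b l * E 2 j l) := by
      simp only [Finset.mul_sum, hE]
      rw [Finset.sum_comm]
      refine Finset.sum_congr rfl fun j _ => ?_
      rw [Finset.sum_comm]
      refine Finset.sum_congr rfl fun l _ => ?_
      rw [← Finset.sum_add_distrib, ← Finset.sum_add_distrib]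
      refine Finset.sum_congr rfl fun r _ => ?_
      rw [gridWeight_eq_pow_mul n K h t 1, gridWeight_eq_pow_mul n K h t 2]
      simp only [hβ, hw, hs]
      ring
    have e2 : (∑ j, |v j|) ^ 2 = ∑ j, ∑ l, (|a j| + |b j|) * (|a l| + |b l|) := by
      rw [Fintype.sum_sum_type, ← Finset.sum_add_distrib, sq, Finset.sum_mul_sum]
    rw [e1, e2, Finset.mul_sum]
    refine (Finset.abs_sum_le_sum_abs _ _).trans (Finset.sum_le_sum fun j _ => ?_)
    rw [Finset.mul_sum]
    refine (Finset.abs_sum_le_sum_abs _ _).trans (Finset.sum_le_sum fun l _ => ?_)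
    set δ := B * L / √(n * h)
    have t1 : |a j * a l * E 0 j l| ≤ |a j| * |a l| * δ := by
      rw [abs_mul, abs_mul]
      gcongr
      exact hEle 0 (by norm_num) j l
    have t2 : |(a j * b l + b j * a l) * E 1 j l| ≤ (|a j| * |b l| + |b j| * |a l|) * δ := by
      rw [abs_mul]
      gcongr
      · refine (abs_add_le _ _).trans ?_
        rw [abs_mul, abs_mul]
      · exact hEle 1 (by norm_num) j l
    have t3 : |b j * b l * E 2 j l| ≤ |b j| * |b l| * δ := by
      rw [abs_mul, abs_mul]
      gcongr
      exact hEle 2 (by norm_num) j l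
    refine (abs_add_le _ _).trans ((add_le_add ((abs_add_le _ _).trans (add_le_add t1 t2)) t3).trans
      (le_of_eq ?_))
    ring
  have := (abs_le.1 hdev).1
  linarith

/-! ### The size of the score -/

variable {M C₁ ρ : ℝ}

/-- The residual is the innovation plus a bias. The event controls the innovation part. In the bias
only coordinates of S survive, and inside the kernel window each has Taylor remainder at most Mh²
times a regressor of size B√L; hence s·M·h²·B²·L, and the absolute weights sum to at most 3W. -/
theorem GoodPath.abs_sum_resid_le (hG : GoodPath n K h A Sig L B x e)
    (hA : TransitionRegular n A M C₁ ρ) (hK : IsKernel K) (hW : ∀ x, K x ≤ W) (hh : 0 < h)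
    (hν : 1 ≤ (n : ℝ) * h) (hL : 0 ≤ L) (hB : 0 ≤ B) {i : Fin d} {S : Finset (Fin d)}
    (hS : ∀ r < n, ∀ j, j ∉ S → A (scaledTime n (r + 1)) i j = 0 ∧
      coefDeriv A (scaledTime n (r + 1)) i j = 0) {s : ℕ} (hs : S.card ≤ s)
    {t : ℕ} (ht : t < n) {k : ℕ} (hk : k < 3) (j : Fin d) :
    |∑ r ∈ Finset.range n, gridWeight n K h t k r * (localResid n A x i t r * x r j)| ≤
      (B + 3 * W * B ^ 2 * M) * (L * (1 / √(n * h) + s * h ^ 2)) := by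
  have hn : 0 < n := by omega
  have hn' : (0 : ℝ) < n := by exact_mod_cast hn
  have hν0 : 0 < (n : ℝ) * h := by linarith
  have hW0 : 0 ≤ W := (hK.nonneg 0).trans (hW 0)
  have hM : 0 ≤ M := (abs_nonneg _).trans
    (hA.secondDeriv_le i i 0 ⟨le_rfl, zero_le_one⟩)
  set b : ℕ → ℝ := fun r => ∑ l, (A (scaledTime n (r + 1)) i l - A (scaledTime n (t + 1)) i l -
    coefDeriv A (scaledTime n (t + 1)) i l *
      (scaledTime n (r + 1) - scaledTime n (t + 1))) * x r l with hb
  have hres : ∀ r < n, localResid n A x i t r = e (r + 1) i + b r := by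
    intro r hr
    rw [localResid, hG.recursion r hr, Pi.add_apply, hb, Matrix.mulVec, dotProduct, add_comm,
      add_sub_assoc, ← Finset.sum_sub_distrib]
    congr 1
    refine Finset.sum_congr rfl fun l _ => by ring
  have hsplit : ∑ r ∈ Finset.range n, gridWeight n K h t k r * (localResid n A x i t r * x r j) =
      ∑ r ∈ Finset.range n, gridWeight n K h t k r * (x r j * e (r + 1) i) +
        ∑ r ∈ Finset.range n, gridWeight n K h t k r * (b r * x r j) := by
    rw [← Finset.sum_add_distrib]
    refine Finset.sum_congr rfl fun r hr => ?_
    rw [hres r (Finset.mem_range.1 hr)]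
    ring
  have hbias : ∀ r < n, |gridWeight n K h t k r * (b r * x r j)| ≤
      |gridWeight n K h t k r| * (s * (M * h ^ 2) * (B ^ 2 * L)) := by
    intro r hr
    by_cases hfar : (n : ℝ) * h < |(r : ℝ) - t|
    · rw [gridWeight_eq_zero hK hν0 hfar]
      simp
    · rw [abs_mul]
      refine mul_le_mul_of_nonneg_left ?_ (abs_nonneg _)
      have hclose : (scaledTime n (r + 1) - scaledTime n (t + 1)) ^ 2 ≤ h ^ 2 := by
        rw [scaledTime_sub]
        refine sq_le_sq' ?_ ?_
        · rw [le_div_iff₀ hn']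
          linarith [(abs_le.1 (not_lt.1 hfar)).1]
        · rw [div_le_iff₀ hn']
          linarith [(abs_le.1 (not_lt.1 hfar)).2]
      have hbr : |b r| ≤ s * (M * h ^ 2) * (B * √L) := by
        have hzero : ∀ l ∈ Finset.univ, l ∉ S →
            (A (scaledTime n (r + 1)) i l - A (scaledTime n (t + 1)) i l -
              coefDeriv A (scaledTime n (t + 1)) i l *
                (scaledTime n (r + 1) - scaledTime n (t + 1))) * x r l = 0 := by
          intro l _ hl
          rw [(hS r hr l hl).1, (hS t ht l hl).1, (hS t ht l hl).2]
          simp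
        rw [hb]
        simp only []
        rw [← Finset.sum_subset (Finset.subset_univ S) hzero]
        refine (Finset.abs_sum_le_sum_abs _ _).trans ?_
        calc _ ≤ ∑ _l ∈ S, (M * h ^ 2) * (B * √L) := Finset.sum_le_sum fun l _ => by
              rw [abs_mul]
              have h1 := abs_sub_linear_le (hA.smooth i l) (hA.secondDeriv_le i l)
                (scaledTime_mem_Icc (n := n) (t := r + 1) (by omega) (by omega))
                (scaledTime_mem_Icc (n := n) (t := t + 1) (by omega) (by omega))
              have h2 : M * (scaledTime n (r + 1) - scaledTime n (t + 1)) ^ 2 ≤ M * h ^ 2 := by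
                gcongr
              exact mul_le_mul (h1.trans h2) (hG.bound r hr l) (abs_nonneg _) (by positivity)
          _ = S.card * ((M * h ^ 2) * (B * √L)) := by rw [Finset.sum_const, nsmul_eq_mul]
          _ ≤ s * ((M * h ^ 2) * (B * √L)) := by gcongr
          _ = _ := by ring
      rw [abs_mul]
      calc |b r| * |x r j| ≤ s * (M * h ^ 2) * (B * √L) * (B * √L) := by
            gcongr
            exact hG.bound r hr j
        _ = s * (M * h ^ 2) * (B ^ 2 * (√L * √L)) := by ring
        _ = _ := by rw [Real.mul_self_sqrt hL]
  have hbias2 : |∑ r ∈ Finset.range n, gridWeight n K h t k r * (b r * x r j)| ≤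
      3 * W * (s * (M * h ^ 2) * (B ^ 2 * L)) := by
    refine (Finset.abs_sum_le_sum_abs _ _).trans ((Finset.sum_le_sum fun r hr =>
      hbias r (Finset.mem_range.1 hr)).trans ?_)
    rw [← Finset.sum_mul]
    gcongr
    exact sum_abs_gridWeight_le hK hW hn hh hν t k
  rw [hsplit]
  refine (abs_add_le _ _).trans ((add_le_add (hG.noise t ht k hk i j) hbias2).trans ?_)
  have p1 : 0 ≤ 3 * W * B ^ 2 * M * (L * (1 / √(n * h))) := by positivity
  have p2 : 0 ≤ B * (L * (s * h ^ 2)) := by positivity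
  have e1 : B * L / √(n * h) = B * (L * (1 / √(n * h))) := by ring
  rw [e1]
  nlinarith

theorem GoodPath.abs_localScore_le (hG : GoodPath n K h A Sig L B x e)
    (hA : TransitionRegular n A M C₁ ρ) (hK : IsKernel K) (hW : ∀ x, K x ≤ W) (hh : 0 < h)
    (hν : 1 ≤ (n : ℝ) * h) (hL : 0 ≤ L) (hB : 0 ≤ B) {i : Fin d} {S : Finset (Fin d)}
    (hS : ∀ r < n, ∀ j, j ∉ S → A (scaledTime n (r + 1)) i j = 0 ∧
      coefDeriv A (scaledTime n (r + 1)) i j = 0) {s : ℕ} (hs : S.card ≤ s)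
    {t : ℕ} (ht : t < n) (j : Fin d ⊕ Fin d) :
    |localScore n K h A x i t j| ≤
      (B + 3 * W * B ^ 2 * M) * (L * (1 / √(n * h) + s * h ^ 2)) := by
  rcases j with j | j
  · exact hG.abs_sum_resid_le hA hK hW hh hν hL hB hS hs ht (k := 0) (by norm_num) j
  · have := hG.abs_sum_resid_le hA hK hW hh hν hL hB hS hs ht (k := 1) (by norm_num) j
    refine le_trans (le_of_eq (congrArg _ (Finset.sum_congr rfl fun r _ => ?_))) this
    rw [gridWeight_eq_pow_mul n K h t 1, designVec, Sum.elim_inr, pow_one]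
    ring

theorem GoodPath.sum_design_sq_le (hG : GoodPath n K h A Sig L B x e) (hK : IsKernel K)
    (hW : ∀ x, K x ≤ W) (hh : 0 < h) (hν : 1 ≤ (n : ℝ) * h) (hL : 0 ≤ L)
    {t : ℕ} (ht : t < n) (j : Fin d) :
    ∑ r ∈ Finset.range n, gridWeight n K h t 0 r * designVec n h x t r (.inl j) ^ 2 ≤
      3 * W * (B ^ 2 * L) := by
  have hn : 0 < n := by omega
  calc _ ≤ ∑ r ∈ Finset.range n, |gridWeight n K h t 0 r| * (B ^ 2 * L) :=
        Finset.sum_le_sum fun r hr => by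
          refine mul_le_mul (le_abs_self _) ?_ (sq_nonneg _) (abs_nonneg _)
          rw [designVec, Sum.elim_inl, ← sq_abs, ← Real.sq_sqrt hL, ← mul_pow]
          exact pow_le_pow_left₀ (abs_nonneg _) (hG.bound r (Finset.mem_range.1 hr) j) 2
    _ ≤ _ := by
        rw [← Finset.sum_mul]
        gcongr
        exact sum_abs_gridWeight_le hK hW hn hh hν t 0

end Model

/-! ### SCAD weights and supports -/

theorem scadDeriv_of_le {lam z : ℝ} (h : z ≤ lam) : scadDeriv lam z = lam := by
  rw [scadDeriv, if_pos h, mul_one]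

theorem scadDeriv_of_ge {lam z : ℝ} (hlam : 0 < lam) (h : a₀ * lam ≤ z) : scadDeriv lam z = 0 := by
  have h1 : lam < z := by
    rw [a₀] at h
    linarith
  rw [scadDeriv, if_neg (not_le.2 h1), max_eq_right (by linarith), zero_div, mul_zero]

section Deterministic

variable {d n : ℕ} {A Sig : ℝ → Matrix (Fin d) (Fin d) ℝ} {M C₁ ρ lam : ℝ}

theorem mem_supp {i j : Fin d} : j ∈ supp n A i ↔ ∃ t : Fin n, A (tau n t) i j ≠ 0 := by
  simp [supp, suppAt]

theorem mem_derivSupp {i j : Fin d} :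
    j ∈ derivSupp n A i ↔ ∃ t : Fin n, coefDeriv A (tau n t) i j ≠ 0 := by
  simp [derivSupp, derivSuppAt]

/-- A path that vanishes on the whole grid has zero deviation, whereas membership in J'_i demands a
positive one. So a coefficient that is zero on the grid also has zero derivative there. -/
theorem MinimalSignal.derivSupp_subset (h : MinimalSignal n A lam) (hlam : 0 < lam) (i : Fin d) :
    derivSupp n A i ⊆ supp n A i := by
  intro j hj
  by_contra hcon
  rw [mem_supp] at hcon
  push Not at hcon
  have h1 := (h i).2 j hj
  have h2 : l2dev (fun t : Fin n => A (tau n t) i j) = 0 := by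
    simp [l2dev, hcon, l2]
  rw [h2, a₀] at h1
  linarith

theorem card_supp_le (n : ℕ) (A : ℝ → Matrix (Fin d) (Fin d) ℝ) (i : Fin d) :
    (supp n A i).card ≤ sparsity n A :=
  Finset.le_sup (f := fun i => (supp n A i).card) (Finset.mem_univ i)

theorem MinimalSignal.eq_zero_of_notMem (h : MinimalSignal n A lam) (hlam : 0 < lam) {i j : Fin d}
    (hj : j ∉ supp n A i) (r : ℕ) (hr : r < n) :
    A (scaledTime n (r + 1)) i j = 0 ∧ coefDeriv A (scaledTime n (r + 1)) i j = 0 := by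
  have h1 := hj
  have h2 : j ∉ derivSupp n A i := fun hcon => hj (h.derivSupp_subset hlam i hcon)
  rw [mem_supp] at h1
  rw [mem_derivSupp] at h2
  push Not at h1 h2
  exact ⟨h1 ⟨r, hr⟩, h2 ⟨r, hr⟩⟩

/-- Outside J'_i the derivative vanishes on the grid only, so the path need not be constant; its
deviation is nevertheless O(n^{-1/2}), negligible against λ₂. -/
theorem l2dev_le_of_derivSupp (hA : TransitionRegular n A M C₁ ρ) (hn : 0 < n) {i j : Fin d}
    (hj : j ∉ derivSupp n A i) : l2dev (fun t : Fin n => A (tau n t) i j) ≤ √n * (M / n) := by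
  have hn' : (0 : ℝ) < n := by exact_mod_cast hn
  have hM : 0 ≤ M := (abs_nonneg _).trans
    (hA.secondDeriv_le i i 0 ⟨le_rfl, zero_le_one⟩)
  rw [mem_derivSupp] at hj
  push Not at hj
  have hgrid : ∀ t : Fin n, tau n t ∈ Icc (1 / (n : ℝ)) 1 := by
    intro t
    have h1 : tau n t ≤ 1 := scaledTime_le_one (by have := t.2; omega)
    refine ⟨?_, h1⟩
    rw [tau, scaledTime]
    push_cast
    gcongr
    simp
  have hdiff : ∀ t r : Fin n, |A (tau n t) i j - A (tau n r) i j| ≤ M / n := by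
    intro t r
    refine abs_sub_le_of_derivWithin_grid_eq_zero (f := fun σ => A σ i j) hn (hA.smooth i j)
      (hA.secondDeriv_le i j) (fun k hk => ?_) (hgrid t) (hgrid r)
    have := hj ⟨k, hk⟩
    rw [coefDeriv, tau, scaledTime] at this
    push_cast at this
    simpa using this
  rw [l2dev]
  have hM0 : 0 ≤ M / n := by positivity
  have := l2_le_sqrt_mul (v := fun t : Fin n => A (tau n t) i j -
    1 / (n : ℝ) * ∑ r, A (tau n r) i j) hM0 fun t => ?_
  · simpa using this
  · have e : A (tau n t) i j - 1 / (n : ℝ) * ∑ r, A (tau n r) i j =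
        1 / (n : ℝ) * ∑ r : Fin n, (A (tau n t) i j - A (tau n r) i j) := by
      rw [Finset.sum_sub_distrib, Finset.sum_const, Finset.card_univ, Fintype.card_fin,
        nsmul_eq_mul]
      field_simp
    rw [e, abs_mul, abs_of_pos (by positivity : (0 : ℝ) < 1 / n)]
    calc 1 / (n : ℝ) * |∑ r : Fin n, (A (tau n t) i j - A (tau n r) i j)|
        ≤ 1 / (n : ℝ) * ∑ _r : Fin n, M / n := by
          gcongr
          exact (Finset.abs_sum_le_sum_abs _ _).trans (Finset.sum_le_sum fun r _ => hdiff t r)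
      _ = M / n := by
          rw [Finset.sum_const, Finset.card_univ, Fintype.card_fin, nsmul_eq_mul]
          field_simp

/-! ### Error bounds for both stages on the regularity event -/

variable {K : ℝ → ℝ} {h W L B c C κ κ₁ γ lam₁ lam₂ : ℝ} {x e : ℤ → Fin d → ℝ}

/-- The path-wise properties of the local linear objectives that are used by both stages. -/
structure LocalRegular {d : ℕ} (n : ℕ) (K : ℝ → ℝ) (h : ℝ) (A : ℝ → Matrix (Fin d) (Fin d) ℝ)
    (x : ℤ → Fin d → ℝ) (κ δ γ q : ℝ) : Prop where
  eigen : ∀ t < n, ∀ v : Fin d ⊕ Fin d → ℝ,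
    κ * ∑ j, v j ^ 2 - δ * (∑ j, |v j|) ^ 2 ≤ localQuad n K h x t v
  score : ∀ i, ∀ t < n, ∀ j, |localScore n K h A x i t j| ≤ γ
  design : ∀ t < n, ∀ j : Fin d,
    ∑ r ∈ Finset.range n, gridWeight n K h t 0 r * designVec n h x t r (.inl j) ^ 2 ≤ q

variable {δ q : ℝ}

/-- The LASSO bound applied to levels and scaled slopes jointly. The two supports at τ_t together
have at most 2s elements, since the support of the derivative lies in J_i. -/
theorem LocalRegular.prelim_error (hR : LocalRegular n K h A x κ δ γ q) (hK : IsKernel K)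
    (hκ : 0 < κ) (hδ : 0 ≤ δ) (hh : 0 < h) (hlam₁ : 0 < lam₁) (hlam₂ : 0 < lam₂)
    (hsig : MinimalSignal n A lam₂)
    (hδs : 9 * δ * (2 * sparsity n A : ℕ) ≤ κ / 2) (hγ : γ ≤ lam₁ / 6)
    {αt βt : Fin d → Fin n → Fin d → ℝ} (hest : IsPrelimEstimate n K h lam₁ x αt βt)
    (i : Fin d) (t : Fin n) (j : Fin d) :
    |αt i t j - A (tau n t) i j| ≤ 8 / (3 * κ) * (lam₁ * √(2 * sparsity n A : ℕ)) := by
  set S : Finset (Fin d ⊕ Fin d) :=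
    (suppAt A i (tau n t)).disjSum (derivSuppAt A i (tau n t)) with hS
  set θ : Fin d ⊕ Fin d → ℝ := Sum.elim (fun j => A (tau n t) i j)
    fun j => h * coefDeriv A (tau n t) i j with hθ
  set u := centred n h A i t (αt i t) (βt i t) with hu
  have hcard : S.card ≤ 2 * sparsity n A := by
    have h1 : (suppAt A i (tau n t)).card ≤ sparsity n A :=
      (Finset.card_le_card (Finset.subset_biUnion_of_mem (fun t : Fin n => suppAt A i (tau n t))
        (Finset.mem_univ t))).trans (card_supp_le n A i)
    have h2 : (derivSuppAt A i (tau n t)).card ≤ sparsity n A :=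
      (Finset.card_le_card ((Finset.subset_biUnion_of_mem
        (fun t : Fin n => derivSuppAt A i (tau n t)) (Finset.mem_univ t)).trans
          (hsig.derivSupp_subset hlam₂ i))).trans (card_supp_le n A i)
    rw [hS, Finset.card_disjSum]
    omega
  have hθS : ∀ j, j ∉ S → θ j = 0 := by
    rintro (j | j) hj
    · simpa [hS, suppAt, hθ] using hj
    · rw [hθ, Sum.elim_inr]
      have : coefDeriv A (tau n t) i j = 0 := by simpa [hS, derivSuppAt] using hj
      rw [this, mul_zero]
  -- With slopes scaled by h, the weighted penalty is the plain ℓ¹ norm of truth plus error.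
  have hpen : ∀ α β : Fin d → ℝ, ∑ j, |α j| + h * ∑ j, |β j| =
      ∑ j, |θ j + centred n h A i t α β j| := by
    intro α β
    rw [Fintype.sum_sum_type, Finset.mul_sum]
    congr 1
    · refine Finset.sum_congr rfl fun j _ => ?_
      simp only [hθ, centred, Sum.elim_inl, tau]
      congr 1
      ring
    · refine Finset.sum_congr rfl fun j _ => ?_
      simp only [hθ, centred, Sum.elim_inr, tau]
      rw [mul_sub, add_sub_cancel, abs_mul, abs_of_pos hh]
  have hmin := hest i t (fun j => A (tau n t) i j) (fun j => coefDeriv A (tau n t) i j)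
  rw [lassoObj, lassoObj, locLinLoss_eq (A := A) hh, locLinLoss_eq (A := A) hh, hpen, hpen] at hmin
  have hzero : centred n h A i t (fun j => A (tau n t) i j)
      (fun j => coefDeriv A (tau n t) i j) = 0 := by
    funext j
    rcases j with j | j <;> simp [centred, tau]
  have hQz : localQuad n K h x t 0 = 0 := by simp [localQuad, wQuad]
  rw [hzero, hQz] at hmin
  simp only [Pi.zero_apply, mul_zero, Finset.sum_const_zero, add_zero, sub_zero] at hmin
  have hbound := lasso_error_bound (q := localQuad n K h x t u)
    (g := localScore n K h A x i t) (θ := θ) (u := u) (S := S) hκ hδ hlam₁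
    (wQuad_nonneg (gridWeight_zero_nonneg hK n hh t) _ _) (hR.eigen t t.2 u)
    (fun j => (hR.score i t t.2 j).trans hγ) hθS hcard hδs (by linarith)
  have := (abs_le_l2 u (.inl j)).trans hbound
  simpa [hu, centred, tau] using this

/-- The weights take their ideal values exactly. On the supports the estimated norm is at least (a₀
+ 1)λ₂ − λ₂/4 ≥ a₀λ₂, where the SCAD derivative is zero; off them it is at most λ₂/2, where the
derivative is λ₂. -/
theorem prelim_scadDeriv (hA : TransitionRegular n A M C₁ ρ) (hn : 0 < n) (hlam₂ : 0 < lam₂)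
    (hsig : MinimalSignal n A lam₂) {η : ℝ} (hη : 0 ≤ η) (hηlam : √n * η ≤ lam₂ / 4)
    (hM : √n * (M / n) ≤ lam₂ / 4) {αt : Fin d → Fin n → Fin d → ℝ}
    (herr : ∀ i t j, |αt i t j - A (tau n t) i j| ≤ η) (i j : Fin d) :
    scadDeriv lam₂ (l2 fun t => αt i t j) = (if j ∈ supp n A i then 0 else lam₂) ∧
      scadDeriv lam₂ (l2dev fun t => αt i t j) = if j ∈ derivSupp n A i then 0 else lam₂ := by
  have hdist : l2 (fun t => αt i t j - A (tau n t) i j) ≤ lam₂ / 4 := by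
    have := l2_le_sqrt_mul hη fun t => herr i t j
    rw [Fintype.card_fin] at this
    exact this.trans hηlam
  have hdist' : l2 (fun t => A (tau n t) i j - αt i t j) ≤ lam₂ / 4 := by
    have e : (fun t => A (tau n t) i j - αt i t j) = fun t => -(αt i t j - A (tau n t) i j) := by
      funext t; ring
    rwa [e, l2_neg]
  constructor
  · split_ifs with hj
    · refine scadDeriv_of_ge hlam₂ ?_
      have h1 := (hsig i).1 j hj
      have h2 := l2_le_add_sub (fun t => A (tau n t) i j) fun t => αt i t j
      linarith
    · refine scadDeriv_of_le ?_
      have h2 := l2_le_add_sub (fun t => αt i t j) fun t => A (tau n t) i j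
      rw [mem_supp] at hj
      push Not at hj
      have h3 : l2 (fun t : Fin n => A (tau n t) i j) = 0 := l2_eq_zero.2 hj
      linarith
  · split_ifs with hj
    · refine scadDeriv_of_ge hlam₂ ?_
      have h1 := (hsig i).2 j hj
      have h2 := l2dev_le_add_l2_sub (fun t => A (tau n t) i j) fun t => αt i t j
      linarith
    · refine scadDeriv_of_le ?_
      have h2 := l2dev_le_add_l2_sub (fun t => αt i t j) fun t => A (tau n t) i j
      have h3 := l2dev_le_of_derivSupp hA hn hj
      linarith

/-- No edge is lost: an active path estimated as zero would have error at least (a₀ + 1)λ₂, above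
the error bound. No edge is invented: the prediction error and the score are too small to balance a
penalty λ₂ on an inactive path. -/
theorem LocalRegular.estimatedEdges_eq (hR : LocalRegular n K h A x κ δ γ q) (hK : IsKernel K)
    (hA : TransitionRegular n A M C₁ ρ) (hn : 0 < n)
    (hκ : 0 < κ) (hδ : 0 ≤ δ) (hγ0 : 0 ≤ γ) (hh : 0 < h) (hlam₁ : 0 < lam₁) (hlam₂ : 0 < lam₂)
    (hsig : MinimalSignal n A lam₂)
    (hδs : 9 * δ * (2 * sparsity n A : ℕ) ≤ κ / 2) (hγ : γ ≤ lam₁ / 6)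
    (hprelim : √n * (8 / (3 * κ) * (lam₁ * √(2 * sparsity n A : ℕ))) ≤ lam₂ / 4)
    (hM : √n * (M / n) ≤ lam₂ / 4) (hγ₂ : 4 * (γ * √n) ≤ lam₂)
    (hsmall : 4 / κ * (γ * √n * √(2 * sparsity n A : ℕ)) < (a₀ + 1) * lam₂)
    (hkkt : 2 * (√q * √(8 / κ * (γ * √n * √(2 * sparsity n A : ℕ)) ^ 2)) + 2 * (γ * √n) < lam₂)
    {αt βt αh βh : Fin d → Fin n → Fin d → ℝ} (hest : IsPrelimEstimate n K h lam₁ x αt βt)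
    (hgroup : IsGroupLassoEstimate n K h lam₂ x αt αh βh) :
    estimatedEdges αh = grangerEdges n A := by
  have hη : 0 ≤ 8 / (3 * κ) * (lam₁ * √(2 * sparsity n A : ℕ)) := by positivity
  have hscad := prelim_scadDeriv hA hn hlam₂ hsig hη hprelim hM
    (hR.prelim_error hK hκ hδ hh hlam₁ hlam₂ hsig hδs hγ hest)
  have key : ∀ i j, (j ∉ supp n A i → ∀ t, αh i t j = 0) ∧
      (j ∈ supp n A i → ∃ t, αh i t j ≠ 0) := by
    intro i
    set S : Finset (Fin d ⊕ Fin d) := (supp n A i).disjSum (derivSupp n A i) with hS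
    have hcard : S.card ≤ 2 * sparsity n A := by
      have h1 := card_supp_le n A i
      have h2 := Finset.card_le_card (hsig.derivSupp_subset hlam₂ i)
      rw [hS, Finset.card_disjSum]
      omega
    set pen : Fin d ⊕ Fin d → ℝ := fun j => if j ∈ S then 0 else lam₂ with hpen
    set u : Fin n → Fin d ⊕ Fin d → ℝ :=
      fun t => centred n h A i t (αh i t) (βh i t) with hu
    set Q : Fin n → (Fin d ⊕ Fin d → ℝ) → ℝ := fun t => wQuad (Finset.range n)
      (gridWeight n K h t 0) (designVec n h x t) with hQ
    set g : Fin n → Fin d ⊕ Fin d → ℝ := fun t => localScore n K h A x i t with hg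
    -- The penalty on coefficients may be read as a penalty on errors: where the weight is nonzero
    -- the true path vanishes on the grid, so coefficient and error coincide.
    have hobj : ∀ α β : Fin n → Fin d → ℝ, groupLassoObj n K h lam₂ x i (αt i) α β =
        ∑ t : Fin n, ∑ r ∈ Finset.range n,
          gridWeight n K h t 0 r * localResid n A x i t r ^ 2 +
        groupObj Q g pen fun t => centred n h A i t (α t) (β t) := by
      intro α β
      rw [groupLassoObj, groupObj, Fintype.sum_sum_type, ← add_assoc, ← add_assoc,
        ← Finset.sum_add_distrib]
      congr 1
      · congr 1
        · exact Finset.sum_congr rfl fun t _ => locLinLoss_eq hh i t (α t) (β t)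
        · refine Finset.sum_congr rfl fun j _ => ?_
          rw [(hscad i j).1]
          by_cases hj : j ∈ supp n A i
          · simp [hpen, hS, hj]
          · have hz : ∀ t : Fin n, A (scaledTime n ((t : ℕ) + 1)) i j = 0 :=
              fun t => (hsig.eq_zero_of_notMem hlam₂ hj t t.2).1
            simp [hpen, hS, hj, centred, hz]
      · refine Finset.sum_congr rfl fun j _ => ?_
        rw [(hscad i j).2]
        by_cases hj : j ∈ derivSupp n A i
        · simp [hpen, hS, hj]
        · have hz : ∀ t : Fin n, coefDeriv A (scaledTime n ((t : ℕ) + 1)) i j = 0 := by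
            have := hj
            rw [mem_derivSupp] at this
            push Not at this
            exact this
          simp [hpen, hS, hj, centred, hz]
    have hmin : ∀ v, groupObj Q g pen u ≤ groupObj Q g pen v := by
      intro v
      -- Every error array v is attained: shift the truth by v, dividing the slope part by h to undo
      -- the scaling.
      have h1 := hgroup i
        (fun t j => A (scaledTime n ((t : ℕ) + 1)) i j + v t (.inl j))
        (fun t j => coefDeriv A (scaledTime n ((t : ℕ) + 1)) i j + v t (.inr j) / h)
      rw [hobj, hobj] at h1
      have hv : (fun t : Fin n => centred n h A i t
          (fun j => A (scaledTime n ((t : ℕ) + 1)) i j + v t (.inl j))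
          (fun j => coefDeriv A (scaledTime n ((t : ℕ) + 1)) i j + v t (.inr j) / h)) = v := by
        funext t j
        rcases j with j | j
        · simp [centred]
        · simp only [centred, Sum.elim_inr, add_sub_cancel_left]
          field_simp
      rw [hv] at h1
      exact le_of_add_le_add_left h1
    have hw : ∀ (t : Fin n) r, 0 ≤ gridWeight n K h t 0 r :=
      fun t r => gridWeight_zero_nonneg hK n hh t r
    obtain ⟨herr, hpred⟩ := groupLasso_error_bound (Q := Q) (g := g) (u := u) (pen := pen)
      (S := S) (m := 2 * sparsity n A) hκ hδ hγ0 hlam₂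
      (fun t => wQuad_nonneg (hw t) _ _) (fun _ => by simp [hQ, wQuad])
      (fun t => hR.eigen t t.2 (u t)) (fun t j => hR.score i t t.2 j) (fun _ => rfl) hcard
      (by
        have : 0 ≤ δ * (2 * sparsity n A : ℕ) := by positivity
        linarith)
      (by rwa [Fintype.card_fin]) (hmin 0)
    rw [Fintype.card_fin] at herr hpred
    intro j
    refine ⟨fun hj t => ?_, fun hj => ?_⟩
    · have h1 := groupLasso_eq_zero hw hγ0 hmin (fun t j => hR.score i t t.2 j) (.inl j)
        (fun t => hR.design t t.2 j) hpred (by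
          rw [Fintype.card_fin]
          simpa [hpen, hS, hj] using hkkt) t
      have hz := (hsig.eq_zero_of_notMem hlam₂ hj t t.2).1
      simpa [hu, centred, hz] using h1
    · by_contra! hcon
      have h1 := herr (.inl j)
      have h2 : (fun t => u t (.inl j)) = fun t => -A (tau n t) i j := by
        funext t
        simp [hu, centred, hcon, tau]
      rw [h2, l2_neg] at h1
      have h3 := (hsig i).1 j hj
      linarith
  ext ⟨i, j⟩
  have hpos : (0 < ∑ t, αh i t j ^ 2) ↔ ∃ t, αh i t j ≠ 0 := by
    constructor
    · intro hlt
      by_contra! hcon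
      simp [hcon] at hlt
    · rintro ⟨t, ht⟩
      exact Finset.sum_pos' (fun _ _ => sq_nonneg _) ⟨t, Finset.mem_univ t, by positivity⟩
  show (0 < ∑ t, αh i t j ^ 2) ↔ ∃ t : Fin n, A (tau n t) i j ≠ 0
  rw [hpos, ← mem_supp]
  constructor
  · rintro ⟨t, ht⟩
    by_contra hj
    exact ht ((key i j).1 hj t)
  · exact (key i j).2

theorem GoodPath.localRegular (hG : GoodPath n K h A Sig L B x e)
    (hA : TransitionRegular n A M C₁ ρ) (hSig : VolatilityRegular Sig c C) (hc : 0 ≤ c)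
    (hK : IsKernel K) (hW : ∀ x, K x ≤ W) (hh : 0 < h) (hν : 1 ≤ (n : ℝ) * h) (hL : 0 ≤ L)
    (hB : 0 ≤ B) (hlam : 0 < lam) (hsig : MinimalSignal n A lam)
    (hκ : ∀ t < n, ∀ a b : ℝ, κ * (a ^ 2 + b ^ 2) ≤
      ∑ r ∈ Finset.range (n - 1), gridWeight n K h t 0 (r + 1) *
        (a + (((r + 1 : ℕ) : ℝ) - t) / (n * h) * b) ^ 2) :
    LocalRegular n K h A x (c * κ) (B * L / √(n * h))
      ((B + 3 * W * B ^ 2 * M) * (L * (1 / √(n * h) + sparsity n A * h ^ 2)))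
      (3 * W * (B ^ 2 * L)) where
  eigen _ ht v := hG.le_localQuad hSig hc hK hh ht (hκ _ ht) v
  score i _ ht _ := hG.abs_localScore_le hA hK hW hh hν hL hB
    (fun r hr j hj => hsig.eq_zero_of_notMem hlam hj r hr) (card_supp_le n A i) ht _
  design _ ht _ := hG.sum_design_sq_le hK hW hh hν hL ht _

end Deterministic

/-! ### Consequences of the rate conditions -/

section Rates

variable {d s : ℕ → ℕ} {h lam₁ lam₂ : ℕ → ℝ}

theorem tendsto_logMax (d : ℕ → ℕ) : Tendsto (fun n => logMax n (d n)) atTop atTop := by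
  refine tendsto_atTop_mono' atTop ?_ (Real.tendsto_log_atTop.comp tendsto_natCast_atTop_atTop)
  filter_upwards [eventually_gt_atTop 0] with n hn
  refine Real.log_le_log (by exact_mod_cast hn) ?_
  exact_mod_cast le_max_left _ _

theorem tendsto_effectiveSize (hh : ∀ n, 0 < h n)
    (hbw₁ : Tendsto (fun n : ℕ => (n : ℝ) * h n / logMax n (d n) ^ 2) atTop atTop) :
    Tendsto (fun n : ℕ => (n : ℝ) * h n) atTop atTop := by
  refine tendsto_atTop_mono' atTop ?_ hbw₁
  filter_upwards [(tendsto_logMax d).eventually_ge_atTop 1] with n hL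
  have : 0 ≤ (n : ℝ) * h n := mul_nonneg (Nat.cast_nonneg n) (hh n).le
  exact div_le_self this (one_le_pow₀ hL)

theorem eventually_bandwidth (hs₁ : ∀ᶠ n in atTop, 1 ≤ s n)
    (hbw₂ : Tendsto (fun n => (s n : ℝ) * h n ^ 2 * logMax n (d n)) atTop (𝓝 0)) :
    ∀ᶠ n in atTop, h n ≤ 1 / 4 ∧ √(s n : ℝ) * h n ≤ 1 := by
  filter_upwards [hs₁, (tendsto_logMax d).eventually_ge_atTop 1,
    hbw₂.eventually_le_const (by norm_num : (0 : ℝ) < 1 / 16)] with n hs hL hb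
  have hs' : (1 : ℝ) ≤ s n := by exact_mod_cast hs
  have h1 : (s n : ℝ) * h n ^ 2 ≤ 1 / 16 :=
    (le_mul_of_one_le_right (by positivity) hL).trans hb
  have h2 : h n ^ 2 ≤ 1 / 16 := (le_mul_of_one_le_left (sq_nonneg _) hs').trans h1
  constructor
  · refine (le_abs_self _).trans (abs_le_of_sq_le_sq ?_ (by norm_num))
    linarith
  · refine (le_abs_self _).trans (abs_le_of_sq_le_sq ?_ zero_le_one)
    rw [mul_pow, Real.sq_sqrt (by positivity)]
    linarith

theorem zeta_nonneg {n d s : ℕ} {h : ℝ} (hL : 0 ≤ logMax n d) : 0 ≤ zeta n d s h := by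
  rw [zeta]
  positivity

theorem eventually_mul_zeta_le (hlam₁ : ∀ n, 0 < lam₁ n)
    (hl₁ : (fun n => zeta n (d n) (s n) (h n)) =o[atTop] lam₁) {k : ℝ} (hk : 0 ≤ k) :
    ∀ᶠ n in atTop, k * zeta n (d n) (s n) (h n) ≤ lam₁ n / 6 := by
  have hε : (0 : ℝ) < 1 / (6 * (k + 1)) := by positivity
  filter_upwards [hl₁.bound hε] with n hn
  rw [Real.norm_eq_abs, Real.norm_eq_abs, abs_of_pos (hlam₁ n)] at hn
  have h1 := (le_abs_self _).trans hn
  calc k * zeta n (d n) (s n) (h n) ≤ k * (1 / (6 * (k + 1)) * lam₁ n) := by gcongr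
    _ = k / (k + 1) * (lam₁ n / 6) := by field_simp
    _ ≤ 1 * (lam₁ n / 6) := by
        have := hlam₁ n
        gcongr
        rw [div_le_one (by positivity)]
        linarith
    _ = _ := one_mul _

/-- This makes δs small. The left side is at most λ₁s, because L/√(nh) ≤ ζ ≤ λ₁, and λ₁s =
(√s·λ₁/h)(√s·h), where the first factor tends to 0 and the second is at most 1. -/
theorem eventually_sparsity_log_le (hh : ∀ n, 0 < h n) (hlam₁ : ∀ n, 0 < lam₁ n)
    (hs₁ : ∀ᶠ n in atTop, 1 ≤ s n)
    (hbw₂ : Tendsto (fun n => (s n : ℝ) * h n ^ 2 * logMax n (d n)) atTop (𝓝 0))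
    (hl₁ : (fun n => zeta n (d n) (s n) (h n)) =o[atTop] lam₁)
    (hl₁' : Tendsto (fun n => √(s n : ℝ) * lam₁ n / h n) atTop (𝓝 0)) {ε : ℝ} (hε : 0 < ε) :
    ∀ᶠ n in atTop, logMax n (d n) / √(n * h n) * s n ≤ ε := by
  filter_upwards [eventually_bandwidth hs₁ hbw₂, eventually_mul_zeta_le hlam₁ hl₁ zero_le_one,
    hl₁'.eventually_le_const hε, (tendsto_logMax d).eventually_ge_atTop 1] with n hb hz hl hL
  have hhn := hh n
  have h1 : logMax n (d n) / √(n * h n) ≤ lam₁ n := by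
    have : logMax n (d n) / √(n * h n) ≤ zeta n (d n) (s n) (h n) := by
      rw [zeta, mul_add, mul_one_div]
      exact le_add_of_nonneg_right (by positivity)
    have := hlam₁ n
    linarith
  rw [div_le_iff₀ hhn] at hl
  calc logMax n (d n) / √(n * h n) * s n ≤ lam₁ n * s n := by gcongr
    _ = √(s n : ℝ) * lam₁ n * √(s n : ℝ) := by
        nth_rewrite 1 [← Real.mul_self_sqrt (Nat.cast_nonneg (s n))]
        ring
    _ ≤ ε * h n * √(s n : ℝ) := by gcongr
    _ = ε * (√(s n : ℝ) * h n) := by ring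
    _ ≤ ε * 1 := by gcongr; exact hb.2
    _ = ε := mul_one ε

/-- The rate that `λ₂` dominates. -/
def groupRate (n d s : ℕ) (h lam₁ : ℝ) : ℝ :=
  √(n : ℝ) * s * logMax n d * zeta n d s h + √((n : ℝ) * s) * lam₁

theorem eventually_mul_groupRate_le (hlam₂ : ∀ n, 0 < lam₂ n)
    (hl₂ : (fun n => groupRate n (d n) (s n) (h n) (lam₁ n)) =o[atTop] lam₂) {k : ℝ}
    (hk : 0 ≤ k) :
    ∀ᶠ n in atTop, k * groupRate n (d n) (s n) (h n) (lam₁ n) ≤ lam₂ n / 4 := by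
  have hε : (0 : ℝ) < 1 / (4 * (k + 1)) := by positivity
  filter_upwards [hl₂.bound hε] with n hn
  rw [Real.norm_eq_abs, Real.norm_eq_abs, abs_of_pos (hlam₂ n)] at hn
  have h1 := (le_abs_self _).trans hn
  calc k * groupRate n (d n) (s n) (h n) (lam₁ n) ≤ k * (1 / (4 * (k + 1)) * lam₂ n) := by gcongr
    _ = k / (k + 1) * (lam₂ n / 4) := by field_simp
    _ ≤ 1 * (lam₂ n / 4) := by
        have := hlam₂ n
        gcongr
        rw [div_le_one (by positivity)]
        linarith
    _ = _ := one_mul _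

/-- The quantities that have to be small relative to `λ₂` are bounded by multiples of
`groupRate`. -/
theorem bounds_of_groupRate {n d s : ℕ} {h lam₁ : ℝ} (hn : 0 < n) (hs : 1 ≤ s)
    (hL : 1 ≤ logMax n d) (hh : 0 < h) (hh1 : h ≤ 1) (hlam₁ : 0 < lam₁) :
    1 ≤ groupRate n d s h lam₁ ∧ √(n : ℝ) * zeta n d s h ≤ groupRate n d s h lam₁ ∧
      zeta n d s h * √(n : ℝ) * √s ≤ groupRate n d s h lam₁ ∧
      √(logMax n d) * (zeta n d s h * √(n : ℝ) * √s) ≤ groupRate n d s h lam₁ ∧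
      √(n : ℝ) * (lam₁ * √s) ≤ groupRate n d s h lam₁ := by
  have hn' : (0 : ℝ) < n := by exact_mod_cast hn
  have hs' : (1 : ℝ) ≤ s := by exact_mod_cast hs
  set L := logMax n d
  have hz0 : 0 ≤ zeta n d s h := zeta_nonneg (by linarith)
  have hsn : 0 < √(n : ℝ) := Real.sqrt_pos.2 hn'
  have hV : √((n : ℝ) * s) * lam₁ = √(n : ℝ) * (lam₁ * √s) := by
    rw [Real.sqrt_mul hn'.le]; ring
  have hU0 : 0 ≤ √(n : ℝ) * s * L * zeta n d s h := by positivity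
  have hV0 : 0 ≤ √((n : ℝ) * s) * lam₁ := by positivity
  have hss : √(s : ℝ) ≤ s := by
    rw [Real.sqrt_le_left (by positivity)]
    nlinarith
  have hLL : √L ≤ L := by
    rw [Real.sqrt_le_left (by positivity)]
    nlinarith
  have hU : √(n : ℝ) * s * L * zeta n d s h ≤ groupRate n d s h lam₁ := by
    rw [groupRate]; linarith
  have h4 : √L * (zeta n d s h * √(n : ℝ) * √s) ≤ √(n : ℝ) * s * L * zeta n d s h := by
    calc √L * (zeta n d s h * √(n : ℝ) * √s) ≤ L * (zeta n d s h * √(n : ℝ) * s) := by gcongr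
      _ = _ := by ring
  have h3 : zeta n d s h * √(n : ℝ) * √s ≤ √L * (zeta n d s h * √(n : ℝ) * √s) := by
    refine le_mul_of_one_le_left (by positivity) ?_
    exact Real.one_le_sqrt.2 hL
  have h2 : √(n : ℝ) * zeta n d s h ≤ zeta n d s h * √(n : ℝ) * √s := by
    rw [mul_comm]
    exact le_mul_of_one_le_right (by positivity) (Real.one_le_sqrt.2 hs')
  -- Since ζ ≥ 1/√(nh) and h ≤ 1. Hence λ₂ dominates constants, in particular the deviations of
  -- paths whose derivative vanishes on the grid.
  have h1 : 1 ≤ √(n : ℝ) * zeta n d s h := by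
    have hz : 1 / √(n * h) ≤ zeta n d s h := by
      rw [zeta]
      calc 1 / √(n * h) ≤ 1 / √(n * h) + s * h ^ 2 := le_add_of_nonneg_right (by positivity)
        _ ≤ _ := le_mul_of_one_le_left (by positivity) hL
    have hnh : √((n : ℝ) * h) ≤ √(n : ℝ) :=
      Real.sqrt_le_sqrt (mul_le_of_le_one_right hn'.le hh1)
    have hpos : 0 < √((n : ℝ) * h) := Real.sqrt_pos.2 (by positivity)
    calc (1 : ℝ) ≤ √(n : ℝ) * (1 / √(n * h)) := by
          rw [mul_one_div, one_le_div hpos]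
          exact hnh
      _ ≤ _ := by gcongr
  refine ⟨by linarith, by linarith, by linarith, by linarith, ?_⟩
  rw [groupRate]
  linarith

end Rates

/-! ### Probabilities tending to one and the numerical conditions of the deterministic argument. -/

theorem withProbApproachingOne_of_le {Ω : ℕ → Type*} [∀ n, MeasurableSpace (Ω n)]
    {P : ∀ n, Measure (Ω n)} {E : ∀ n, Set (Ω n)} {a : ℝ}
    (h : ∀ᶠ n : ℕ in atTop, P n (E n)ᶜ ≤ ENNReal.ofReal (a / n)) : WithProbApproachingOne P E := by
  have h0 : Tendsto (fun n : ℕ => ENNReal.ofReal (a / n)) atTop (𝓝 0) := by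
    have := ENNReal.tendsto_ofReal (tendsto_const_div_atTop_nhds_zero_nat a)
    rwa [ENNReal.ofReal_zero] at this
  exact tendsto_of_tendsto_of_tendsto_of_le_of_le' tendsto_const_nhds h0
    (Eventually.of_forall fun _ => zero_le) h

/-- Only subadditivity, 1 ≤ P(E) + P(Eᶜ), is used, so E need not be measurable. -/
theorem WithProbApproachingOne.tendsto_measure {Ω : ℕ → Type*} [∀ n, MeasurableSpace (Ω n)]
    {P : ∀ n, Measure (Ω n)} [∀ n, IsProbabilityMeasure (P n)] {E : ∀ n, Set (Ω n)}
    (h : WithProbApproachingOne P E) : Tendsto (fun n => P n (E n)) atTop (𝓝 1) := by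
  have h1 : Tendsto (fun n => 1 - P n (E n)ᶜ) atTop (𝓝 1) := by
    have := ENNReal.Tendsto.sub (tendsto_const_nhds (x := (1 : ENNReal))) h
      (Or.inl ENNReal.one_ne_top)
    rwa [tsub_zero] at this
  refine tendsto_of_tendsto_of_tendsto_of_le_of_le h1 tendsto_const_nhds (fun n => ?_)
    fun n => prob_le_one
  rw [tsub_le_iff_right, ← measure_univ (μ := P n), ← Set.union_compl_self (E n)]
  exact measure_union_le _ _

theorem maxLevel_nonneg {ι₁ C₀ C₁ ρ C : ℝ} (hι : 0 < ι₁) (hC₀ : 0 ≤ C₀) (hρ₀ : 0 < ρ) (hρ₁ : ρ < 1)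
    (hC : 0 ≤ C) : 0 ≤ maxLevel ι₁ C₀ C₁ ρ C := by
  have h1 : 0 ≤ (1 - ρ ^ 2)⁻¹ := inv_nonneg.2 (by nlinarith)
  have h2 := subgaussianProxy_nonneg hι hC₀
  rw [maxLevel, solProxy]
  positivity

theorem pathLevel_nonneg {ι₁ C₀ C₁ ρ C : ℝ} (W : ℝ) (hι : 0 < ι₁) (hC₀ : 0 ≤ C₀) (hρ₀ : 0 < ρ)
    (hρ₁ : ρ < 1) (hC : 0 ≤ C) : 0 ≤ pathLevel ι₁ C₀ C₁ ρ C W := by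
  have h1 := maxLevel_nonneg (C₁ := C₁) hι hC₀ hρ₀ hρ₁ hC
  have h2 := subgaussianProxy_nonneg hι hC₀
  rw [pathLevel, productProxy]
  positivity

/-- R stands for the rate dominated by λ₂. The hypotheses `h₁`–`h₅` are instances of k·R ≤ λ₂/4,
with k the constant that each requirement of the deterministic argument produces after √(2s) ≤ 2√s.
-/
theorem bounds_of_mul_le {n s : ℕ} {L z lam₁ lam₂ R κ b q M : ℝ} (hn : 0 < n) (hz : 0 ≤ z)
    (hlam₁ : 0 ≤ lam₁) (hlam₂ : 0 < lam₂) (hκ : 0 < κ) (hb : 0 ≤ b) (hq : 0 ≤ q) (hM : 0 ≤ M)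
    (hR1 : 1 ≤ R) (hR2 : √(n : ℝ) * z ≤ R) (hR3 : z * √(n : ℝ) * √s ≤ R)
    (hR4 : √L * (z * √(n : ℝ) * √s) ≤ R) (hR5 : √(n : ℝ) * (lam₁ * √s) ≤ R)
    (h₁ : 8 / (3 * κ) * 2 * R ≤ lam₂ / 4) (h₂ : M * R ≤ lam₂ / 4)
    (h₃ : 16 * b * R ≤ lam₂ / 4) (h₄ : 4 / κ * (b * 2) * R ≤ lam₂ / 4)
    (h₅ : 2 * (√q * (√(8 / κ) * (b * 2))) * R ≤ lam₂ / 4) :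
    √(n : ℝ) * (8 / (3 * κ) * (lam₁ * √((2 * s : ℕ) : ℝ))) ≤ lam₂ / 4 ∧
    √(n : ℝ) * (M / n) ≤ lam₂ / 4 ∧ 4 * (b * z * √(n : ℝ)) ≤ lam₂ ∧
    4 / κ * (b * z * √(n : ℝ) * √((2 * s : ℕ) : ℝ)) < (a₀ + 1) * lam₂ ∧
    2 * (√(q * L) * √(8 / κ * (b * z * √(n : ℝ) * √((2 * s : ℕ) : ℝ)) ^ 2)) +
      2 * (b * z * √(n : ℝ)) < lam₂ := by
  have hn' : (0 : ℝ) < n := by exact_mod_cast hn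
  have hs2 : √((2 * s : ℕ) : ℝ) ≤ 2 * √(s : ℝ) := by
    rw [Real.sqrt_le_left (by positivity), mul_pow, Real.sq_sqrt (by positivity)]
    push_cast
    have : (0 : ℝ) ≤ s := by positivity
    linarith
  have hbz : b * z * √(n : ℝ) * √((2 * s : ℕ) : ℝ) ≤ b * 2 * (z * √(n : ℝ) * √(s : ℝ)) := by
    calc _ ≤ b * z * √(n : ℝ) * (2 * √(s : ℝ)) := by gcongr
      _ = _ := by ring
  have hγ : b * z * √(n : ℝ) ≤ b * R := by
    rw [mul_assoc, mul_comm z]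
    gcongr
  refine ⟨?_, ?_, by linarith, ?_, ?_⟩
  · refine le_trans ?_ h₁
    calc _ ≤ √(n : ℝ) * (8 / (3 * κ) * (lam₁ * (2 * √(s : ℝ)))) := by gcongr
      _ = 8 / (3 * κ) * 2 * (√(n : ℝ) * (lam₁ * √(s : ℝ))) := by ring
      _ ≤ _ := by gcongr
  · refine le_trans ?_ h₂
    have h1 : √(n : ℝ) ≤ n := by
      rw [Real.sqrt_le_left hn'.le]
      have : (1 : ℝ) ≤ n := by exact_mod_cast hn
      nlinarith
    calc √(n : ℝ) * (M / n) ≤ n * (M / n) := by gcongr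
      _ = M * 1 := by field_simp
      _ ≤ M * R := by gcongr
  · have h1 : 4 / κ * (b * z * √(n : ℝ) * √((2 * s : ℕ) : ℝ)) ≤ lam₂ / 4 := by
      refine le_trans ?_ h₄
      calc _ ≤ 4 / κ * (b * 2 * (z * √(n : ℝ) * √(s : ℝ))) := by gcongr
        _ ≤ 4 / κ * (b * 2 * R) := by gcongr
        _ = _ := by ring
    rw [a₀]
    linarith
  · have h1 : 2 * (√(q * L) *
        √(8 / κ * (b * z * √(n : ℝ) * √((2 * s : ℕ) : ℝ)) ^ 2)) ≤ lam₂ / 4 := by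
      refine le_trans ?_ h₅
      rw [Real.sqrt_mul hq, Real.sqrt_mul (by positivity), Real.sqrt_sq (by positivity)]
      calc _ ≤ 2 * (√q * √L * (√(8 / κ) * (b * 2 * (z * √(n : ℝ) * √(s : ℝ))))) := by gcongr
        _ = 2 * (√q * (√(8 / κ) * (b * 2))) * (√L * (z * √(n : ℝ) * √(s : ℝ))) := by ring
        _ ≤ _ := by gcongr
    linarith

/-- Using B + 1 in the threshold avoids dividing by B, which is only known to be nonnegative. -/
theorem nine_mul_le_half {B κ δ : ℝ} {s : ℕ} (hB : 0 ≤ B) (hκ : 0 < κ)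
    (h : δ * s ≤ κ / (36 * (B + 1))) : 9 * (B * δ) * (2 * s : ℕ) ≤ κ / 2 := by
  push_cast
  calc 9 * (B * δ) * (2 * (s : ℝ)) = 18 * B * (δ * s) := by ring
    _ ≤ 18 * B * (κ / (36 * (B + 1))) := by gcongr
    _ = κ / 2 * (B / (B + 1)) := by field_simp; ring
    _ ≤ κ / 2 * 1 := by
        gcongr
        rw [div_le_one (by positivity)]
        linarith
    _ = _ := mul_one _

end TVNet

end

/-! ### Assembly of the consistency theorem. -/

theorem corollary4p1
    {Ω : ℕ → Type*} [∀ n, MeasurableSpace (Ω n)] (P : ∀ n, Measure (Ω n))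
    [∀ n, IsProbabilityMeasure (P n)]
    -- dimension, coefficient functions, innovations and observed series at sample size `n`
    (d : ℕ → ℕ)
    (A Sig : ∀ n, ℝ → Matrix (Fin (d n)) (Fin (d n)) ℝ)
    (eps X : ∀ n, ℤ → Ω n → Fin (d n) → ℝ)
    -- kernel, bandwidth and tuning parameters
    (K : ℝ → ℝ) (h lam₁ lam₂ : ℕ → ℝ)
    -- constants that do not depend on `n`
    (ι₁ C₀ M C₁ ρ c C κ₀ : ℝ)
    (hι₁ : 0 < ι₁) (hρ₀ : 0 < ρ) (hρ₁ : ρ < 1) (hc : 0 < c) (hκ₀ : 0 < κ₀)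
    (hh : ∀ n, 0 < h n) (hlam₁ : ∀ n, 0 < lam₁ n) (hlam₂ : ∀ n, 0 < lam₂ n)
    -- the model
    (hX : ∀ n, 0 < n → TVNet.IsTVVAR (P n) n (A n) (Sig n) (eps n) (X n))
    (hA : ∀ n, 0 < n → TVNet.TransitionRegular n (A n) M C₁ ρ)
    (hSig : ∀ n, 0 < n → TVNet.VolatilityRegular (Sig n) c C)
    (heps : ∀ n, 0 < n → TVNet.IsInnovationSequence (P n) (eps n) ι₁ C₀)
    -- kernel, sparsity and bandwidth
    (hK : TVNet.IsKernel K)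
    (s : ℕ → ℕ) (hs : ∀ n, s n = TVNet.sparsity n (A n)) (hs₁ : ∀ᶠ n in atTop, 1 ≤ s n)
    (hbw₁ : Tendsto (fun n : ℕ => (n : ℝ) * h n / TVNet.logMax n (d n) ^ 2) atTop atTop)
    (hbw₂ : Tendsto (fun n => (s n : ℝ) * h n ^ 2 * TVNet.logMax n (d n)) atTop (𝓝 0))
    -- first tuning parameter and restricted eigenvalues
    (hl₁ : (fun n => TVNet.zeta n (d n) (s n) (h n)) =o[atTop] lam₁)
    (hl₁' : Tendsto (fun n => √(s n : ℝ) * lam₁ n / h n) atTop (𝓝 0))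
    (hRE : TVNet.WithProbApproachingOne P fun n =>
      {ω | TVNet.RestrictedEigenvalue n K (h n) (A n) (fun t => X n t ω) κ₀})
    -- second tuning parameter and minimal signal
    (hl₂ : (fun n : ℕ => √(n : ℝ) * s n * TVNet.logMax n (d n) * TVNet.zeta n (d n) (s n) (h n)
      + √((n : ℝ) * s n) * lam₁ n) =o[atTop] lam₂)
    (hsig : ∀ᶠ n in atTop, TVNet.MinimalSignal n (A n) (lam₂ n))
    -- any first-stage LASSO estimates and any second-stage group LASSO estimates
    (αt βt αh βh : ∀ n, Ω n → Fin (d n) → Fin n → Fin (d n) → ℝ)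
    (hprelim : ∀ n ω, TVNet.IsPrelimEstimate n K (h n) (lam₁ n) (fun t => X n t ω)
      (αt n ω) (βt n ω))
    (hgroup : ∀ n ω, TVNet.IsGroupLassoEstimate n K (h n) (lam₂ n) (fun t => X n t ω)
      (αt n ω) (αh n ω) (βh n ω)) :
    Tendsto (fun n => P n {ω | TVNet.estimatedEdges (αh n ω) = TVNet.grangerEdges n (A n)})
        atTop (𝓝 1) ∧
      TVNet.WithProbApproachingOne P fun n =>
        {ω | TVNet.estimatedEdges (αh n ω) = TVNet.grangerEdges n (A n)} := by
  obtain ⟨W, hW0, hW⟩ := hK.exists_bound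
  obtain ⟨κ, ν₀, hκ, hdesign⟩ := hK.exists_design_lower_bound
  -- Enlarging the volatility bound makes it positive, as needed to divide by it in the moment
  -- bounds.
  set C' := max C 1 with hC'
  have hC'0 : 0 < C' := lt_max_of_lt_right one_pos
  have hSig' : ∀ n, 0 < n → TVNet.VolatilityRegular (Sig n) c C' := fun n hn =>
    (hSig n hn).mono (le_max_left _ _)
  have hdim : ∀ᶠ n in atTop, Nonempty (Fin (d n)) := by
    filter_upwards [hs₁] with n hn
    by_contra hcon
    rw [not_nonempty_iff] at hcon
    rw [hs n, TVNet.sparsity, Finset.univ_eq_empty, Finset.sup_empty] at hn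
    exact absurd hn (by norm_num)
  -- A single sample size with d ≥ 1 suffices to read off the signs of C₀ and M, which do not depend
  -- on n.
  obtain ⟨m, hm, ⟨j₀⟩⟩ := ((eventually_gt_atTop 0).and hdim).exists
  have hC₀ : 0 ≤ C₀ := zero_le_one.trans ((heps m hm).one_le hι₁ j₀)
  have hM : 0 ≤ M := (abs_nonneg _).trans
    ((hA m hm).secondDeriv_le j₀ j₀ 0 ⟨le_rfl, zero_le_one⟩)
  set B := TVNet.pathLevel ι₁ C₀ C₁ ρ C' W with hB
  have hB0 : 0 ≤ B := TVNet.pathLevel_nonneg W hι₁ hC₀ hρ₀ hρ₁ hC'0.le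
  set Bγ := B + 3 * W * B ^ 2 * M with hBγ
  have hBγ0 : 0 ≤ Bγ := by positivity
  set κ₁ := c * κ with hκ₁
  have hκ₁0 : 0 < κ₁ := mul_pos hc hκ
  have hL := TVNet.tendsto_logMax d
  have hν := TVNet.tendsto_effectiveSize hh hbw₁
  -- The quantity equals W/√(nh) → 0. It places the Chernoff parameter in the bounded range where
  -- the sub-exponential products of innovations have a moment bound.
  have hνW : ∀ᶠ n : ℕ in atTop, √(n * h n) * (W / (n * h n)) ≤ ι₁ / C' / 2 := by
    have h1 : Tendsto (fun n : ℕ => W / √(n * h n)) atTop (𝓝 0) :=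
      (Real.tendsto_sqrt_atTop.comp hν).const_div_atTop W
    filter_upwards [h1.eventually_le_const (by positivity : 0 < ι₁ / C' / 2),
      hν.eventually_gt_atTop 0] with n hn hpos
    refine le_trans (le_of_eq ?_) hn
    have hsq : 0 < √(n * h n) := Real.sqrt_pos.2 hpos
    rw [eq_div_iff hsq.ne', mul_right_comm, Real.mul_self_sqrt hpos.le]
    rw [mul_div_cancel₀ _ hpos.ne']
  have hl₂' : (fun n => TVNet.groupRate n (d n) (s n) (h n) (lam₁ n)) =o[atTop] lam₂ := hl₂
  have hrate := fun k : ℝ => TVNet.eventually_mul_groupRate_le (k := k) hlam₂ hl₂'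
  have hq0 : 0 ≤ 3 * W * B ^ 2 := by positivity
  have hmain : ∀ᶠ n : ℕ in atTop,
      P n {ω | TVNet.estimatedEdges (αh n ω) = TVNet.grangerEdges n (A n)}ᶜ ≤
        ENNReal.ofReal (22 / n) := by
    filter_upwards [eventually_gt_atTop 0, hs₁, hdim, hsig, hL.eventually_ge_atTop 1,
      hν.eventually_ge_atTop 1, hν.eventually_ge_atTop ν₀, hνW,
      TVNet.eventually_bandwidth hs₁ hbw₂, TVNet.eventually_mul_zeta_le hlam₁ hl₁ hBγ0,
      TVNet.eventually_sparsity_log_le hh hlam₁ hs₁ hbw₂ hl₁ hl₁'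
        (by positivity : 0 < κ₁ / (36 * (B + 1))),
      hrate (8 / (3 * κ₁) * 2) (by positivity), hrate M hM, hrate (16 * Bγ) (by positivity),
      hrate (4 / κ₁ * (Bγ * 2)) (by positivity),
      hrate (2 * (√(3 * W * B ^ 2) * (√(8 / κ₁) * (Bγ * 2)))) (by positivity)]
      with n hn hsn hdn hsign hLn hν1 hνn hνWn hbn hζ hsL hr₃ hr₄ hr₅ hr₆ hr₇
    obtain ⟨i₀⟩ := hdn
    have hn' : (0 : ℝ) < n := by exact_mod_cast hn
    have hhn := hh n
    have hL0 : 0 ≤ TVNet.logMax n (d n) := by linarith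
    have hz0 : 0 ≤ TVNet.zeta n (d n) (s n) (h n) := TVNet.zeta_nonneg hL0
    obtain ⟨hR1, hR2, hR3, hR4, hR5⟩ := TVNet.bounds_of_groupRate (d := d n) hn hsn hLn (hh n)
      (hbn.1.trans (by norm_num)) (hlam₁ n)
    have hδs := TVNet.nine_mul_le_half hB0 hκ₁0 hsL
    obtain ⟨hprel, hMn, hγn, hsmall, hkkt⟩ := TVNet.bounds_of_mul_le hn hz0 (hlam₁ n).le (hlam₂ n)
      hκ₁0 hBγ0 hq0 hM hR1 hR2 hR3 hR4 hR5 hr₃ hr₄ hr₅ hr₆ hr₇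
    rw [hs n, TVNet.zeta] at hζ hγn hsmall hkkt
    rw [hs n] at hδs hprel
    have hlam₂n := hlam₂ n
    have hgood := TVNet.measure_not_goodPath_le hn (hX n hn) (hA n hn) (hSig' n hn) (heps n hn) hι₁
      hρ₀ hρ₁ hC'0 hK hW hhn hν1 hνWn hLn i₀
    refine (measure_mono ?_).trans (hgood.trans (ENNReal.ofReal_le_ofReal ?_))
    · intro ω hω hG
      refine hω ?_
      have hreg := hG.localRegular (hA n hn) (hSig' n hn) hc.le hK hW hhn hν1 hL0 hB0 hlam₂n hsign
        (hdesign n (h n) hn hhn hbn.1 hνn)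
      rw [← hBγ, mul_div_assoc, ← mul_assoc (3 * W)] at hreg
      exact hreg.estimatedEdges_eq hK (hA n hn) hn hκ₁0 (by positivity) (by positivity) hhn
        (hlam₁ n) hlam₂n hsign hδs hζ hprel hMn hγn hsmall hkkt (hprelim n ω) (hgroup n ω)
    -- It remains to replace n∨d by the smaller n in the denominator.
    · gcongr
      exact le_max_left _ _
  have hprob := TVNet.withProbApproachingOne_of_le hmain
  exact ⟨hprob.tendsto_measure, hprob⟩
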